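/- Fix countably infinite sets of concept names $A$, role names $r$, feature names $f$ and individual names $a$, and for each feature name $f$ a totally ordered domain $\mathrm{dom}(f)$ whose elements are represented by pairwise distinct finite strings. $\mathcal{ALCQI}(f)$ concepts are given by $$C, D ::= \top \mid A \mid \neg C \mid C \sqcap D \mid (\bowtie n\ R.C) \mid (f \bowtie v),$$ where ${\bowtie} \in \{\leq,\geq\}$, $n \ge 0$, $R$ is a role name $r$ or an inverse role $r^-$, and $v \in \mathrm{dom}(f)$; $\mathcal{ALCQ}(f)$ disallows inverse roles, $\mathcal{ALCQI}$ disallows feature comparisons $(f \bowtie v)$, and $\mathcal{ALCQ}$ disallows both. A database $I$ is a finite set of facts $A(a)$, $r(a,b)$, $f(a,v)$ with $v\in\mathrm{dom}(f)$, containing at most one fact $f(a,v)$ for each $a$ and $f$; $\mathrm{adom}(I)$ is the set of individuals occurring in $I$. The extension $C^I \subseteq \mathrm{adom}(I)$ is defined by $\top^I = \mathrm{adom}(I)$, $A^I = \{a \mid A(a) \in I\}$, $(\neg C)^I = \mathrm{adom}(I) \setminus C^I$, $(C \sqcap D)^I = C^I \cap D^I$, $(\bowtie n\ R.C)^I = \{a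 \in \mathrm{adom}(I) \mid |\{b \in C^I \mid R(a,b) \in I\}| \bowtie n\}$, where $r^-(a,b) \in I$ means $r(b,a) \in I$, and $(f \bowtie v)^I = \{a \in \mathrm{adom}(I) \mid f(a,v') \in I \text{ for some } v' \bowtie v\}$. For $P, N \subseteq \mathrm{adom}(I)$, a concept $C$ fits a positive example $a \in P$ if $a \in C^I$, fits a negative example $b \in N$ if $b \notin C^I$, and fits $P,N$ in $I$ if it fits all of them. Theorem. Let $\mathcal{L}$ be one of $\mathcal{ALCQI}(f)$, $\mathcal{ALCQ}(f)$, $\mathcal{ALCQI}$, $\mathcal{ALCQ}$. There is an algorithm, running in time polynomial in the length of its input, which on input a database $I$ and sets $P, N \subseteq \mathrm{adom}(I)$ returns an $\mathcal{L}$ concept $C$, represented as a DAG (that is, as a list of nodes, each of which applies a constructor to earlier nodes, with the numbers in number restrictions written in unary), such that (i) $C$ fits $P,N$ in $I$ whenever some $\mathcal{L}$ concept fits $P,N$ in $I$, and (ii) $|P \cap C^I| + |N \setminus C^I| \geq |P \cap E^I| + |N \setminus E^I|$ for every $\mathcal{L}$ concept $E$. -/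

import Mathlib

namespace DLFitting

/-! ## Syntax

The four countably infinite sets of names are the sets of bit strings; they are kept apart by the
constructors in which they are used. `D f` is the domain of the feature `f`. -/

abbrev ConceptName : Type := List Bool
abbrev RoleName : Type := List Bool
abbrev FeatureName : Type := List Bool
abbrev IndividualName : Type := List Bool

/-- The comparison symbol `≤` or `≥`. -/
inductive Cmp
  | le
  | ge
  deriving DecidableEq

/-- `c.Holds x y` is `x ≤ y` or `x ≥ y`, depending on `c`. -/
def Cmp.Holds {α : Type} [LE α] : Cmp → α → α → Prop
  | .le, x, y => x ≤ y
  | .ge, x, y => x ≥ y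

/-- A role name `r` or an inverse role `r⁻`. -/
inductive Role
  | name (r : RoleName)
  | inverse (r : RoleName)
  deriving DecidableEq

/-- `ALCQI(f)` concepts. -/
inductive Concept (D : FeatureName → Type) : Type
  | top
  | atom (A : ConceptName)
  | neg (C : Concept D)
  | inter (C E : Concept D)
  | restrict (c : Cmp) (n : ℕ) (R : Role) (C : Concept D)
  | feature (c : Cmp) (f : FeatureName) (v : D f)

/-- The description logics under consideration. -/
inductive DL
  | ALCQIf
  | ALCQf
  | ALCQI
  | ALCQ

/-- Are inverse roles available? -/
def DL.AllowsInverse : DL → Prop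
  | .ALCQIf => True
  | .ALCQf => False
  | .ALCQI => True
  | .ALCQ => False

/-- Are feature comparisons available? -/
def DL.AllowsFeatures : DL → Prop
  | .ALCQIf => True
  | .ALCQf => True
  | .ALCQI => False
  | .ALCQ => False

/-- `C.IsIn L`: the concept `C` is an `L` concept. -/
def Concept.IsIn {D : FeatureName → Type} (L : DL) : Concept D → Prop
  | .top => True
  | .atom _ => True
  | .neg C => C.IsIn L
  | .inter C E => C.IsIn L ∧ E.IsIn L
  | .restrict _ _ (.name _) C => C.IsIn L
  | .restrict _ _ (.inverse _) C => L.AllowsInverse ∧ C.IsIn L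
  | .feature _ _ _ => L.AllowsFeatures

/-! ## Databases and semantics -/

/-- Facts `A(a)`, `r(a,b)` and `f(a,v)`. -/
inductive Fact (D : FeatureName → Type) : Type
  | concept (A : ConceptName) (a : IndividualName)
  | role (r : RoleName) (a b : IndividualName)
  | feature (f : FeatureName) (a : IndividualName) (v : D f)

/-- The individuals that occur in a fact. -/
def Fact.individuals {D : FeatureName → Type} : Fact D → Set IndividualName
  | .concept _ a => {a}
  | .role _ a b => {a, b}
  | .feature _ a _ => {a}

/-- A finite set of facts with at most one `f`-value for each individual and feature. -/
structure Database (D : FeatureName → Type) where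
  facts : Finset (Fact D)
  functional : ∀ (f : FeatureName) (a : IndividualName) (v w : D f),
    Fact.feature f a v ∈ facts → Fact.feature f a w ∈ facts → v = w

namespace Database

variable {D : FeatureName → Type}

/-- The active domain: all individuals that occur in the database. -/
def adom (I : Database D) : Set IndividualName :=
  {a | ∃ φ ∈ I.facts, a ∈ φ.individuals}

/-- The `R`-successors of `a`. -/
def succ (I : Database D) : Role → IndividualName → Set IndividualName
  | .name r, a => {b | Fact.role r a b ∈ I.facts}
  | .inverse r, a => {b | Fact.role r b a ∈ I.facts}

/-- The extension of a concept. -/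
def ext [∀ f, LinearOrder (D f)] (I : Database D) : Concept D → Set IndividualName
  | .top => I.adom
  | .atom A => {a | Fact.concept A a ∈ I.facts}
  | .neg C => I.adom \ I.ext C
  | .inter C E => I.ext C ∩ I.ext E
  | .restrict c n R C => {a | a ∈ I.adom ∧ c.Holds (I.succ R a ∩ I.ext C).ncard n}
  | .feature c f v =>
      {a | a ∈ I.adom ∧ ∃ w : D f, Fact.feature f a w ∈ I.facts ∧ c.Holds w v}

/-- The active domain is finite. -/
theorem finite_adom (I : Database D) : I.adom.Finite := by
  have h : I.adom = ⋃ φ ∈ I.facts, φ.individuals := by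
    ext a
    simp [adom]
  rw [h]
  refine Set.Finite.biUnion I.facts.finite_toSet fun φ _ => ?_
  cases φ <;> simp [Fact.individuals]

/-- Successors belong to the active domain, so that they are finite in number. -/
theorem succ_subset_adom (I : Database D) (R : Role) (a : IndividualName) :
    I.succ R a ⊆ I.adom := by
  intro b hb
  cases R with
  | name r => exact ⟨_, hb, by simp [Fact.individuals]⟩
  | inverse r => exact ⟨_, hb, by simp [Fact.individuals]⟩

end Database

/-! ## Fitting -/

section Fitting

variable {D : FeatureName → Type} [∀ f, LinearOrder (D f)]

/-- `C` fits the positive examples `P` and the negative examples `N` in `I`. -/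
def Fits (I : Database D) (P N : Set IndividualName) (C : Concept D) : Prop :=
  (∀ a ∈ P, a ∈ I.ext C) ∧ (∀ b ∈ N, b ∉ I.ext C)

/-- The number of positive examples plus the number of negative examples that `C` fits. -/
noncomputable def numFitted (I : Database D) (P N : Set IndividualName) (C : Concept D) : ℕ :=
  (P ∩ I.ext C).ncard + (N \ I.ext C).ncard

end Fitting

/-- An input `I, P, N` of a fitting algorithm, each of the three finite sets being
written down as a list of its elements. -/
structure Input (D : FeatureName → Type) where
  facts : List (Fact D)
  nodup_facts : facts.Nodup
  functional : ∀ (f : FeatureName) (a : IndividualName) (v w : D f),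
    Fact.feature f a v ∈ facts → Fact.feature f a w ∈ facts → v = w
  pos : List IndividualName
  nodup_pos : pos.Nodup
  pos_occurs : ∀ a ∈ pos, ∃ φ ∈ facts, a ∈ φ.individuals
  neg : List IndividualName
  nodup_neg : neg.Nodup
  neg_occurs : ∀ a ∈ neg, ∃ φ ∈ facts, a ∈ φ.individuals

namespace Input

variable {D : FeatureName → Type}

/-- The database of an input. -/
def db (X : Input D) : Database D where
  facts := ⟨X.facts, X.nodup_facts⟩
  functional := X.functional

/-- The set of positive examples of an input. -/
def P (X : Input D) : Set IndividualName := {a | a ∈ X.pos}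

/-- The set of negative examples of an input. -/
def N (X : Input D) : Set IndividualName := {a | a ∈ X.neg}

end Input

/-! ## Concepts in DAG form -/

/-- A node of a concept DAG. The numbers `i`, `j` point to other nodes. -/
inductive Node (D : FeatureName → Type) : Type
  | top
  | atom (A : ConceptName)
  | neg (i : ℕ)
  | inter (i j : ℕ)
  | restrict (c : Cmp) (n : ℕ) (R : Role) (i : ℕ)
  | feature (c : Cmp) (f : FeatureName) (v : D f)

/-- A DAG is a list of nodes, numbered from `0`, in which nodes point to earlier nodes only;
the last node is the root. -/
abbrev DAG (D : FeatureName → Type) : Type := List (Node D)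

/-- The concept represented by a node, given the concepts represented by the earlier nodes;
`none` if a pointer leads nowhere. -/
def Node.toConcept {D : FeatureName → Type} (cs : List (Concept D)) : Node D → Option (Concept D)
  | .top => some .top
  | .atom A => some (.atom A)
  | .neg i => cs[i]?.map .neg
  | .inter i j => cs[i]?.bind fun C => cs[j]?.map fun E => .inter C E
  | .restrict c n R i => cs[i]?.map (.restrict c n R)
  | .feature c f v => some (.feature c f v)

/-- The list of the concepts represented by the nodes of a DAG, in the order of the nodes;
`none` if some pointer does not lead to an earlier node. -/
def DAG.unfold {D : FeatureName → Type} (g : DAG D) : Option (List (Concept D)) :=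
  g.foldlM (fun cs ν => (ν.toConcept cs).map fun C => cs ++ [C]) []

/-- The concept represented by (the root of) a DAG; `none` if the DAG is empty or malformed. -/
def DAG.toConcept {D : FeatureName → Type} (g : DAG D) : Option (Concept D) :=
  (DAG.unfold g).bind List.getLast?

/-! ## String representations

All strings are over the finite alphabet `Symbol`. Names are written bit by bit; a feature value
`v : D f` is written as the bit string `code f v`; numbers in number restrictions and pointers are
written in unary. -/

inductive Symbol
  | zero
  | one
  | endMark
  | conceptFact
  | roleFact
  | featureFact
  | posExample
  | negExample
  | top
  | atom
  | neg
  | inter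
  | restrict
  | feature
  | le
  | ge
  | roleName
  | inverseRole
  deriving DecidableEq

instance : Fintype Symbol where
  elems := {.zero, .one, .endMark, .conceptFact, .roleFact, .featureFact, .posExample, .negExample,
    .top, .atom, .neg, .inter, .restrict, .feature, .le, .ge, .roleName, .inverseRole}
  complete := by intro x; cases x <;> decide

def encodeBits (w : List Bool) : List Symbol :=
  w.map (fun b => if b then Symbol.one else Symbol.zero) ++ [.endMark]

def encodeUnary (n : ℕ) : List Symbol :=
  List.replicate n .one ++ [.endMark]

def encodeCmp : Cmp → List Symbol
  | .le => [.le]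
  | .ge => [.ge]

def encodeRole : Role → List Symbol
  | .name r => .roleName :: encodeBits r
  | .inverse r => .inverseRole :: encodeBits r

section Encoding

variable {D : FeatureName → Type} (code : ∀ f, D f → List Bool)

def encodeFact : Fact D → List Symbol
  | .concept A a => .conceptFact :: (encodeBits A ++ encodeBits a)
  | .role r a b => .roleFact :: (encodeBits r ++ encodeBits a ++ encodeBits b)
  | .feature f a v => .featureFact :: (encodeBits f ++ encodeBits a ++ encodeBits (code f v))

def encodeInput (X : Input D) : List Symbol :=
  X.facts.flatMap (encodeFact code) ++
    X.pos.flatMap (fun a => .posExample :: encodeBits a) ++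
    X.neg.flatMap (fun a => .negExample :: encodeBits a)

def encodeNode : Node D → List Symbol
  | .top => [.top]
  | .atom A => .atom :: encodeBits A
  | .neg i => .neg :: encodeUnary i
  | .inter i j => .inter :: (encodeUnary i ++ encodeUnary j)
  | .restrict c n R i =>
      .restrict :: (encodeCmp c ++ encodeUnary n ++ encodeRole R ++ encodeUnary i)
  | .feature c f v => .feature :: (encodeCmp c ++ encodeBits f ++ encodeBits (code f v))

def encodeDAG (g : DAG D) : List Symbol :=
  g.flatMap (encodeNode code)

end Encoding

/-! ## Fitting algorithms -/

section Algorithms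

variable {D : FeatureName → Type}

/-- `𝒜` is computed by a Turing machine that runs in polynomial time. -/
def IsPolyTime (code : ∀ f, D f → List Bool) (𝒜 : Input D → DAG D) : Prop :=
  Nonempty (Turing.TM2ComputableInPolyTime (encodeInput code) (encodeDAG code) 𝒜)

variable [∀ f, LinearOrder (D f)]

/-- `𝒜` is a fitting algorithm for `L`: it always returns an `L` concept in DAG form, and this
concept fits the examples whenever some `L` concept does. -/
def IsFittingAlgorithm (L : DL) (𝒜 : Input D → DAG D) : Prop :=
  ∀ X : Input D, ∃ C : Concept D, (𝒜 X).toConcept = some C ∧ C.IsIn L ∧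
    ((∃ E : Concept D, E.IsIn L ∧ Fits X.db X.P X.N E) → Fits X.db X.P X.N C)

/-- The returned concept fits at least as many examples as any other `L` concept. -/
def IsOptimal (L : DL) (𝒜 : Input D → DAG D) : Prop :=
  ∀ X : Input D, ∃ C : Concept D, (𝒜 X).toConcept = some C ∧ C.IsIn L ∧
    ∀ E : Concept D, E.IsIn L → numFitted X.db X.P X.N E ≤ numFitted X.db X.P X.N C

end Algorithms

end DLFitting

/-!
The concepts that are returned come from partition refinement. Start with the relation on the
active domain that relates all individuals. In each round, two related individuals remain related
if they have the same concept names and (where features are available) feature values, and if for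
each available role they have the same numbers of successors in each class
(`Fitting.refinement`). A round that changes the relation removes a pair, so that as many rounds as
there are pairs reach a stable relation (`Fitting.refinement_stable`). By induction on concepts,
no concept tells apart two individuals that a stable relation relates
(`Fitting.mem_ext_iff_of_stable`). Conversely, the algorithm maintains a DAG with a node for each
class, whose extension is the class: to refine a class by one of the tests, it is intersected with
`≥ n R.K ⊓ ≤ n R.K`, where `K` is the concept of an earlier class, with a concept name, with
`f ≥ v ⊓ f ≤ v`, or with the negation of one of the last two (`Fitting.exists_step`). Every concept
includes or excludes each class as a whole, and so the union of those classes that contain at least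
as many positive as negative examples fits as many examples as possible
(`Fitting.numFitted_le_of_stable`). This gives (ii), and (i) follows, since a concept fits all
examples if and only if it fits the largest conceivable number of them (`Fitting.fits_iff`).
All numbers in number restrictions are at most the number of individuals, and each refinement of a
class by a test adds at most five nodes, so that the DAG has polynomial size.

What remains is that the algorithm runs on a Turing machine in polynomial time. Mathlib's
`Turing.TM2ComputableInPolyTime` comes without closure properties, not even under composition.
Therefore a small imperative language for operating on stacks is compiled to `TM2` machines
(`Machine.computable_of_exec`). Data are binary trees, stored in prefix notation on one stack, and
`Machine.PolyTime f` says that some program replaces the code of `a` on top of this stack by the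
code of `f a` within polynomially many steps. This predicate is closed under composition, pairing,
case distinction and iteration over lists, the latter as long as the accumulated value stays of
polynomial size (`Machine.PolyTime.foldl`). The algorithm is written as a list program, and most
goals `PolyTime f` are then solved by `fun_prop`; the exceptions are the iterations, whose sizes are
bounded through the size of the DAG (`Fitting.polyTime_output`).
-/

namespace DLFitting

/-! ### Structured stack programs and their compilation to Turing machines -/

namespace Machine

/-- The stacks: the input and output of the machine, a main stack that holds the data, two
auxiliary stacks, and a stack that serves as a unary counter. -/
inductive Stack
  | inp
  | out
  | main
  | auxA
  | auxB
  | count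
  deriving DecidableEq

instance : Fintype Stack where
  elems := {.inp, .out, .main, .auxA, .auxB, .count}
  complete := by intro x; cases x <;> decide

/-- The finite memory of the machine: two registers, each able to hold the result of a `pop`. -/
abbrev Reg : Type := Option Symbol × Option Symbol

/-- The contents of the registers and of the stacks, the top of a stack being written first. -/
structure Mem where
  reg : Reg
  inp : List Symbol
  out : List Symbol
  main : List Symbol
  auxA : List Symbol
  auxB : List Symbol
  count : List Symbol

namespace Mem

def get (s : Mem) : Stack → List Symbol
  | .inp => s.inp
  | .out => s.out
  | .main => s.main
  | .auxA => s.auxA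
  | .auxB => s.auxB
  | .count => s.count

def set (s : Mem) (k : Stack) (w : List Symbol) : Mem :=
  match k with
  | .inp => { s with inp := w }
  | .out => { s with out := w }
  | .main => { s with main := w }
  | .auxA => { s with auxA := w }
  | .auxB => { s with auxB := w }
  | .count => { s with count := w }

def setReg (s : Mem) (r : Reg) : Mem := { s with reg := r }

theorem get_set (s : Mem) (k : Stack) (w : List Symbol) :
    (s.set k w).get = Function.update s.get k w := by
  funext j
  cases k <;> cases j <;> simp [get, set]

end Mem

/-- Structured programs on the stacks. -/
inductive Prog : Type
  | push (k : Stack) (f : Reg → Symbol)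
  | pop (k : Stack) (f : Reg → Option Symbol → Reg)
  | seq (p q : Prog)
  | ite (c : Reg → Bool) (p q : Prog)
  | loop (c : Reg → Bool) (p : Prog)

infixr:60 " ;; " => Prog.seq

/-- `Exec p s t n`: started in `s`, the program `p` ends in `t` after at most `n` steps. -/
inductive Exec : Prog → Mem → Mem → ℕ → Prop
  | push (k : Stack) (f : Reg → Symbol) (s : Mem) :
      Exec (.push k f) s (s.set k (f s.reg :: s.get k)) 1
  | pop (k : Stack) (f : Reg → Option Symbol → Reg) (s : Mem) :
      Exec (.pop k f) s ((s.set k (s.get k).tail).setReg (f s.reg (s.get k).head?)) 1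
  | seq {p q : Prog} {s t u : Mem} {n m : ℕ} :
      Exec p s t n → Exec q t u m → Exec (p ;; q) s u (n + m)
  | ite_true {c : Reg → Bool} {p q : Prog} {s t : Mem} {n : ℕ} :
      c s.reg = true → Exec p s t n → Exec (.ite c p q) s t (n + 1)
  | ite_false {c : Reg → Bool} {p q : Prog} {s t : Mem} {n : ℕ} :
      c s.reg = false → Exec q s t n → Exec (.ite c p q) s t (n + 1)
  | loop_done {c : Reg → Bool} {p : Prog} {s : Mem} :
      c s.reg = false → Exec (.loop c p) s s 1
  | loop_step {c : Reg → Bool} {p : Prog} {s t u : Mem} {n m : ℕ} :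
      c s.reg = true → Exec p s t n → Exec (.loop c p) t u m →
        Exec (.loop c p) s u (n + m + 1)
  | mono {p : Prog} {s t : Mem} {n m : ℕ} : Exec p s t n → n ≤ m → Exec p s t m

/-- The program points of a program. -/
def Prog.Point : Prog → Type
  | .push _ _ => Unit
  | .pop _ _ => Unit
  | .seq p q => p.Point ⊕ q.Point
  | .ite _ p q => Option (p.Point ⊕ q.Point)
  | .loop _ p => Option p.Point

instance Prog.fintypePoint : (p : Prog) → Fintype p.Point
  | .push _ _ => inferInstanceAs (Fintype Unit)
  | .pop _ _ => inferInstanceAs (Fintype Unit)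
  | .seq p q =>
      haveI := p.fintypePoint
      haveI := q.fintypePoint
      inferInstanceAs (Fintype (p.Point ⊕ q.Point))
  | .ite _ p q =>
      haveI := p.fintypePoint
      haveI := q.fintypePoint
      inferInstanceAs (Fintype (Option (p.Point ⊕ q.Point)))
  | .loop _ p =>
      haveI := p.fintypePoint
      inferInstanceAs (Fintype (Option p.Point))

/-- The program point at which the execution of a program starts. -/
def Prog.entry : (p : Prog) → p.Point
  | .push _ _ => ()
  | .pop _ _ => ()
  | .seq p _ => Sum.inl p.entry
  | .ite _ _ _ => none
  | .loop _ _ => none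

/-- Statements of the Turing machine. -/
abbrev Code (Λ : Type) : Type := Turing.TM2.Stmt (fun _ : Stack => Symbol) Λ Reg

/-- The statement of the Turing machine at a program point, for a program whose points are
embedded into a set `Λ` of labels by `emb` and which jumps to `exit` at its end. -/
def Prog.compile {Λ : Type} : (p : Prog) → (emb : p.Point → Λ) → (exit : Λ) → p.Point → Code Λ
  | .push k f, _, exit, _ => .push k f (.goto fun _ => exit)
  | .pop k f, _, exit, _ => .pop k f (.goto fun _ => exit)
  | .seq p q, emb, exit, l =>
      Sum.elim (p.compile (fun x => emb (Sum.inl x)) (emb (Sum.inr q.entry)))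
        (q.compile (fun x => emb (Sum.inr x)) exit) l
  | .ite c p q, emb, exit, l =>
      match l with
      | none => .branch c (.goto fun _ => emb (some (Sum.inl p.entry)))
          (.goto fun _ => emb (some (Sum.inr q.entry)))
      | some (Sum.inl x) => p.compile (fun x => emb (some (Sum.inl x))) exit x
      | some (Sum.inr x) => q.compile (fun x => emb (some (Sum.inr x))) exit x
  | .loop c p, emb, exit, l =>
      match l with
      | none => .branch c (.goto fun _ => emb (some p.entry)) (.goto fun _ => exit)
      | some x => p.compile (fun x => emb (some x)) (emb none) x

/-- The configuration of the Turing machine with given label and memory. -/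
def cfg {Λ : Type} (l : Option Λ) (s : Mem) : Turing.TM2.Cfg (fun _ : Stack => Symbol) Λ Reg :=
  ⟨l, s.reg, s.get⟩

/-- The Turing machine with program `M` gets from `c` to `d` in at most `n` steps. -/
def StepsLE {Λ : Type} (M : Λ → Code Λ) (c d : Turing.TM2.Cfg (fun _ : Stack => Symbol) Λ Reg)
    (n : ℕ) : Prop :=
  ∃ k ≤ n, (flip bind (Turing.TM2.step M))^[k] (some c) = some d

theorem StepsLE.trans {Λ : Type} {M : Λ → Code Λ}
    {c d e : Turing.TM2.Cfg (fun _ : Stack => Symbol) Λ Reg} {n m : ℕ}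
    (h₁ : StepsLE M c d n) (h₂ : StepsLE M d e m) : StepsLE M c e (n + m) := by
  obtain ⟨k, hk, h₁⟩ := h₁
  obtain ⟨l, hl, h₂⟩ := h₂
  refine ⟨l + k, by omega, ?_⟩
  rw [Function.iterate_add_apply, h₁, h₂]

theorem StepsLE.of_step {Λ : Type} {M : Λ → Code Λ}
    {c d : Turing.TM2.Cfg (fun _ : Stack => Symbol) Λ Reg}
    (h : Turing.TM2.step M c = some d) : StepsLE M c d 1 :=
  ⟨1, le_rfl, h⟩

/-- The Turing machine simulates the program. -/
theorem Exec.stepsLE {p : Prog} {s t : Mem} {n : ℕ} (h : Exec p s t n) {Λ : Type}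
    (M : Λ → Code Λ) (emb : p.Point → Λ) (exit : Λ)
    (hM : ∀ l, M (emb l) = p.compile emb exit l) :
    StepsLE M (cfg (some (emb p.entry)) s) (cfg (some exit) t) n := by
  induction h generalizing exit with
  | push k f s =>
    refine .of_step ?_
    simp [cfg, hM, Prog.compile, Mem.get_set]
    cases k <;> rfl
  | pop k f s =>
    refine .of_step ?_
    simp only [cfg, Turing.TM2.step, hM, Prog.compile, Turing.TM2.stepAux]
    congr 2
    exact (Mem.get_set _ _ _).symm
  | @seq p q s t u n m _ _ ihp ihq =>
    exact (ihp (fun x => emb (Sum.inl x)) (emb (Sum.inr q.entry)) fun l => hM (Sum.inl l)).trans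
      (ihq (fun x => emb (Sum.inr x)) exit fun l => hM (Sum.inr l))
  | @ite_true c p q s t n hc _ ih =>
    rw [add_comm]
    refine StepsLE.trans (d := cfg (some (emb (some (Sum.inl p.entry)))) s) (.of_step ?_)
      (ih (fun x => emb (some (Sum.inl x))) exit fun l => hM (some (Sum.inl l)))
    have e := hM none
    simp only [Prog.compile] at e
    simp [cfg, Prog.entry, e, hc]
  | @ite_false c p q s t n hc _ ih =>
    rw [add_comm]
    refine StepsLE.trans (d := cfg (some (emb (some (Sum.inr q.entry)))) s) (.of_step ?_)
      (ih (fun x => emb (some (Sum.inr x))) exit fun l => hM (some (Sum.inr l)))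
    have e := hM none
    simp only [Prog.compile] at e
    simp [cfg, Prog.entry, e, hc]
  | @loop_done c p s hc =>
    refine .of_step ?_
    have e := hM none
    simp only [Prog.compile] at e
    simp [cfg, Prog.entry, e, hc]
  | @loop_step c p s t u n m hc _ _ ih ihl =>
    rw [add_comm]
    refine StepsLE.trans (d := cfg (some (emb (some p.entry))) s) (.of_step ?_)
      ((ih (fun x => emb (some x)) (emb none) fun l => hM (some l)).trans (ihl emb exit hM))
    have e := hM none
    simp only [Prog.compile] at e
    simp [cfg, Prog.entry, e, hc]
  | mono _ hle ih =>
    obtain ⟨k, hk, h⟩ := ih emb exit hM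
    exact ⟨k, hk.trans hle, h⟩

/-- The Turing machine of a program: it executes the program and then halts. -/
def machine (p : Prog) : Turing.FinTM2 where
  K := Stack
  k₀ := .inp
  k₁ := .out
  Γ _ := Symbol
  Λ := Option p.Point
  main := some p.entry
  σ := Reg
  initialState := (none, none)
  m := fun l => match l with
    | none => .halt
    | some l => p.compile some none l

/-- A function is computable in polynomial time if some program, started with the code of the
argument on the input stack, ends with the code of the value on the output stack and with empty
registers and other stacks, after polynomially many steps. -/
theorem computable_of_exec {α β : Type} {ea : α → List Symbol} {eb : β → List Symbol}
    {f : α → β} (p : Prog) (q : Polynomial ℕ)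
    (h : ∀ a, Exec p ⟨(none, none), ea a, [], [], [], [], []⟩
      ⟨(none, none), [], eb (f a), [], [], [], []⟩ (q.eval (ea a).length)) :
    Nonempty (Turing.TM2ComputableInPolyTime ea eb f) := by
  have key : ∀ a, ∃ k ≤ (q + 1).eval (ea a).length,
      (flip bind (machine p).step)^[k] (some (Turing.initList (machine p) (ea a))) =
        some (Turing.haltList (machine p) (eb (f a))) := by
    intro a
    have h₁ := (h a).stepsLE (machine p).m some none fun l => rfl
    have h₂ : StepsLE (machine p).m
        (cfg (some none) ⟨(none, none), [], eb (f a), [], [], [], []⟩)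
        (cfg none ⟨(none, none), [], eb (f a), [], [], [], []⟩) 1 := .of_step rfl
    obtain ⟨k, hk, h₃⟩ := h₁.trans h₂
    refine ⟨k, by simpa using hk, ?_⟩
    have e₁ : Turing.initList (machine p) (ea a) =
        cfg (some (some p.entry)) ⟨(none, none), ea a, [], [], [], [], []⟩ := by
      unfold Turing.initList cfg
      congr 1
      funext k
      cases k <;> rfl
    have e₂ : Turing.haltList (machine p) (eb (f a)) =
        cfg none ⟨(none, none), [], eb (f a), [], [], [], []⟩ := by
      unfold Turing.haltList cfg
      congr 1
      funext k
      cases k <;> rfl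
    rw [e₁, e₂]
    exact h₃
  choose k hk hk' using key
  exact ⟨{
    tm := machine p
    inputAlphabet := Equiv.refl _
    outputAlphabet := Equiv.refl _
    time := q + 1
    outputsFun := fun a =>
      { steps := k a
        evals_in_steps := by
          have e : ∀ w : List Symbol, List.map (Equiv.refl Symbol).invFun w = w := fun w => by
            simp [Equiv.refl]
          have := hk' a
          rw [← e (ea a), ← e (eb (f a))] at this
          exact this
        steps_le_m := hk a } }⟩

/-! ### Trees on the main stack -/

/-- Binary trees whose leaves are labelled by symbols: the data on which the programs operate. -/
inductive Tree : Type
  | leaf (s : Symbol)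
  | node (l r : Tree)

/-- The prefix code of a tree. -/
def Tree.code : Tree → List Symbol
  | .leaf s => [.zero, s]
  | .node l r => .one :: (l.code ++ r.code)

/-- The length of the code of a tree. -/
def Tree.size (t : Tree) : ℕ := t.code.length

@[simp] theorem Tree.length_code (t : Tree) : t.code.length = t.size := rfl

@[simp] theorem Tree.size_leaf (s : Symbol) : (Tree.leaf s).size = 2 := rfl

@[simp] theorem Tree.size_node (l r : Tree) : (Tree.node l r).size = l.size + r.size + 1 := by
  simp only [Tree.size, Tree.code, List.length_cons, List.length_append]

/-- The code is a prefix code. -/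
theorem Tree.code_append_inj (t : Tree) : ∀ (t' : Tree) {u u' : List Symbol},
    t.code ++ u = t'.code ++ u' → t = t' ∧ u = u' := by
  induction t with
  | leaf s =>
    intro t' u u' h
    cases t' <;> simp_all [Tree.code]
  | node l r ihl ihr =>
    intro t' u u' h
    cases t' with
    | leaf s => simp [Tree.code] at h
    | node l' r' =>
      simp only [Tree.code, List.cons_append, List.append_assoc, List.cons.injEq, true_and] at h
      obtain ⟨hl, h⟩ := ihl l' h
      obtain ⟨hr, h⟩ := ihr r' h
      exact ⟨by rw [hl, hr], h⟩

theorem Tree.code_injective : Function.Injective Tree.code := fun t t' h =>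
  (Tree.code_append_inj t t' (u := []) (u' := []) (by simpa using h)).1

/-- The content of the main stack when it holds the given trees. -/
def codes (ts : List Tree) : List Symbol := ts.flatMap Tree.code

@[simp] theorem codes_nil : codes [] = [] := rfl

@[simp] theorem codes_cons (t : Tree) (ts : List Tree) : codes (t :: ts) = t.code ++ codes ts := rfl

@[simp] theorem codes_append (ts us : List Tree) : codes (ts ++ us) = codes ts ++ codes us := by
  simp [codes]

/-- `Op p xs ys n`: the program `p` replaces the trees `xs` at the top of the main stack by the
trees `ys` in at most `n` steps. It finds and leaves the auxiliary stacks empty, and it does not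
touch the rest of the main stack, nor the input and the output. -/
def Op (p : Prog) (xs ys : List Tree) (n : ℕ) : Prop :=
  ∀ (r : Reg) (i o rest : List Symbol), ∃ r' : Reg,
    Exec p ⟨r, i, o, codes xs ++ rest, [], [], []⟩ ⟨r', i, o, codes ys ++ rest, [], [], []⟩ n

namespace Op

theorem seq {p q : Prog} {xs ys zs : List Tree} {n m : ℕ} (h₁ : Op p xs ys n)
    (h₂ : Op q ys zs m) : Op (p ;; q) xs zs (n + m) := by
  intro r i o rest
  obtain ⟨r₁, h₁⟩ := h₁ r i o rest
  obtain ⟨r₂, h₂⟩ := h₂ r₁ i o rest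
  exact ⟨r₂, h₁.seq h₂⟩

theorem frame {p : Prog} {xs ys : List Tree} {n : ℕ} (h : Op p xs ys n) (zs : List Tree) :
    Op p (xs ++ zs) (ys ++ zs) n := by
  intro r i o rest
  obtain ⟨r', h⟩ := h r i o (codes zs ++ rest)
  exact ⟨r', by simpa using h⟩

theorem mono {p : Prog} {xs ys : List Tree} {n m : ℕ} (h : Op p xs ys n) (hnm : n ≤ m) :
    Op p xs ys m := by
  intro r i o rest
  obtain ⟨r', h⟩ := h r i o rest
  exact ⟨r', h.mono hnm⟩

end Op

/-! ### Basic operations on trees -/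

/-- Pop into the first register. -/
def popX (k : Stack) : Prog := .pop k fun r o => (o, r.2)

/-- Pop into the second register. -/
def popY (k : Stack) : Prog := .pop k fun r o => (r.1, o)

/-- Push the content of the first register. -/
def pushX (k : Stack) : Prog := .push k fun r => r.1.getD .zero

def pushSymbol (k : Stack) (s : Symbol) : Prog := .push k fun _ => s

/-- Does the first register hold the given symbol? -/
def xIs (s : Symbol) (r : Reg) : Bool := decide (r.1 = some s)

/-- Does the first register hold any symbol? -/
def xIsSome (r : Reg) : Bool := r.1.isSome

/-- Move the whole content of one stack to another one. -/
def pour (k l : Stack) : Prog := popX k ;; .loop xIsSome (pushX l ;; popX k)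

theorem exec_pour {k l : Stack} (hkl : k ≠ l) (s : Mem) :
    Exec (pour k l) s (((s.set k []).set l ((s.get k).reverse ++ s.get l)).setReg (none, s.reg.2))
      (3 * (s.get k).length + 2) := by
  have hloop : ∀ (w : List Symbol) (s : Mem), s.reg.1 = w.head? → s.get k = w.tail →
      Exec (.loop xIsSome (pushX l ;; popX k)) s
        (((s.set k []).set l (w.reverse ++ s.get l)).setReg (none, s.reg.2))
        (3 * w.length + 1) := by
    intro w
    induction w with
    | nil =>
      intro s h₁ h₂
      have e : ((s.set k []).set l (([] : List Symbol).reverse ++ s.get l)).setReg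
          (none, s.reg.2) = s := by
        obtain ⟨⟨x, y⟩, _⟩ := s
        simp only [List.head?_nil, List.tail_nil] at h₁ h₂
        subst h₁
        cases k <;> cases l <;> simp_all [Mem.set, Mem.get, Mem.setReg]
      rw [e]
      exact .loop_done (by simp [xIsSome, h₁])
    | cons x w ih =>
      intro s h₁ h₂
      refine .mono (.loop_step (by simp [xIsSome, h₁]) (.seq (.push _ _ _) (.pop _ _ _))
        (n := 2) (m := 3 * w.length + 1) ?_) (by simp; omega)
      convert ih _ ?_ ?_ using 1
      · obtain ⟨⟨x, y⟩, _⟩ := s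
        cases k <;> cases l <;> simp_all [Mem.set, Mem.get, Mem.setReg]
      · cases k <;> cases l <;> simp_all [Mem.set, Mem.get, Mem.setReg]
      · cases k <;> cases l <;> simp_all [Mem.set, Mem.get, Mem.setReg]
  have h := Exec.seq (.pop k (fun r o => (o, r.2)) s)
    (hloop (s.get k) _ rfl (by cases k <;> rfl))
  convert h.mono (m := 3 * (s.get k).length + 2) (by omega) using 1
  · rfl
  · cases k <;> cases l <;> first | exact absurd rfl hkl | rfl

/-- The content of a stack is thrown away. -/
def clear (k : Stack) : Prog := popX k ;; .loop xIsSome (popX k)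

theorem exec_clear (k : Stack) (s : Mem) :
    Exec (clear k) s ((s.set k []).setReg (none, s.reg.2)) (2 * (s.get k).length + 2) := by
  have hloop : ∀ (w : List Symbol) (s : Mem), s.reg.1 = w.head? → s.get k = w.tail →
      Exec (.loop xIsSome (popX k)) s ((s.set k []).setReg (none, s.reg.2))
        (2 * w.length + 1) := by
    intro w
    induction w with
    | nil =>
      intro s h₁ h₂
      have e : (s.set k []).setReg (none, s.reg.2) = s := by
        obtain ⟨⟨x, y⟩, _⟩ := s
        simp only [List.head?_nil, List.tail_nil] at h₁ h₂
        subst h₁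
        cases k <;> simp_all [Mem.set, Mem.get, Mem.setReg]
      rw [e]
      exact .loop_done (by simp [xIsSome, h₁])
    | cons x w ih =>
      intro s h₁ h₂
      refine .mono (.loop_step (by simp [xIsSome, h₁]) (.pop _ _ _)
        (n := 1) (m := 2 * w.length + 1) ?_) (by simp; omega)
      convert ih _ ?_ ?_ using 1
      · obtain ⟨⟨x, y⟩, _⟩ := s
        cases k <;> simp_all [Mem.set, Mem.get, Mem.setReg]
      · cases k <;> simp_all [Mem.set, Mem.get, Mem.setReg]
      · cases k <;> simp_all [Mem.set, Mem.get, Mem.setReg]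
  have h := Exec.seq (.pop k (fun r o => (o, r.2)) s)
    (hloop (s.get k) _ rfl (by cases k <;> rfl))
  convert h.mono (m := 2 * (s.get k).length + 2) (by omega) using 1
  · rfl
  · cases k <;> rfl

/-- One step of `moveTree`: it moves one node and updates the number of pending subtrees. -/
def moveNode (k : Stack) : Prog :=
  popX .main ;; pushX k ;;
  .ite (xIs .one) (pushSymbol .count .one ;; pushSymbol .count .one) (popX .main ;; pushX k) ;;
  popX .count

/-- Move the code of the topmost tree of the main stack to another stack, thereby reversing it.
The counter holds the number of subtrees that have still to be moved. -/
def moveTree (k : Stack) : Prog :=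
  pushSymbol .count .one ;; popX .count ;; .loop xIsSome (moveNode k)

/-- The loop of `moveTree` moves a tree; the rest of its run, which deals with the other pending
subtrees, is given by the hypothesis. -/
theorem exec_moveTree_loop {k : Stack} (hk : k ≠ .main) (hk' : k ≠ .count) (t : Tree) :
    ∀ (s u : Mem) (rest : List Symbol) (m : ℕ), s.reg.1 = some .one → s.main = t.code ++ rest →
      Exec (.loop xIsSome (moveNode k))
        ⟨(s.count.head?, s.reg.2), (s.set k (t.code.reverse ++ s.get k)).inp,
          (s.set k (t.code.reverse ++ s.get k)).out, rest,
          (s.set k (t.code.reverse ++ s.get k)).auxA,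
          (s.set k (t.code.reverse ++ s.get k)).auxB, s.count.tail⟩ u m →
      Exec (.loop xIsSome (moveNode k)) s u (m + 8 * t.size) := by
  induction t with
  | leaf x =>
    intro s u rest m h₁ h₂ h
    obtain ⟨⟨rx, ry⟩, i, o, mn, a, b, c⟩ := s
    simp only at h₁ h₂
    subst h₁ h₂
    refine .mono (.loop_step (by simp [xIsSome]) (.seq (.pop _ _ _) (.seq (.push _ _ _)
      (.seq (.ite_false ?_ (.seq (.pop _ _ _) (.push _ _ _))) (.pop _ _ _)))) (m := m) ?_)
      (show _ ≤ _ by simp; omega)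
    · cases k <;> simp_all [xIs, Mem.setReg, Mem.set, Mem.get, Tree.code]
    · cases k <;> first | exact absurd rfl hk | exact absurd rfl hk' | exact h
  | node l r ihl ihr =>
    intro s u rest m h₁ h₂ h
    obtain ⟨⟨rx, ry⟩, i, o, mn, a, b, c⟩ := s
    simp only at h₁ h₂
    subst h₁ h₂
    refine .mono (.loop_step (by simp [xIsSome]) (.seq (.pop _ _ _) (.seq (.push _ _ _)
      (.seq (.ite_true ?_ (.seq (.push _ _ _) (.push _ _ _))) (.pop _ _ _))))
      (m := m + 8 * r.size + 8 * l.size) ?_) (show _ ≤ _ by simp; omega)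
    · cases k <;> simp_all [xIs, Mem.setReg, Mem.set, Mem.get, Tree.code]
    · refine ihl _ u (r.code ++ rest) _ ?_ ?_ (ihr _ u rest _ ?_ ?_ ?_)
      all_goals cases k <;> first | exact absurd rfl hk | exact absurd rfl hk' | skip
      all_goals first | rfl | (simp [Mem.setReg, Mem.set, Mem.get, Tree.code]; done) |
      simpa [Mem.setReg, Mem.set, Mem.get, Tree.code] using h

theorem exec_moveTree {k : Stack} (hk : k ≠ .main) (hk' : k ≠ .count) (t : Tree) (s : Mem)
    (rest : List Symbol) (hs : s.main = t.code ++ rest) (hc : s.count = []) :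
    Exec (moveTree k) s
      (((s.set .main rest).set k (t.code.reverse ++ s.get k)).setReg (none, s.reg.2))
      (8 * t.size + 3) := by
  obtain ⟨⟨rx, ry⟩, i, o, mn, a, b, c⟩ := s
  simp only at hs hc
  subst hs hc
  refine .mono (.seq (.push _ _ _) (.seq (.pop _ _ _)
    (exec_moveTree_loop hk hk' t _ _ rest 1 rfl rfl ?_))) (show _ ≤ _ by omega)
  cases k <;> first | exact absurd rfl hk | exact absurd rfl hk' | exact .loop_done rfl

/-- Exchange the two topmost trees. -/
def swap : Prog := moveTree .auxA ;; moveTree .auxB ;; pour .auxA .main ;; pour .auxB .main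

theorem op_swap (x y : Tree) : Op swap [x, y] [y, x] (12 * (x.size + y.size) + 12) := by
  intro r i o rest
  refine ⟨(none, r.2), ?_⟩
  have h := Exec.seq (exec_moveTree (k := .auxA) (by decide) (by decide) x
      ⟨r, i, o, x.code ++ (y.code ++ rest), [], [], []⟩ (y.code ++ rest) rfl rfl)
    (.seq (exec_moveTree (k := .auxB) (by decide) (by decide) y _ rest rfl rfl)
    (.seq (exec_pour (k := .auxA) (l := .main) (by decide) _)
      (exec_pour (k := .auxB) (l := .main) (by decide) _)))
  simp only [Mem.set, Mem.get, Mem.setReg, List.append_nil, List.reverse_reverse,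
    List.length_reverse, Tree.length_code] at h
  simpa [swap] using h.mono (by omega)

/-- Remove the topmost tree. -/
def drop : Prog := moveTree .auxA ;; clear .auxA

theorem op_drop (x : Tree) : Op drop [x] [] (10 * x.size + 5) := by
  intro r i o rest
  refine ⟨(none, r.2), ?_⟩
  have h := Exec.seq (exec_moveTree (k := .auxA) (by decide) (by decide) x
      ⟨r, i, o, x.code ++ rest, [], [], []⟩ rest rfl rfl)
    (exec_clear .auxA _)
  simp only [Mem.set, Mem.get, Mem.setReg, List.append_nil,
    List.length_reverse, Tree.length_code] at h
  simpa [drop] using h.mono (by omega)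

/-- Bring the third tree to the top. -/
def rot : Prog :=
  moveTree .auxA ;; moveTree .auxA ;; moveTree .auxB ;; pour .auxA .main ;; pour .auxB .main

theorem op_rot (x y z : Tree) :
    Op rot [x, y, z] [z, x, y] (12 * (x.size + y.size + z.size) + 15) := by
  intro r i o rest
  refine ⟨(none, r.2), ?_⟩
  have h := Exec.seq (exec_moveTree (k := .auxA) (by decide) (by decide) x
      ⟨r, i, o, x.code ++ (y.code ++ (z.code ++ rest)), [], [], []⟩ (y.code ++ (z.code ++ rest))
      rfl rfl)
    (.seq (exec_moveTree (k := .auxA) (by decide) (by decide) y _ (z.code ++ rest) rfl rfl)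
    (.seq (exec_moveTree (k := .auxB) (by decide) (by decide) z _ rest rfl rfl)
    (.seq (exec_pour (k := .auxA) (l := .main) (by decide) _)
      (exec_pour (k := .auxB) (l := .main) (by decide) _))))
  simp only [Mem.set, Mem.get, Mem.setReg, List.append_nil, List.reverse_reverse,
    List.reverse_append, List.length_append, List.length_reverse, Tree.length_code] at h
  simpa [rot] using h.mono (by omega)

/-- Move the content of the stack `auxA` to both the main stack and the stack `auxB`. -/
def copyOut : Prog :=
  popX .auxA ;; .loop xIsSome (pushX .main ;; pushX .auxB ;; popX .auxA)

theorem exec_copyOut (r : Reg) (i o m w : List Symbol) :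
    Exec copyOut ⟨r, i, o, m, w, [], []⟩
      ⟨(none, r.2), i, o, w.reverse ++ m, [], w.reverse, []⟩ (4 * w.length + 2) := by
  have hloop : ∀ (w m b : List Symbol),
      Exec (.loop xIsSome (pushX .main ;; pushX .auxB ;; popX .auxA))
        ⟨(w.head?, r.2), i, o, m, w.tail, b, []⟩
        ⟨(none, r.2), i, o, w.reverse ++ m, [], w.reverse ++ b, []⟩ (4 * w.length + 1) := by
    intro w
    induction w with
    | nil => exact fun m b => .loop_done rfl
    | cons x w ih =>
      intro m b
      refine .mono (.loop_step rfl (.seq (.push _ _ _) (.seq (.push _ _ _) (.pop _ _ _)))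
        (m := 4 * w.length + 1) ?_) (show _ ≤ _ by simp; omega)
      simpa [Mem.set, Mem.get, Mem.setReg] using ih (x :: m) (x :: b)
  refine .mono (.seq (.pop _ _ _) (m := 4 * w.length + 1) ?_) (by omega)
  simpa [Mem.set, Mem.get, Mem.setReg] using hloop w m []

/-- Duplicate the topmost tree. -/
def dup : Prog := moveTree .auxA ;; copyOut ;; pour .auxB .auxA ;; pour .auxA .main

theorem op_dup (x : Tree) : Op dup [x] [x, x] (18 * x.size + 9) := by
  intro r i o rest
  refine ⟨(none, r.2), ?_⟩
  have h := Exec.seq (exec_moveTree (k := .auxA) (by decide) (by decide) x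
      ⟨r, i, o, x.code ++ rest, [], [], []⟩ rest rfl rfl)
    (.seq (exec_copyOut _ _ _ _ _)
    (.seq (exec_pour (k := .auxB) (l := .auxA) (by decide) _)
      (exec_pour (k := .auxA) (l := .main) (by decide) _)))
  simp only [Mem.set, Mem.get, Mem.setReg, List.append_nil, List.reverse_reverse,
    List.length_reverse, Tree.length_code] at h
  simpa [dup] using h.mono (by omega)

/-- Join the two topmost trees to a single one. -/
def join : Prog := pushSymbol .main .one

theorem op_join (x y : Tree) : Op join [x, y] [.node x y] 1 := by
  intro r i o rest
  have := Exec.push .main (fun _ => .one) ⟨r, i, o, codes [x, y] ++ rest, [], [], []⟩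
  exact ⟨r, by simpa [join, pushSymbol, Tree.code, Mem.get, Mem.set] using this⟩

/-- Split the topmost tree into its subtrees. -/
def split : Prog := popX .main

theorem op_split (x y : Tree) : Op split [.node x y] [x, y] 1 := by
  intro r i o rest
  have := Exec.pop .main (fun r o => (o, r.2)) ⟨r, i, o, codes [.node x y] ++ rest, [], [], []⟩
  exact ⟨_, by simpa [split, popX, Tree.code, Mem.get, Mem.set, Mem.setReg] using this⟩

/-- Put a list of symbols on the main stack. -/
def pushWord : List Symbol → Prog
  | [] => popX .auxA
  | s :: w => pushWord w ;; pushSymbol .main s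

theorem exec_pushWord (w : List Symbol) (r : Reg) (i o m : List Symbol) :
    ∃ r', Exec (pushWord w) ⟨r, i, o, m, [], [], []⟩ ⟨r', i, o, w ++ m, [], [], []⟩
      (w.length + 1) := by
  induction w with
  | nil => exact ⟨_, .mono (.pop _ _ _) (by simp)⟩
  | cons s w ih =>
    obtain ⟨r', h⟩ := ih
    exact ⟨r', .mono (h.seq (.push _ _ _)) (by simp)⟩

theorem op_pushWord (x : Tree) : Op (pushWord x.code) [] [x] (x.size + 1) := by
  intro r i o rest
  simpa using exec_pushWord x.code r i o rest

/-- Does the topmost tree consist of more than a leaf? If so, split it and run `p`; otherwise,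
remove it and run `q`. -/
def caseTree (p q : Prog) : Prog := popX .main ;; .ite (xIs .one) p (popX .main ;; q)

theorem op_caseTree_node {p : Prog} (q : Prog) {x y : Tree} {zs us : List Tree} {n : ℕ}
    (h : Op p (x :: y :: zs) us n) : Op (caseTree p q) (.node x y :: zs) us (n + 2) := by
  intro r i o rest
  obtain ⟨r', h⟩ := h (some .one, r.2) i o rest
  refine ⟨r', .mono (.seq (.pop _ _ _) (.ite_true ?_ (n := n) ?_)) (show _ ≤ _ by omega)⟩
  · simp [xIs, Mem.setReg, Mem.get, Tree.code]
  · simpa [Mem.setReg, Mem.get, Mem.set, Tree.code] using h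

theorem op_caseTree_leaf (p : Prog) {q : Prog} {s : Symbol} {zs us : List Tree} {n : ℕ}
    (h : Op q zs us n) : Op (caseTree p q) (.leaf s :: zs) us (n + 3) := by
  intro r i o rest
  obtain ⟨r', h⟩ := h (some s, r.2) i o rest
  refine ⟨r', .mono (.seq (.pop _ _ _) (.ite_false ?_ (.seq (.pop _ _ _) (m := n) ?_)))
    (show _ ≤ _ by omega)⟩
  · simp [xIs, Mem.setReg, Mem.get, Tree.code]
  · simpa [Mem.setReg, Mem.get, Mem.set, Tree.code] using h

/-- Remove the topmost tree, a leaf; run `p` if its label is `s`, and `q` otherwise. -/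
def caseLeaf (s : Symbol) (p q : Prog) : Prog :=
  popX .main ;; popX .main ;; .ite (xIs s) p q

theorem op_caseLeaf_pos {s : Symbol} {p : Prog} (q : Prog) {zs us : List Tree} {n : ℕ}
    (h : Op p zs us n) : Op (caseLeaf s p q) (.leaf s :: zs) us (n + 3) := by
  intro r i o rest
  obtain ⟨r', h⟩ := h (some s, r.2) i o rest
  refine ⟨r', .mono (.seq (.pop _ _ _) (.seq (.pop _ _ _) (.ite_true ?_ (n := n) ?_)))
    (show _ ≤ _ by omega)⟩
  · simp [xIs, Mem.setReg, Mem.get, Mem.set, Tree.code]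
  · simpa [Mem.setReg, Mem.get, Mem.set, Tree.code] using h

theorem op_caseLeaf_neg {s s' : Symbol} (hs : s' ≠ s) (p : Prog) {q : Prog} {zs us : List Tree}
    {n : ℕ} (h : Op q zs us n) : Op (caseLeaf s p q) (.leaf s' :: zs) us (n + 3) := by
  intro r i o rest
  obtain ⟨r', h⟩ := h (some s', r.2) i o rest
  refine ⟨r', .mono (.seq (.pop _ _ _) (.seq (.pop _ _ _) (.ite_false ?_ (n := n) ?_)))
    (show _ ≤ _ by omega)⟩
  · simp [xIs, Mem.setReg, Mem.get, Mem.set, Tree.code, hs]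
  · simpa [Mem.setReg, Mem.get, Mem.set, Tree.code] using h

/-- While the topmost tree is not a leaf, split it and run `p`; finally remove the leaf. -/
def whileNode (p : Prog) : Prog :=
  popX .main ;; .loop (xIs .one) (p ;; popX .main) ;; popX .main

/-- `Iter p xs ys n`: the runs of `p` in the loop `whileNode p` transform `xs` to `ys`. -/
inductive Iter (p : Prog) : List Tree → List Tree → ℕ → Prop
  | done (s : Symbol) (zs : List Tree) : Iter p (.leaf s :: zs) zs 0
  | step {x y : Tree} {zs us vs : List Tree} {n m : ℕ} :
      Op p (x :: y :: zs) us n → Iter p us vs m → Iter p (.node x y :: zs) vs (n + m + 2)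

theorem Iter.op {p : Prog} {xs ys : List Tree} {n : ℕ} (h : Iter p xs ys n) :
    Op (whileNode p) xs ys (n + 3) := by
  have hloop : ∀ (r : Reg) (i o rest : List Symbol), ∃ (r' : Reg) (s : Symbol),
      Exec (.loop (xIs .one) (p ;; popX .main))
        ⟨((codes xs ++ rest).head?, r.2), i, o, (codes xs ++ rest).tail, [], [], []⟩
        ⟨r', i, o, s :: (codes ys ++ rest), [], [], []⟩ (n + 1) := by
    induction h with
    | done s zs =>
      intro r i o rest
      exact ⟨_, s, .loop_done (by simp [xIs, Tree.code])⟩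
    | @step x y zs us vs n m hp _ ih =>
      intro r i o rest
      obtain ⟨r₁, h₁⟩ := hp (some .one, r.2) i o rest
      obtain ⟨r', s, h₂⟩ := ih r₁ i o rest
      have h₃ := Exec.loop_step (c := xIs .one) (by simp [xIs])
        (.seq h₁ (.pop .main (fun r o => (o, r.2)) _)) h₂
      exact ⟨r', s, by simpa [Tree.code, popX] using h₃.mono (by omega)⟩
  intro r i o rest
  obtain ⟨r', s, h'⟩ := hloop r i o rest
  exact ⟨_, .mono (.seq (.pop _ _ _) (.seq h' (.pop _ _ _))) (show _ ≤ _ by omega)⟩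

/-- Do the two registers hold the same symbol? -/
def regEq (r : Reg) : Bool := r.1.isSome && decide (r.1 = r.2)

/-- Compare the contents of the stacks `auxA` and `auxB`, remove them, and put a leaf with the
result on the main stack. -/
def compareAux : Prog :=
  popX .auxA ;; popY .auxB ;; .loop regEq (popX .auxA ;; popY .auxB) ;;
  .ite (fun r => decide (r.1 = r.2)) (pushSymbol .main .one) (pushSymbol .main .zero) ;;
  clear .auxA ;; clear .auxB ;; pushSymbol .main .zero

theorem exec_compareAux (r : Reg) (i o m u v : List Symbol) :
    ∃ r', Exec compareAux ⟨r, i, o, m, u, v, []⟩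
      ⟨r', i, o, .zero :: (if u = v then .one else .zero) :: m, [], [], []⟩
      (5 * u.length + 2 * v.length + 10) := by
  have hloop : ∀ (u v : List Symbol), ∃ (x y : Option Symbol) (u' v' : List Symbol),
      (x = y ↔ u = v) ∧ u'.length ≤ u.length ∧ v'.length ≤ v.length ∧
      Exec (.loop regEq (popX .auxA ;; popY .auxB))
        ⟨(u.head?, v.head?), i, o, m, u.tail, v.tail, []⟩
        ⟨(x, y), i, o, m, u', v', []⟩ (3 * u.length + 1) := by
    intro u
    induction u with
    | nil =>
      intro v
      refine ⟨_, _, _, _, ?_, ?_, ?_, .loop_done rfl⟩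
      · cases v <;> simp
      · simp
      · simp
    | cons a u ih =>
      intro v
      by_cases hv : v.head? = some a
      · obtain ⟨v, rfl⟩ : ∃ v', v = a :: v' := by
          cases v with
          | nil => simp at hv
          | cons b v => simp at hv; exact ⟨v, by rw [hv]⟩
        obtain ⟨x, y, u', v', h₁, h₂, h₃, h₄⟩ := ih v
        refine ⟨x, y, u', v', by simpa using h₁, by simp; omega, by simp; omega,
          .mono (.loop_step (by simp [regEq]) (.seq (.pop _ _ _) (.pop _ _ _)) h₄)
            (show _ ≤ _ by simp; omega)⟩
      · refine ⟨_, _, _, _, ?_, ?_, ?_, .mono (.loop_done ?_) (show 1 ≤ _ by omega)⟩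
        · constructor
          · intro h
            exact absurd h.symm hv
          · rintro rfl
            rfl
        · simp
        · simp
        · simp only [regEq, List.head?_cons, Option.isSome_some, Bool.true_and]
          refine decide_eq_false ?_
          exact fun h => hv (Eq.symm h)
  obtain ⟨x, y, u', v', h₁, h₂, h₃, h₄⟩ := hloop u v
  have h₅ : Exec (.ite (fun r => decide (r.1 = r.2)) (pushSymbol .main .one)
      (pushSymbol .main .zero)) ⟨(x, y), i, o, m, u', v', []⟩
      ⟨(x, y), i, o, (if u = v then .one else .zero) :: m, u', v', []⟩ 2 := by
    by_cases huv : u = v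
    · rw [if_pos huv]
      exact .ite_true (by simpa using h₁.2 huv) (.push _ _ _)
    · rw [if_neg huv]
      exact .ite_false (by simpa using fun h => huv (h₁.1 h)) (.push _ _ _)
  exact ⟨_, .mono (.seq (.pop _ _ _) (.seq (.pop _ _ _) (.seq h₄ (.seq h₅
    (.seq (exec_clear .auxA _) (.seq (exec_clear .auxB _) (.push _ _ _)))))))
    (show _ ≤ _ by simp only [Mem.get, Mem.set, Mem.setReg]; omega)⟩

/-- Replace the two topmost trees by a leaf that tells whether they are equal. -/
def eqTree : Prog := moveTree .auxA ;; moveTree .auxB ;; compareAux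

open Classical in
theorem op_eqTree (x y : Tree) : Op eqTree [x, y] [.leaf (if x = y then .one else .zero)]
    (13 * x.size + 10 * y.size + 16) := by
  intro r i o rest
  obtain ⟨r', hr⟩ := exec_compareAux (none, r.2) i o rest x.code.reverse y.code.reverse
  refine ⟨r', ?_⟩
  have h := Exec.seq (exec_moveTree (k := .auxA) (by decide) (by decide) x
      ⟨r, i, o, x.code ++ (y.code ++ rest), [], [], []⟩ (y.code ++ rest) rfl rfl)
    (.seq (exec_moveTree (k := .auxB) (by decide) (by decide) y _ rest rfl rfl)
      (m := 5 * x.size + 2 * y.size + 10)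
      (by simpa [Mem.set, Mem.get, Mem.setReg] using hr))
  have e : (if x.code.reverse = y.code.reverse then Symbol.one else .zero) =
      if x = y then Symbol.one else .zero := by
    simp [Tree.code_injective.eq_iff]
  rw [← e]
  simpa [Tree.code, eqTree] using h.mono (by omega)

/-! ### Functions computable in polynomial time, on data coded by trees -/

/-- An injective coding of the elements of a type by trees. -/
class Enc (α : Type) where
  tree : α → Tree
  injective : Function.Injective tree

/-- The length of the code of a datum. -/
def size {α : Type} [Enc α] (a : α) : ℕ := (Enc.tree a).size

@[simp] theorem size_tree {α : Type} [Enc α] (a : α) : (Enc.tree a).size = size a := rfl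

instance : Enc Symbol := ⟨.leaf, fun _ _ h => by injection h⟩

instance : Enc Bool :=
  ⟨fun b => .leaf (bif b then .one else .zero), fun a b h => by cases a <;> cases b <;> simp_all⟩

instance : Enc Unit := ⟨fun _ => .leaf .zero, fun _ _ _ => rfl⟩

instance {α β : Type} [Enc α] [Enc β] : Enc (α × β) :=
  ⟨fun p => .node (Enc.tree p.1) (Enc.tree p.2), fun p q h => by
    injection h with h₁ h₂
    exact Prod.ext (Enc.injective h₁) (Enc.injective h₂)⟩

/-- A list is coded by nesting its elements to the right. -/
def listTree {α : Type} [Enc α] : List α → Tree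
  | [] => .leaf .zero
  | a :: l => .node (Enc.tree a) (listTree l)

instance {α : Type} [Enc α] : Enc (List α) :=
  ⟨listTree, fun l => by
    induction l with
    | nil => intro l' h; cases l' <;> simp_all [listTree]
    | cons a l ih =>
      intro l' h
      cases l' with
      | nil => simp [listTree] at h
      | cons b l' =>
        simp only [listTree, Tree.node.injEq] at h
        rw [Enc.injective h.1, ih h.2]⟩

/-- Natural numbers are coded in unary. -/
instance : Enc ℕ :=
  ⟨fun n => Enc.tree (List.replicate n ()), fun n m h => by
    simpa using congrArg List.length (Enc.injective h)⟩

section Size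

variable {α β : Type} [Enc α] [Enc β]

@[simp] theorem size_symbol (s : Symbol) : size s = 2 := rfl

@[simp] theorem size_bool (b : Bool) : size b = 2 := rfl

@[simp] theorem size_unit (u : Unit) : size u = 2 := rfl

@[simp] theorem size_prod (a : α) (b : β) : size (a, b) = size a + size b + 1 :=
  Tree.size_node _ _

@[simp] theorem size_nil : size ([] : List α) = 2 := rfl

@[simp] theorem size_cons (a : α) (l : List α) : size (a :: l) = size a + size l + 1 :=
  Tree.size_node _ _

theorem size_append (l l' : List α) : size (l ++ l') + 2 = size l + size l' := by
  induction l with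
  | nil => simp; omega
  | cons a l ih => simp; omega

@[simp] theorem size_nat (n : ℕ) : size n = 3 * n + 2 := by
  have : ∀ n, size (List.replicate n ()) = 3 * n + 2 := by
    intro n
    induction n with
    | zero => rfl
    | succ n ih => simp [List.replicate_succ, ih]; omega
  exact this n

theorem size_le_of_mem {a : α} {l : List α} (h : a ∈ l) : size a ≤ size l := by
  induction l with
  | nil => simp at h
  | cons b l ih =>
    rcases List.mem_cons.1 h with rfl | h
    · simp; omega
    · have := ih h; simp; omega

theorem length_le_size (l : List α) : l.length ≤ size l := by
  induction l with
  | nil => simp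
  | cons b l ih => simp; omega

theorem size_le_of_sublist {l l' : List α} (h : l.Sublist l') : size l ≤ size l' := by
  induction h with
  | slnil => simp
  | cons a _ ih => simp; omega
  | cons_cons a _ ih => simp; omega

theorem size_le_length_mul {l : List α} {n : ℕ} (h : ∀ a ∈ l, size a ≤ n) :
    size l ≤ l.length * (n + 1) + 2 := by
  induction l with
  | nil => simp
  | cons a l ih =>
    have h₁ := h a (by simp)
    have h₂ := ih fun b hb => h b (by simp [hb])
    simp only [size_cons, List.length_cons]
    linarith [Nat.succ_mul l.length (n + 1)]

end Size

/-- Polynomials with natural coefficients are monotone. -/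
theorem eval_mono (q : Polynomial ℕ) {n m : ℕ} (h : n ≤ m) : q.eval n ≤ q.eval m := by
  rw [Polynomial.eval_eq_sum, Polynomial.eval_eq_sum, Polynomial.sum, Polynomial.sum]
  gcongr

/-- `f` is computed by a program in polynomial time. -/
@[fun_prop]
def PolyTime {α β : Type} [Enc α] [Enc β] (f : α → β) : Prop :=
  ∃ (p : Prog) (q : Polynomial ℕ), ∀ a, Op p [Enc.tree a] [Enc.tree (f a)] (q.eval (size a))

/-- In `n` steps, the main stack grows by at most `n` symbols. -/
theorem Exec.length_main_le {p : Prog} {s t : Mem} {n : ℕ} (h : Exec p s t n) :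
    t.main.length ≤ s.main.length + n := by
  induction h with
  | push k f s => cases k <;> simp [Mem.set, Mem.get]
  | pop k f s => cases k <;> simp [Mem.set, Mem.get, Mem.setReg]; omega
  | _ => omega

namespace PolyTime

variable {α β γ δ σ : Type} [Enc α] [Enc β] [Enc γ] [Enc δ] [Enc σ]

/-- The size of the value is polynomially bounded. -/
theorem size_le {f : α → β} (hf : PolyTime f) :
    ∃ q : Polynomial ℕ, ∀ a, size (f a) ≤ q.eval (size a) := by
  obtain ⟨p, q, h⟩ := hf
  refine ⟨.X + q, fun a => ?_⟩
  obtain ⟨r', h⟩ := h a (none, none) [] [] []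
  simpa using h.length_main_le

theorem of_op {f : α → β} (p : Prog) (q : Polynomial ℕ) (c : α → ℕ)
    (h : ∀ a, Op p [Enc.tree a] [Enc.tree (f a)] (c a)) (hc : ∀ a, c a ≤ q.eval (size a)) :
    PolyTime f :=
  ⟨p, q, fun a => (h a).mono (hc a)⟩

@[fun_prop] theorem comp {g : β → γ} {f : α → β} (hg : PolyTime g) (hf : PolyTime f) :
    PolyTime fun a => g (f a) := by
  obtain ⟨s, hs⟩ := hf.size_le
  obtain ⟨p, q, hf⟩ := hf
  obtain ⟨p', q', hg⟩ := hg
  refine of_op (p ;; p') (q + q'.comp s) _ (fun a => (hf a).seq (hg (f a))) fun a => ?_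
  simpa using eval_mono q' (hs a)

/-- A function that changes the type but not the code. -/
theorem of_tree_eq {f : α → β} (h : ∀ a, Enc.tree (f a) = Enc.tree a) : PolyTime f := by
  refine of_op (popX .auxA) 1 (fun _ => 1) (fun a r i o rest => ?_) (by simp)
  have := Exec.pop .auxA (fun r o => (o, r.2)) ⟨r, i, o, codes [Enc.tree a] ++ rest, [], [], []⟩
  exact ⟨_, by simpa [popX, h, Mem.get, Mem.set, Mem.setReg] using this⟩

@[fun_prop] theorem id' : PolyTime fun a : α => a := of_tree_eq fun _ => rfl

@[fun_prop] theorem const (b : β) : PolyTime fun _ : α => b := by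
  refine of_op (drop ;; pushWord (Enc.tree b).code) (10 * .X + 5 + .C (size b + 1)) _
    (fun a => (op_drop _).seq (op_pushWord _)) fun a => ?_
  simp

/-- A pair of functions: the argument is duplicated, and the functions are applied one after the
other. -/
@[fun_prop] theorem pair {f : α → β} {g : α → γ} (hf : PolyTime f) (hg : PolyTime g) :
    PolyTime fun a => (f a, g a) := by
  obtain ⟨s, hs⟩ := hg.size_le
  obtain ⟨p, q, hf⟩ := hf
  obtain ⟨p', q', hg⟩ := hg
  refine of_op (dup ;; p' ;; swap ;; p ;; join)
    (18 * .X + 9 + q' + (12 * (s + .X) + 12) + q + 1) _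
    (fun a => (op_dup _).seq (((hg a).frame _).seq ((op_swap _ _).seq
      (((hf a).frame _).seq (op_join _ _))))) fun a => ?_
  have := hs a
  simp
  omega

theorem fst' : PolyTime (Prod.fst : α × β → α) := by
  refine of_op (split ;; swap ;; drop) (22 * .X + 20) _
    (fun a => (op_split _ _).seq ((op_swap _ _).seq ((op_drop _).frame [_]))) fun a => ?_
  obtain ⟨a, b⟩ := a
  simp
  omega

theorem snd' : PolyTime (Prod.snd : α × β → β) := by
  refine of_op (split ;; drop) (10 * .X + 20) _
    (fun a => (op_split _ _).seq ((op_drop _).frame [_])) fun a => ?_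
  obtain ⟨a, b⟩ := a
  simp
  omega

@[fun_prop] theorem fst {f : α → β × γ} (hf : PolyTime f) : PolyTime fun a => (f a).1 :=
  fst'.comp hf

@[fun_prop] theorem snd {f : α → β × γ} (hf : PolyTime f) : PolyTime fun a => (f a).2 :=
  snd'.comp hf

@[fun_prop] theorem cond {c : α → Bool} {f g : α → β} (hc : PolyTime c) (hf : PolyTime f)
    (hg : PolyTime g) : PolyTime fun a => cond (c a) (f a) (g a) := by
  obtain ⟨p₀, q₀, hc⟩ := hc
  obtain ⟨p, q, hf⟩ := hf
  obtain ⟨p', q', hg⟩ := hg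
  refine of_op (dup ;; p₀ ;; caseLeaf .one p p') (18 * .X + 9 + q₀ + q + q' + 3)
    (fun a => 18 * size a + 9 + (q₀.eval (size a) + (q.eval (size a) + q'.eval (size a) + 3)))
    (fun a => (op_dup _).seq (((hc a).frame _).seq ?_)) fun a => ?_
  · cases h : c a
    · exact op_caseLeaf_neg (by simp) p ((hg a).mono (by simp))
    · exact op_caseLeaf_pos p' ((hf a).mono (by simp))
  · simp
    omega

end PolyTime

open Classical in
/-- Equality as a function with truth values. -/
noncomputable def eqB {α : Type} (a b : α) : Bool := decide (a = b)

@[simp] theorem eqB_iff {α : Type} {a b : α} : eqB a b = true ↔ a = b := by simp [eqB]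

namespace PolyTime

variable {α β γ δ σ : Type} [Enc α] [Enc β] [Enc γ] [Enc δ] [Enc σ]

@[fun_prop] theorem eqB {f g : α → β} (hf : PolyTime f) (hg : PolyTime g) :
    PolyTime fun a => eqB (f a) (g a) := by
  have h : PolyTime fun p : β × β => Machine.eqB p.1 p.2 := by
    refine of_op (split ;; eqTree) (13 * .X + 20)
      (fun p => 1 + (13 * size p.1 + 10 * size p.2 + 16)) (fun p => ?_) fun p => ?_
    · have h := (op_split _ _).seq (op_eqTree (Enc.tree p.1) (Enc.tree p.2))
      have e (b : Bool) : Enc.tree b = .leaf (bif b then .one else .zero) := rfl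
      rw [e, Machine.eqB, show Enc.tree p = .node (Enc.tree p.1) (Enc.tree p.2) from rfl]
      by_cases hp : p.1 = p.2
      · rw [if_pos (congrArg _ hp)] at h
        simpa [hp] using h
      · rw [if_neg fun h => hp (Enc.injective h)] at h
        simpa [hp] using h
    · obtain ⟨a, b⟩ := p
      simp
      omega
  exact h.comp (hf.pair hg)

@[fun_prop] theorem cons {f : α → β} {l : α → List β} (hf : PolyTime f) (hl : PolyTime l) :
    PolyTime fun a => f a :: l a :=
  (of_tree_eq (f := fun p : β × List β => p.1 :: p.2) fun _ => rfl).comp (hf.pair hl)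

@[fun_prop] theorem succ {f : α → ℕ} (hf : PolyTime f) : PolyTime fun a => f a + 1 :=
  (of_tree_eq (f := fun p : Unit × ℕ => p.2 + 1) fun _ => by
    simp [Enc.tree, List.replicate_succ, listTree]).comp ((const ()).pair hf)

@[fun_prop] theorem replicate_unit {f : α → ℕ} (hf : PolyTime f) :
    PolyTime fun a => List.replicate (f a) () :=
  (of_tree_eq (f := fun n : ℕ => List.replicate n ()) fun _ => rfl).comp hf

@[fun_prop] theorem isEmpty {l : α → List β} (hl : PolyTime l) :
    PolyTime fun a => (l a).isEmpty := by
  have : (fun a => (l a).isEmpty) = fun a => Machine.eqB (l a) [] := by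
    funext a
    rw [Bool.eq_iff_iff]
    simp
  rw [this]
  fun_prop

@[fun_prop] theorem tail {l : α → List β} (hl : PolyTime l) : PolyTime fun a => (l a).tail := by
  refine PolyTime.comp (g := List.tail) ?_ hl
  refine of_op (caseTree drop (pushSymbol .main .zero ;; pushSymbol .main .zero)) (10 * .X + 10)
    (fun l => 10 * size l + 10) (fun l => ?_) (by simp)
  cases l with
  | nil =>
    refine (op_caseTree_leaf _ (zs := []) (n := 2) fun r i o rest => ⟨r, ?_⟩).mono (by simp)
    exact .seq (.push _ _ _) (.push _ _ _)
  | cons a l =>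
    exact (op_caseTree_node _ ((op_drop (Enc.tree a)).frame [Enc.tree l])).mono
      (by simp; omega)

@[fun_prop] theorem headD {l : α → List β} {f : α → β} (hl : PolyTime l) (hf : PolyTime f) :
    PolyTime fun a => (l a).headD (f a) := by
  refine PolyTime.comp (g := fun p : List β × β => p.1.headD p.2) ?_ (hl.pair hf)
  refine of_op (split ;; caseTree (swap ;; drop ;; swap ;; drop) (popX .auxA)) (100 * .X + 100)
    (fun p => 100 * size p + 100) (fun p => ?_) (by simp)
  obtain ⟨l, b⟩ := p
  cases l with
  | nil =>
    refine ((op_split _ _).seq (op_caseTree_leaf _ (zs := [_]) (n := 1) fun r i o rest =>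
      ⟨_, .pop _ _ _⟩)).mono (by simp)
  | cons a l =>
    exact ((op_split _ _).seq (op_caseTree_node _ (((op_swap (Enc.tree a) (Enc.tree l)).frame
      [Enc.tree b]).seq (((op_drop _).frame [_, _]).seq ((op_swap _ _).seq
      ((op_drop _).frame [_])))))).mono (by simp; omega)

/-- The loop that computes a fold: the list is on top of the current value. -/
theorem iter_foldl {f : σ × β → σ} {p : Prog} {q : Polynomial ℕ}
    (hf : ∀ a, Op p [Enc.tree a] [Enc.tree (f a)] (q.eval (size a))) (B : ℕ) :
    ∀ (l : List β) (s : σ), size l ≤ B →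
      (∀ l', l' <+: l → size (l'.foldl (fun s b => f (s, b)) s) ≤ B) →
      Iter (rot ;; join ;; p ;; swap) [Enc.tree l, Enc.tree s]
        [Enc.tree (l.foldl (fun s b => f (s, b)) s)]
        (l.length * (60 * B + 30 + q.eval (2 * B + 1))) := by
  intro l
  induction l with
  | nil =>
    intro s _ _
    rw [List.length_nil, Nat.zero_mul]
    exact .done .zero [Enc.tree s]
  | cons b l ih =>
    intro s hl hs
    have h₁ := hs [] (by simp)
    have h₂ := hs [b] (by simp)
    simp only [List.foldl_nil, List.foldl_cons] at h₁ h₂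
    have h := ih (f (s, b)) (by simp at hl; omega) fun l' hl' => by
      simpa using hs (b :: l') (by simpa using hl')
    have hop := (op_rot (Enc.tree b) (Enc.tree l) (Enc.tree s)).seq
      (((op_join (Enc.tree s) (Enc.tree b)).frame [Enc.tree l]).seq
      (((hf (s, b)).frame [Enc.tree l]).seq (op_swap _ _)))
    have hq := eval_mono q (n := size (s, b)) (m := 2 * B + 1) (by simp at hl ⊢; omega)
    have e : Enc.tree (b :: l) = .node (Enc.tree b) (Enc.tree l) := rfl
    rw [e]
    have hn : size b + size l + 1 ≤ B := by simpa using hl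
    refine Eq.mp ?_ (Iter.step (hop.mono (m := 60 * B + 28 + q.eval (2 * B + 1)) ?_) h)
    · congr 1
      simp only [List.length_cons]
      ring
    · simp only [size] at hq h₁ h₂ hn ⊢
      omega

/-- A fold over a list whose intermediate values are of polynomially bounded size. -/
theorem foldl {l : α → List β} {s : α → σ} {f : α → σ → β → σ} (hl : PolyTime l)
    (hs : PolyTime s) (hf : PolyTime fun p : α × σ × β => f p.1 p.2.1 p.2.2) (q : Polynomial ℕ)
    (hq : ∀ a l', l' <+: l a → size (l'.foldl (f a) (s a)) ≤ q.eval (size a)) :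
    PolyTime fun a => (l a).foldl (f a) (s a) := by
  -- The fold is computed together with its parameter `a`.
  have hg : PolyTime fun p : (α × σ) × β => (p.1.1, f p.1.1 p.1.2 p.2) := by
    refine pair (by fun_prop) ?_
    exact hf.comp (f := fun p : (α × σ) × β => (p.1.1, p.1.2, p.2)) (by fun_prop)
  have hfold : ∀ a (l : List β) (s : σ),
      l.foldl (fun (s : α × σ) b => (s.1, f s.1 s.2 b)) (a, s) = (a, l.foldl (f a) s) := by
    intro a l
    induction l with
    | nil => intro s; rfl
    | cons b l ih => intro s; simp [ih]
  suffices h : PolyTime fun a => (l a).foldl (fun (s : α × σ) b => (s.1, f s.1 s.2 b)) (a, s a) by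
    simp only [hfold] at h
    exact snd h
  obtain ⟨p, t, hg⟩ := hg
  obtain ⟨p₀, t₀, h₀⟩ : PolyTime fun a => (l a, a, s a) := by fun_prop
  obtain ⟨tl, htl⟩ := hl.size_le
  let B : Polynomial ℕ := tl + .X + q + 1
  refine of_op (p₀ ;; split ;; whileNode (rot ;; join ;; p ;; swap))
    (t₀ + 1 + tl * (60 * B + 30 + t.comp (2 * B + 1)) + 3)
    _ (fun a => (h₀ a).seq ((op_split _ _).seq (iter_foldl hg (B.eval (size a)) _ _ ?_ ?_).op))
    fun a => ?_
  · have := htl a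
    simp only [B, Polynomial.eval_add, Polynomial.eval_one]
    omega
  · intro l' hl'
    have h₂ := hq a l' hl'
    simp only [hfold, B, Polynomial.eval_add, Polynomial.eval_X, Polynomial.eval_one, size_prod]
    omega
  · have h₁ := (length_le_size (l a)).trans (htl a)
    have h₂ :=
      Nat.mul_le_mul_right (60 * B.eval (size a) + 30 + t.eval (2 * B.eval (size a) + 1)) h₁
    simp only [Polynomial.eval_add, Polynomial.eval_mul, Polynomial.eval_comp, Polynomial.eval_one,
      Polynomial.eval_ofNat]
    omega

/-- A fold each step of which adds a polynomially bounded number to the size of the value. -/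
theorem foldl_of_add {l : α → List β} {s : α → σ} {f : α → σ → β → σ} (hl : PolyTime l)
    (hs : PolyTime s) (hf : PolyTime fun p : α × σ × β => f p.1 p.2.1 p.2.2) (q : Polynomial ℕ)
    (hq : ∀ a s b, size (f a s b) ≤ size s + q.eval (size a + size b)) :
    PolyTime fun a => (l a).foldl (f a) (s a) := by
  obtain ⟨tl, htl⟩ := hl.size_le
  obtain ⟨ts, hts⟩ := hs.size_le
  refine foldl hl hs hf (ts + tl * q.comp (.X + tl)) fun a l' hl' => ?_
  have key : ∀ (l'' : List β) (n : ℕ) (s : σ), (∀ b ∈ l'', size b ≤ n) →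
      size (l''.foldl (f a) s) ≤ size s + l''.length * q.eval (size a + n) := by
    intro l'' n
    induction l'' with
    | nil => simp
    | cons b l'' ih =>
      intro s hb
      have h₁ := ih (f a s b) fun b hb' => hb b (by simp [hb'])
      have h₂ := hq a s b
      have h₃ := eval_mono q (Nat.add_le_add_left (hb b (by simp)) (size a))
      simp only [List.foldl_cons, List.length_cons, Nat.succ_mul]
      omega
  have h₁ := key l' (tl.eval (size a)) (s a) fun b hb =>
    (size_le_of_mem (hl'.subset hb)).trans (htl a)
  have h₂ : l'.length ≤ tl.eval (size a) :=
    (hl'.length_le.trans (length_le_size _)).trans (htl a)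
  have h₃ := Nat.mul_le_mul_right (q.eval (size a + tl.eval (size a))) h₂
  have h₄ := hts a
  simp only [Polynomial.eval_add, Polynomial.eval_mul, Polynomial.eval_comp, Polynomial.eval_X]
  omega

end PolyTime

/-! ### List functions computable in polynomial time -/

/-- Membership as a function with truth values. -/
noncomputable def memB {α : Type} (a : α) (l : List α) : Bool := l.any fun b => eqB a b

@[simp] theorem memB_iff {α : Type} {a : α} {l : List α} : memB a l = true ↔ a ∈ l := by
  simp [memB]

/-- Remove repetitions. -/
noncomputable def dedupB {α : Type} (l : List α) : List α :=
  l.foldl (fun acc a => bif memB a acc then acc else a :: acc) []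

theorem dedupB_spec {α : Type} (l : List α) : (dedupB l).Nodup ∧ ∀ a, a ∈ dedupB l ↔ a ∈ l := by
  have key : ∀ (l acc : List α), acc.Nodup →
      (l.foldl (fun acc a => bif memB a acc then acc else a :: acc) acc).Nodup ∧
      ∀ a, a ∈ l.foldl (fun acc a => bif memB a acc then acc else a :: acc) acc ↔
        a ∈ acc ∨ a ∈ l := by
    intro l
    induction l with
    | nil => intro acc h; simpa using h
    | cons b l ih =>
      intro acc h
      rw [List.foldl_cons]
      by_cases hb : b ∈ acc
      · rw [memB_iff.2 hb, cond_true]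
        refine ⟨(ih acc h).1, fun a => ?_⟩
        rw [(ih acc h).2, List.mem_cons]
        exact ⟨fun h => h.imp_right .inr, fun h => h.elim .inl fun h => h.elim
          (fun h => .inl (h ▸ hb)) .inr⟩
      · rw [show memB b acc = false from Bool.eq_false_iff.2 (mt memB_iff.1 hb), cond_false]
        have h' : (b :: acc).Nodup := List.nodup_cons.2 ⟨hb, h⟩
        refine ⟨(ih _ h').1, fun a => ?_⟩
        rw [(ih _ h').2, List.mem_cons, List.mem_cons]
        tauto
  refine ⟨(key l [] List.nodup_nil).1, fun a => ?_⟩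
  rw [dedupB, (key l [] List.nodup_nil).2]
  simp

namespace PolyTime

variable {α β γ δ σ : Type} [Enc α] [Enc β] [Enc γ] [Enc δ] [Enc σ]

@[fun_prop] theorem not {c : α → Bool} (hc : PolyTime c) : PolyTime fun a => !c a := by
  have : (fun a => !c a) = fun a => bif c a then false else true := by
    funext a; cases c a <;> rfl
  rw [this]
  fun_prop

@[fun_prop] theorem and {c d : α → Bool} (hc : PolyTime c) (hd : PolyTime d) :
    PolyTime fun a => c a && d a := by
  have : (fun a => c a && d a) = fun a => bif c a then d a else false := by
    funext a; cases c a <;> rfl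
  rw [this]
  fun_prop

@[fun_prop] theorem or {c d : α → Bool} (hc : PolyTime c) (hd : PolyTime d) :
    PolyTime fun a => c a || d a := by
  have : (fun a => c a || d a) = fun a => bif c a then true else d a := by
    funext a; cases c a <;> rfl
  rw [this]
  fun_prop

@[fun_prop] theorem reverse {l : α → List β} (hl : PolyTime l) :
    PolyTime fun a => (l a).reverse := by
  have e (a : α) : (l a).reverse = (l a).foldl (fun acc b => b :: acc) [] := by simp
  simp only [e]
  refine foldl_of_add (f := fun _ acc b => b :: acc) hl (const _) (by fun_prop) (.X + 1)
    fun a s b => ?_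
  simp
  omega

@[fun_prop] theorem append {l l' : α → List β} (hl : PolyTime l) (hl' : PolyTime l') :
    PolyTime fun a => l a ++ l' a := by
  have e (a : α) : l a ++ l' a = (l a).reverse.foldl (fun acc b => b :: acc) (l' a) := by simp
  simp only [e]
  refine foldl_of_add (f := fun _ acc b => b :: acc) hl.reverse hl' (by fun_prop) (.X + 1)
    fun a s b => ?_
  simp
  omega

@[fun_prop] theorem map {l : α → List β} {f : α → β → γ} (hl : PolyTime l)
    (hf : PolyTime fun p : α × β => f p.1 p.2) : PolyTime fun a => (l a).map (f a) := by
  have e (a : α) : (l a).map (f a) = ((l a).foldl (fun acc b => f a b :: acc) []).reverse := by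
    have : ∀ (l : List β) (acc : List γ),
        l.foldl (fun acc b => f a b :: acc) acc = (l.map (f a)).reverse ++ acc := by
      intro l
      induction l with
      | nil => simp
      | cons b l ih => simp [ih]
    simp [this]
  simp only [e]
  obtain ⟨q, hq⟩ := hf.size_le
  refine reverse (foldl_of_add (f := fun a acc b => f a b :: acc) hl (const _)
    (cons (hf.comp (f := fun p : α × List γ × β => (p.1, p.2.2)) (by fun_prop)) (by fun_prop))
    (q.comp (.X + 1) + 1) fun a s b => ?_)
  have := hq (a, b)
  simp at this ⊢
  omega

@[fun_prop] theorem flatMap {l : α → List β} {f : α → β → List γ} (hl : PolyTime l)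
    (hf : PolyTime fun p : α × β => f p.1 p.2) : PolyTime fun a => (l a).flatMap (f a) := by
  have e (a : α) : (l a).flatMap (f a) = (l a).foldl (fun acc b => acc ++ f a b) [] := by
    have : ∀ (l : List β) (acc : List γ),
        l.foldl (fun acc b => acc ++ f a b) acc = acc ++ l.flatMap (f a) := by
      intro l
      induction l with
      | nil => simp
      | cons b l ih => simp [ih]
    simp [this]
  simp only [e]
  obtain ⟨q, hq⟩ := hf.size_le
  refine foldl_of_add (f := fun a acc b => acc ++ f a b) hl (const _)
    (append (by fun_prop) (hf.comp (f := fun p : α × List γ × β => (p.1, p.2.2)) (by fun_prop)))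
    (q.comp (.X + 1)) fun a s b => ?_
  have h₁ := hq (a, b)
  have h₂ := size_append s (f a b)
  simp at h₁ ⊢
  omega

@[fun_prop] theorem filter {l : α → List β} {c : α → β → Bool} (hl : PolyTime l)
    (hc : PolyTime fun p : α × β => c p.1 p.2) : PolyTime fun a => (l a).filter (c a) := by
  have e (a : α) : (l a).filter (c a) = (l a).flatMap fun b => bif c a b then [b] else [] := by
    induction l a with
    | nil => rfl
    | cons b l ih => cases h : c a b <;> simp [h, ih]
  simp only [e]
  exact flatMap hl (cond hc (by fun_prop) (by fun_prop))

@[fun_prop] theorem length {l : α → List β} (hl : PolyTime l) : PolyTime fun a => (l a).length := by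
  have e (a : α) : (l a).length = (l a).foldl (fun n _ => n + 1) 0 := by
    have : ∀ (l : List β) (n : ℕ), l.foldl (fun n _ => n + 1) n = l.length + n := by
      intro l
      induction l with
      | nil => simp
      | cons b l ih => intro n; simp [ih]; omega
    simp [this]
  simp only [e]
  refine foldl_of_add (f := fun _ n _ => n + 1) hl (const _) (by fun_prop) 3 fun a s b => ?_
  simp
  omega

@[fun_prop] theorem any {l : α → List β} {c : α → β → Bool} (hl : PolyTime l)
    (hc : PolyTime fun p : α × β => c p.1 p.2) : PolyTime fun a => (l a).any (c a) := by
  have e (a : α) : (l a).any (c a) = !((l a).filter (c a)).isEmpty := by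
    rw [Bool.eq_iff_iff]
    simp
  simp only [e]
  fun_prop

@[fun_prop] theorem memB {f : α → β} {l : α → List β} (hf : PolyTime f) (hl : PolyTime l) :
    PolyTime fun a => memB (f a) (l a) :=
  any hl (eqB (hf.comp (by fun_prop)) (by fun_prop))

@[fun_prop] theorem dedupB {l : α → List β} (hl : PolyTime l) :
    PolyTime fun a => dedupB (l a) := by
  refine foldl_of_add (f := fun _ acc b => bif Machine.memB b acc then acc else b :: acc) hl
    (const _) (by fun_prop) (.X + 1) fun a s b => ?_
  cases Machine.memB b s <;> simp
  omega

@[fun_prop] theorem leB {l : α → List β} {l' : α → List γ} (hl : PolyTime l) (hl' : PolyTime l') :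
    PolyTime fun a => decide ((l a).length ≤ (l' a).length) := by
  have e (a : α) : decide ((l a).length ≤ (l' a).length) =
      ((l' a).foldl (fun s _ => s.tail) (l a)).isEmpty := by
    have : ∀ (l' : List γ) (l : List β), l'.foldl (fun s _ => s.tail) l = l.drop l'.length := by
      intro l'
      induction l' with
      | nil => simp
      | cons b l' ih => intro l; simp [ih]
    rw [this, Bool.eq_iff_iff]
    simp
  simp only [e]
  refine isEmpty (foldl_of_add (f := fun _ s _ => s.tail) hl' hl (by fun_prop) 0
    fun a s b => ?_)
  simpa using size_le_of_sublist s.tail_sublist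

end PolyTime

/-! ### Input and output -/

/-- Move the input to the main stack, as a coded list of symbols in reverse order. -/
def readInput : Prog :=
  pushSymbol .main .zero ;; pushSymbol .main .zero ;; popX .inp ;;
  .loop xIsSome (pushX .main ;; pushSymbol .main .zero ;; pushSymbol .main .one ;; popX .inp)

theorem exec_readInput (r : Reg) (w : List Symbol) :
    Exec readInput ⟨r, w, [], [], [], [], []⟩
      ⟨(none, r.2), [], [], (Enc.tree w.reverse).code, [], [], []⟩ (5 * w.length + 4) := by
  have hloop : ∀ (w u : List Symbol),
      Exec (.loop xIsSome (pushX .main ;; pushSymbol .main .zero ;; pushSymbol .main .one ;;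
          popX .inp))
        ⟨(w.head?, r.2), w.tail, [], (Enc.tree u).code, [], [], []⟩
        ⟨(none, r.2), [], [], (Enc.tree (w.reverse ++ u)).code, [], [], []⟩
        (5 * w.length + 1) := by
    intro w
    induction w with
    | nil => exact fun u => .loop_done rfl
    | cons x w ih =>
      intro u
      have h := ih (x :: u)
      rw [List.reverse_cons, List.append_assoc]
      exact .mono (.loop_step rfl (.seq (.push _ _ _) (.seq (.push _ _ _) (.seq (.push _ _ _)
        (.pop _ _ _)))) h) (show _ ≤ _ by simp; omega)
  have h := hloop w []
  rw [List.append_nil] at h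
  exact .mono (.seq (.push _ _ _) (.seq (.push _ _ _) (.seq (.pop _ _ _) h)))
    (show _ ≤ _ by omega)

/-- Move a coded list of symbols from the main stack to the output, in reverse order, and empty
the registers. -/
def writeOutput : Prog :=
  popX .main ;;
  .loop (xIs .one) (popX .main ;; popX .main ;; pushX .out ;; popX .main) ;;
  popX .main ;; popX .main ;; popY .main

theorem exec_writeOutput (r : Reg) (w : List Symbol) :
    Exec writeOutput ⟨r, [], [], (Enc.tree w).code, [], [], []⟩
      ⟨(none, none), [], w.reverse, [], [], [], []⟩ (5 * w.length + 5) := by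
  have hloop : ∀ (w u : List Symbol),
      Exec (.loop (xIs .one) (popX .main ;; popX .main ;; pushX .out ;; popX .main))
        ⟨((Enc.tree w).code.head?, r.2), [], u, (Enc.tree w).code.tail, [], [], []⟩
        ⟨(some .zero, r.2), [], w.reverse ++ u, [.zero], [], [], []⟩
        (5 * w.length + 1) := by
    intro w
    induction w with
    | nil => exact fun u => .loop_done rfl
    | cons x w ih =>
      intro u
      have h := ih (x :: u)
      rw [List.reverse_cons, List.append_assoc]
      exact .mono (.loop_step rfl (.seq (.pop _ _ _) (.seq (.pop _ _ _) (.seq (.push _ _ _)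
        (.pop _ _ _)))) h) (show _ ≤ _ by simp; omega)
  have h := hloop w []
  rw [List.append_nil] at h
  exact .mono (.seq (.pop _ _ _) (.seq h (.seq (.pop _ _ _) (.seq (.pop _ _ _) (.pop _ _ _)))))
    (show _ ≤ _ by omega)

theorem size_symbols (w : List Symbol) : size w = 3 * w.length + 2 := by
  induction w with
  | nil => rfl
  | cons s w ih => simp [ih]; omega

/-- A polynomial-time function on strings gives rise to a Turing machine that runs in polynomial
time. -/
theorem PolyTime.computable {α β : Type} {ea : α → List Symbol} {eb : β → List Symbol}
    {f : α → β} {F : List Symbol → List Symbol} (hF : PolyTime F)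
    (h : ∀ a, eb (f a) = F (ea a)) : Nonempty (Turing.TM2ComputableInPolyTime ea eb f) := by
  have hG : PolyTime fun w : List Symbol => (F w.reverse).reverse :=
    reverse (hF.comp (by fun_prop))
  obtain ⟨t, ht⟩ := hG.size_le
  obtain ⟨p, q, hp⟩ := hG
  refine computable_of_exec (readInput ;; p ;; writeOutput)
    (5 * .X + 4 + q.comp (3 * .X + 2) + (5 * t.comp (3 * .X + 2) + 5)) fun a => ?_
  obtain ⟨r, hr⟩ := hp (ea a).reverse (none, none) [] [] []
  have hw := exec_writeOutput r (F (ea a)).reverse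
  simp only [List.reverse_reverse] at hr hw
  simp only [codes_cons, codes_nil, List.append_nil] at hr
  rw [h]
  refine ((exec_readInput _ _).seq (hr.seq hw)).mono ?_
  have h₁ := (length_le_size _).trans (ht (ea a).reverse)
  simp only [size_symbols, List.length_reverse, List.reverse_reverse] at h₁ ⊢
  simp
  omega

end Machine

namespace Fitting

open Machine

/-! ### The fitting algorithm -/

abbrev Word : Type := List Bool

/-- A fact or an example as it is read from the input: its first symbol and its words. -/
abbrev Item : Type := Symbol × List Word

namespace Item

def word₀ (φ : Item) : Word := φ.2.headD []

def word₁ (φ : Item) : Word := φ.2.tail.headD []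

def word₂ (φ : Item) : Word := φ.2.tail.tail.headD []

end Item

/-- One step of the parser, which reads the input from right to left. It collects the words that
follow the next symbol to the left that starts an item, and the items. The default values matter
only for strings that encode no input. -/
noncomputable def parseStep (s : List Word × List Item) (x : Symbol) : List Word × List Item :=
  bif eqB x .endMark then ([] :: s.1, s.2)
  else bif eqB x .zero then ((false :: s.1.headD []) :: s.1.tail, s.2)
  else bif eqB x .one then ((true :: s.1.headD []) :: s.1.tail, s.2)
  else ([], (x, s.1) :: s.2)

/-- The items of the input. -/
noncomputable def parse (w : List Symbol) : List Item :=
  (w.reverse.foldl parseStep ([], [])).2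

/-- The individuals that occur in the facts. -/
noncomputable def inds (items : List Item) : List Word :=
  dedupB (items.flatMap fun φ =>
    bif eqB φ.1 .conceptFact || eqB φ.1 .featureFact then [Item.word₁ φ]
    else bif eqB φ.1 .roleFact then [Item.word₁ φ, Item.word₂ φ]
    else [])

/-- The examples marked by the symbol `x`. -/
noncomputable def examples (x : Symbol) (items : List Item) : List Word :=
  (items.filter fun φ => eqB φ.1 x).map Item.word₀

/-- A table entry `(a, i, l)`: the node `i` of the DAG represents a concept with extension `l`,
the current class of the individual `a`. -/
abbrev Entry : Type := Word × ℕ × List Word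

/-- A test `(x, w, v, i, l)` by which the individuals of a class are told apart. If `x` is
`roleName` or `inverseRole`, the test counts the successors in the set `l`, the extension of the
node `i`, for the role (inverse to the role) with name `w`. If `x` is `atom`, it asks for the
concept name `w`, and if `x` is `feature`, for the value `v` of the feature `w`; in these cases `l`
is an arbitrary one-element list, so that the count is `0` or `1`. -/
abbrev Test : Type := Symbol × Word × Word × ℕ × List Word

/-- The fact that a test looks up for the individuals `b` and `c`. -/
noncomputable def query (τ : Test) (b c : Word) : Item :=
  bif eqB τ.1 .roleName then (.roleFact, [τ.2.1, b, c])
  else bif eqB τ.1 .inverseRole then (.roleFact, [τ.2.1, c, b])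
  else bif eqB τ.1 .atom then (.conceptFact, [τ.2.1, b])
  else (.featureFact, [τ.2.1, b, τ.2.2.1])

/-- The result of a test for the individual `b`. -/
noncomputable def val (items : List Item) (τ : Test) (b : Word) : ℕ :=
  (τ.2.2.2.2.filter fun c => memB (query τ b c) items).length

/-- All tests for a table, depending on the availability of inverse roles and features. -/
noncomputable def tests (inv feat : Bool) (items : List Item) (tbl : List Entry) : List Test :=
  items.flatMap fun φ =>
    bif eqB φ.1 .conceptFact then [(.atom, Item.word₀ φ, [], 0, [[]])]
    else bif eqB φ.1 .featureFact && feat then [(.feature, Item.word₀ φ, Item.word₂ φ, 0, [[]])]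
    else bif eqB φ.1 .roleFact then
      tbl.flatMap fun e => (.roleName, Item.word₀ φ, [], e.2.1, e.2.2) ::
        bif inv then [(.inverseRole, Item.word₀ φ, [], e.2.1, e.2.2)] else []
    else []

/-- The string that represents a node; feature values are words. -/
def nodeString (ν : Node fun _ => Word) : List Symbol := encodeNode (fun _ => id) ν

/-- The string of a node for the test `τ`. Together, the nodes for `≥` and `≤` say that the result
of the test is `n`; for the atoms, they say that it is positive. -/
noncomputable def testString (τ : Test) (c : Cmp) (n : ℕ) : List Symbol :=
  bif eqB τ.1 .roleName then nodeString (.restrict c n (.name τ.2.1) τ.2.2.2.1)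
  else bif eqB τ.1 .inverseRole then nodeString (.restrict c n (.inverse τ.2.1) τ.2.2.2.1)
  else bif eqB τ.1 .atom then nodeString (.atom τ.2.1)
  else nodeString (.feature c τ.2.1 τ.2.2.1)

/-- Is the result `n` of the test `τ` to be expressed by a negation? -/
noncomputable def negated (τ : Test) (n : ℕ) : Bool :=
  (eqB τ.1 .atom || eqB τ.1 .feature) && eqB n 0

/-- The state `(o, n, i, l)` of the computation of a class: the string `o` of the DAG so far, its
number `n` of nodes, and a node `i` with extension `l`. -/
abbrev State : Type := List Symbol × ℕ × ℕ × List Word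

/-- The individuals for which the test `τ` yields the same result as for `a` are singled out. -/
noncomputable def step (items : List Item) (a : Word) (s : State) (τ : Test) : State :=
  (s.1 ++ testString τ .ge (val items τ a) ++ testString τ .le (val items τ a) ++
      nodeString (.inter s.2.1 (s.2.1 + 1)) ++
      (bif negated τ (val items τ a) then
        nodeString (.neg (s.2.1 + 2)) ++ nodeString (.inter s.2.2.1 (s.2.1 + 3))
      else nodeString (.inter s.2.2.1 (s.2.1 + 2))),
    (bif negated τ (val items τ a) then s.2.1 + 5 else s.2.1 + 4),
    (bif negated τ (val items τ a) then s.2.1 + 4 else s.2.1 + 3),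
    s.2.2.2.filter fun b => eqB (val items τ b) (val items τ a))

/-- The class of the table entry `e` is refined by all tests of a list. -/
noncomputable def refineEntry (items : List Item) (ts : List Test)
    (s : List Symbol × ℕ × List Entry) (e : Entry) : List Symbol × ℕ × List Entry :=
  let r := ts.foldl (step items e.1) (s.1, s.2.1, e.2)
  (r.1, r.2.1, s.2.2 ++ [(e.1, r.2.2)])

/-- One round of the refinement. -/
noncomputable def round (inv feat : Bool) (items : List Item) (s : List Symbol × ℕ × List Entry) :
    List Symbol × ℕ × List Entry :=
  s.2.2.foldl (refineEntry items (tests inv feat items s.2.2)) (s.1, s.2.1, [])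

/-- The refinement, starting with one class that contains all individuals. -/
noncomputable def rounds (inv feat : Bool) (items : List Item) : List Symbol × ℕ × List Entry :=
  ((inds items).flatMap fun _ => inds items).foldl (fun s _ => round inv feat items s)
    (nodeString .top, 1, (inds items).map fun a => (a, 0, inds items))

/-- Does a class contain at least as many positive as negative examples? -/
noncomputable def isGood (items : List Item) (l : List Word) : Bool :=
  decide (((examples .negExample items).filter fun b => memB b l).length ≤
    ((examples .posExample items).filter fun b => memB b l).length)

/-- The complements of the good classes are intersected. -/
noncomputable def collect (items : List Item) (s : List Symbol × ℕ × ℕ) (e : Entry) :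
    List Symbol × ℕ × ℕ :=
  bif isGood items e.2.2 then
    (s.1 ++ (nodeString (.neg e.2.1) ++ nodeString (.inter s.2.2 s.2.1)), s.2.1 + 2, s.2.1 + 1)
  else s

/-- The output: the union of the good classes. -/
noncomputable def output (inv feat : Bool) (items : List Item) : List Symbol :=
  let r := rounds inv feat items
  let s := r.2.2.foldl (collect items) (r.1, r.2.1, 0)
  s.1 ++ nodeString (.neg s.2.2)

/-! ### The algorithm runs in polynomial time -/

section PolyTime

variable {α : Type} [Enc α]

@[fun_prop] theorem polyTime_word₀ {f : α → Item} (hf : PolyTime f) :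
    PolyTime fun a => Item.word₀ (f a) := by
  unfold Item.word₀; fun_prop

@[fun_prop] theorem polyTime_word₁ {f : α → Item} (hf : PolyTime f) :
    PolyTime fun a => Item.word₁ (f a) := by
  unfold Item.word₁; fun_prop

@[fun_prop] theorem polyTime_word₂ {f : α → Item} (hf : PolyTime f) :
    PolyTime fun a => Item.word₂ (f a) := by
  unfold Item.word₂; fun_prop

theorem polyTime_parse : PolyTime parse := by
  refine PolyTime.snd (PolyTime.foldl_of_add (f := fun _ => parseStep) (by fun_prop)
    (PolyTime.const _) ?_ 20 fun a s x => ?_)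
  · unfold parseStep
    fun_prop
  · obtain ⟨ws, is⟩ := s
    have h (b : Bool) : size ((b :: ws.headD []) :: ws.tail) ≤ size ws + 10 := by
      cases ws with
      | nil => simp
      | cons => simp; omega
    have h₁ := h false
    have h₂ := h true
    unfold parseStep
    cases eqB x Symbol.endMark
    · cases eqB x Symbol.zero
      · cases eqB x Symbol.one
        · simp; omega
        · simp only [size_prod, cond_true, cond_false, Polynomial.eval_ofNat]; omega
      · simp only [size_prod, cond_true, cond_false, Polynomial.eval_ofNat]; omega
    · simp; omega

@[fun_prop] theorem polyTime_inds {f : α → List Item} (hf : PolyTime f) :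
    PolyTime fun a => inds (f a) := by
  unfold inds; fun_prop

@[fun_prop] theorem polyTime_examples (x : Symbol) {f : α → List Item} (hf : PolyTime f) :
    PolyTime fun a => examples x (f a) := by
  unfold examples; fun_prop

@[fun_prop] theorem polyTime_query {τ : α → Test} {b c : α → Word} (hτ : PolyTime τ)
    (hb : PolyTime b) (hc : PolyTime c) : PolyTime fun a => query (τ a) (b a) (c a) := by
  unfold query; fun_prop

@[fun_prop] theorem polyTime_val {f : α → List Item} {τ : α → Test} {b : α → Word}
    (hf : PolyTime f) (hτ : PolyTime τ) (hb : PolyTime b) :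
    PolyTime fun a => val (f a) (τ a) (b a) := by
  unfold val; fun_prop

@[fun_prop] theorem polyTime_tests (inv feat : Bool) {f : α → List Item} {t : α → List Entry}
    (hf : PolyTime f) (ht : PolyTime t) : PolyTime fun a => tests inv feat (f a) (t a) := by
  unfold tests; fun_prop

@[fun_prop] theorem polyTime_encodeBits {w : α → Word} (hw : PolyTime w) :
    PolyTime fun a => encodeBits (w a) := by
  have e (a : α) : encodeBits (w a) =
      (w a).map (fun b => bif b then Symbol.one else .zero) ++ [.endMark] := by
    simp [encodeBits, cond_eq_ite]
  simp only [e]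
  fun_prop

@[fun_prop] theorem polyTime_encodeUnary {n : α → ℕ} (hn : PolyTime n) :
    PolyTime fun a => encodeUnary (n a) := by
  have e (a : α) : encodeUnary (n a) =
      (List.replicate (n a) ()).map (fun _ => Symbol.one) ++ [.endMark] := by
    simp [encodeUnary]
  simp only [e]
  fun_prop

@[fun_prop] theorem polyTime_neg {i : α → ℕ} (hi : PolyTime i) :
    PolyTime fun a => nodeString (.neg (i a)) := by
  simp only [nodeString, encodeNode]; fun_prop

@[fun_prop] theorem polyTime_inter {i j : α → ℕ} (hi : PolyTime i) (hj : PolyTime j) :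
    PolyTime fun a => nodeString (.inter (i a) (j a)) := by
  simp only [nodeString, encodeNode]; fun_prop

@[fun_prop] theorem polyTime_testString (c : Cmp) {τ : α → Test} {n : α → ℕ} (hτ : PolyTime τ)
    (hn : PolyTime n) : PolyTime fun a => testString (τ a) c (n a) := by
  simp only [testString, nodeString, encodeNode, encodeRole, id]; fun_prop

@[fun_prop] theorem polyTime_negated {τ : α → Test} {n : α → ℕ} (hτ : PolyTime τ)
    (hn : PolyTime n) : PolyTime fun a => negated (τ a) (n a) := by
  unfold negated; fun_prop

@[fun_prop] theorem polyTime_isGood {f : α → List Item} {l : α → List Word} (hf : PolyTime f)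
    (hl : PolyTime l) : PolyTime fun a => isGood (f a) (l a) := by
  unfold isGood; fun_prop

theorem polyTime_step : PolyTime fun p : (List Item × Word) × State × Test =>
    step p.1.1 p.1.2 p.2.1 p.2.2 := by
  unfold step; fun_prop

theorem polyTime_collect : PolyTime fun p : List Item × (List Symbol × ℕ × ℕ) × Entry =>
    collect p.1 p.2.1 p.2.2 := by
  unfold collect; fun_prop

end PolyTime

/-! ### Bounds for the length of the output -/

/-- At most `J` nodes have been written; `W` bounds the lengths of the words and the numbers in
number restrictions. The length of the string is bounded generously: each node is charged as many
symbols as the five nodes of one step can take together. -/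
structure Within (W J : ℕ) (o : List Symbol) (n i : ℕ) : Prop where
  nodes : n ≤ J
  pointer : i ≤ J
  string : o.length ≤ J * (10 * (W + J + 10))

theorem Within.mono {W J K : ℕ} {o : List Symbol} {n i : ℕ} (h : Within W J o n i) (hJK : J ≤ K) :
    Within W K o n i :=
  ⟨h.nodes.trans hJK, h.pointer.trans hJK, h.string.trans (by gcongr)⟩

theorem Within.append {W J : ℕ} {o w : List Symbol} {n i n' i' : ℕ} (h : Within W J o n i)
    (hw : w.length ≤ 10 * (W + J + 10)) (hn : n' ≤ n + 5) (hi : i' ≤ n + 5) :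
    Within W (J + 5) (o ++ w) n' i' := by
  obtain ⟨h₁, h₂, h₃⟩ := h
  refine ⟨by omega, by omega, ?_⟩
  rw [List.length_append]
  calc o.length + w.length ≤ J * (10 * (W + J + 10)) + 10 * (W + J + 10) := by gcongr
    _ = (J + 1) * (10 * (W + J + 10)) := by ring
    _ ≤ (J + 5) * (10 * (W + (J + 5) + 10)) := by gcongr <;> omega

/-- The words of the test `τ` and its set are bounded by `W`, and its pointer by `J`. -/
structure TestWithin (W J : ℕ) (τ : Test) : Prop where
  name : τ.2.1.length ≤ W
  value : τ.2.2.1.length ≤ W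
  pointer : τ.2.2.2.1 ≤ J
  set : τ.2.2.2.2.length ≤ W

theorem length_encodeBits (w : Word) : (encodeBits w).length = w.length + 1 := by
  simp [encodeBits]

theorem length_encodeUnary (n : ℕ) : (encodeUnary n).length = n + 1 := by
  simp [encodeUnary]

theorem length_testString {W J : ℕ} {τ : Test} (h : TestWithin W J τ) (c : Cmp) {n : ℕ}
    (hn : n ≤ W) : (testString τ c n).length ≤ 2 * W + J + 10 := by
  obtain ⟨h₁, h₂, h₃, h₄⟩ := h
  unfold testString
  have hc : (encodeCmp c).length = 1 := by cases c <;> rfl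
  cases eqB τ.1 Symbol.roleName
  · cases eqB τ.1 Symbol.inverseRole
    · cases eqB τ.1 Symbol.atom <;>
        simp [nodeString, encodeNode, length_encodeBits, hc] <;> omega
    · simp [nodeString, encodeNode, encodeRole, length_encodeBits, length_encodeUnary, hc]
      omega
  · simp [nodeString, encodeNode, encodeRole, length_encodeBits, length_encodeUnary, hc]
    omega

theorem val_le (items : List Item) (τ : Test) (b : Word) : val items τ b ≤ τ.2.2.2.2.length :=
  List.length_filter_le _ _

theorem step_within {W J : ℕ} {items : List Item} {a : Word} {s : State} {τ : Test}
    (hs : Within W J s.1 s.2.1 s.2.2.1) (hτ : TestWithin W J τ) :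
    Within W (J + 5) (step items a s τ).1 (step items a s τ).2.1 (step items a s τ).2.2.1 := by
  have hn := (val_le items τ a).trans hτ.set
  have h₁ := length_testString hτ .ge hn
  have h₂ := length_testString hτ .le hn
  obtain ⟨h₃, h₄, -⟩ := id hs
  unfold step
  simp only [List.append_assoc]
  cases negated τ (val items τ a)
  all_goals
    refine hs.append ?_ (by simp) (by simp)
    simp [nodeString, encodeNode, length_encodeUnary]
    omega

theorem foldl_step_within {W : ℕ} {items : List Item} {a : Word} (ts : List Test) :
    ∀ {J : ℕ} {s : State}, (∀ τ ∈ ts, TestWithin W J τ) → Within W J s.1 s.2.1 s.2.2.1 →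
      Within W (J + 5 * ts.length) (ts.foldl (step items a) s).1
        (ts.foldl (step items a) s).2.1 (ts.foldl (step items a) s).2.2.1 := by
  induction ts with
  | nil => exact fun _ h => h
  | cons τ ts ih =>
    intro J s hts hs
    refine (ih (fun τ' hτ' => ?_) (step_within hs (hts τ (by simp)))).mono
      (by simp only [List.length_cons]; omega)
    obtain ⟨h₁, h₂, h₃, h₄⟩ := hts τ' (by simp [hτ'])
    exact ⟨h₁, h₂, by omega, h₄⟩

theorem foldl_step_sublist {items : List Item} {a : Word} (ts : List Test) (s : State) :
    (ts.foldl (step items a) s).2.2.2.Sublist s.2.2.2 := by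
  induction ts generalizing s with
  | nil => exact .refl _
  | cons τ ts ih => exact (ih _).trans List.filter_sublist

/-- The entries of a table point to the first `J` nodes, and they arise from the entries in `tbl`
by shrinking the classes. -/
def TableWithin (J : ℕ) (tbl new : List Entry) : Prop :=
  ∀ e ∈ new, e.2.1 ≤ J ∧ ∃ e' ∈ tbl, e.1 = e'.1 ∧ e.2.2.Sublist e'.2.2

theorem foldl_refineEntry_within {W : ℕ} {items : List Item} {ts : List Test} {tbl : List Entry}
    (l : List Entry) :
    ∀ {J : ℕ} {s : List Symbol × ℕ × List Entry}, (∀ τ ∈ ts, TestWithin W J τ) →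
      (∀ e ∈ l, e.2.1 ≤ J) → l ⊆ tbl → Within W J s.1 s.2.1 0 → TableWithin J tbl s.2.2 →
      Within W (J + 5 * ts.length * l.length) (l.foldl (refineEntry items ts) s).1
        (l.foldl (refineEntry items ts) s).2.1 0 ∧
      TableWithin (J + 5 * ts.length * l.length) tbl (l.foldl (refineEntry items ts) s).2.2 ∧
      (l.foldl (refineEntry items ts) s).2.2.length = s.2.2.length + l.length := by
  induction l with
  | nil => exact fun _ _ _ h h' => ⟨h, h', rfl⟩
  | cons e l ih =>
    intro J s hts hl hsub hs hs'
    have h₁ := foldl_step_within (items := items) (a := e.1) ts (s := (s.1, s.2.1, e.2)) hts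
      ⟨hs.nodes, hl e (by simp), hs.string⟩
    have h₂ := foldl_step_sublist (items := items) (a := e.1) ts (s.1, s.2.1, e.2)
    have h := ih (J := J + 5 * ts.length) (s := refineEntry items ts s e) (fun τ hτ => ?_)
      (fun e' he' => ?_) (fun e' he' => hsub (by simp [he'])) ⟨h₁.nodes, by omega, h₁.string⟩ ?_
    · have e₁ : J + 5 * ts.length * (l.length + 1) =
          J + 5 * ts.length + 5 * ts.length * l.length := by ring
      rw [List.foldl_cons, List.length_cons, e₁]
      refine ⟨h.1, h.2.1, h.2.2.trans ?_⟩
      simp [refineEntry]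
      omega
    · obtain ⟨h₁, h₂, h₃, h₄⟩ := hts τ hτ
      exact ⟨h₁, h₂, by omega, h₄⟩
    · exact (hl e' (by simp [he'])).trans (by omega)
    · intro e' he'
      simp only [refineEntry, List.mem_append, List.mem_singleton] at he'
      rcases he' with he' | rfl
      · exact ⟨(hs' e' he').1.trans (by omega), (hs' e' he').2⟩
      · exact ⟨h₁.pointer, e, hsub (by simp), rfl, h₂⟩

theorem length_tests_le (inv feat : Bool) (items : List Item) (tbl : List Entry) :
    (tests inv feat items tbl).length ≤ items.length * (2 * tbl.length + 1) := by
  unfold tests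
  rw [List.length_flatMap, mul_comm]
  refine (List.sum_le_card_nsmul _ (2 * tbl.length + 1) ?_).trans (by simp [mul_comm])
  intro n hn
  obtain ⟨φ, -, rfl⟩ := List.mem_map.1 hn
  cases eqB φ.1 Symbol.conceptFact
  · cases eqB φ.1 Symbol.featureFact && feat
    · cases eqB φ.1 Symbol.roleFact
      · simp
      · cases inv
        · simp [mul_comm]
          omega
        · simp [mul_comm]
    · simp
  · simp

/-- The words in the tests come from the items, and the other parts from the table. -/
theorem tests_within {inv feat : Bool} {items : List Item} {tbl : List Entry} {J K : ℕ}
    (h : ∀ e ∈ tbl, e.2.1 ≤ J ∧ e.2.2.length ≤ K) :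
    ∀ τ ∈ tests inv feat items tbl, TestWithin (size items + K + 1) J τ := by
  intro τ hτ
  obtain ⟨φ, hφ, hτ⟩ := List.mem_flatMap.1 hτ
  have hsz := size_le_of_mem hφ
  have hw : ∀ ws : List Word, (ws.headD []).length ≤ size ws := by
    intro ws
    cases ws with
    | nil => simp
    | cons w ws =>
      have := length_le_size w
      simp
      omega
  have ht : ∀ ws : List Word, size ws.tail ≤ size ws := fun ws =>
    size_le_of_sublist ws.tail_sublist
  have h₀ : (Item.word₀ φ).length ≤ size items := by
    have := hw φ.2
    obtain ⟨x, ws⟩ := φ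
    simp only [size_prod] at hsz
    exact this.trans (by simp only; omega)
  have h₂ : (Item.word₂ φ).length ≤ size items := by
    have := (hw φ.2.tail.tail).trans ((ht _).trans (ht _))
    obtain ⟨x, ws⟩ := φ
    simp only [size_prod] at hsz
    exact this.trans (by simp only; omega)
  cases h₃ : eqB φ.1 Symbol.conceptFact
  · cases h₄ : eqB φ.1 Symbol.featureFact && feat
    · cases h₅ : eqB φ.1 Symbol.roleFact
      · simp only [h₃, h₄, h₅, cond_false, List.not_mem_nil] at hτ
      · simp only [h₃, h₄, h₅, cond_false, cond_true, List.mem_flatMap] at hτ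
        obtain ⟨e, he, hτ⟩ := hτ
        obtain ⟨h₆, h₇⟩ := h e he
        cases inv <;> simp at hτ
        · subst hτ
          constructor <;> simp <;> omega
        · rcases hτ with rfl | rfl <;> constructor <;> simp <;> omega
    · simp only [h₃, h₄, cond_false, cond_true, List.mem_singleton] at hτ
      subst hτ
      constructor <;> simp <;> omega
  · simp only [h₃, cond_true, List.mem_singleton] at hτ
    subst hτ
    constructor <;> simp
    omega

/-- The invariant of the rounds: there is one entry for each individual, its pointer leads to one of
the first `J` nodes, and its class is a sublist of the individuals. -/
structure RoundWithin (items : List Item) (W J : ℕ) (s : List Symbol × ℕ × List Entry) :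
    Prop where
  within : Within W J s.1 s.2.1 0
  length : s.2.2.length = (inds items).length
  entry : ∀ e ∈ s.2.2, e.2.1 ≤ J ∧ e.1 ∈ inds items ∧ e.2.2.Sublist (inds items)

theorem round_within {inv feat : Bool} {items : List Item} {J : ℕ}
    {s : List Symbol × ℕ × List Entry}
    (h : RoundWithin items (size items + (inds items).length + 1) J s) :
    RoundWithin items (size items + (inds items).length + 1)
      (J + 5 * (items.length * (2 * (inds items).length + 1)) * (inds items).length)
      (round inv feat items s) := by
  obtain ⟨h₁, h₂, h₃⟩ := h
  have h₄ := tests_within (inv := inv) (feat := feat) (items := items) (tbl := s.2.2) (J := J)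
    (K := (inds items).length) fun e he => ⟨(h₃ e he).1, (h₃ e he).2.2.length_le⟩
  obtain ⟨h₅, h₆, h₇⟩ := foldl_refineEntry_within (items := items) s.2.2
    (s := (s.1, s.2.1, [])) h₄ (fun e he => (h₃ e he).1) (List.Subset.refl _) h₁
    (fun e he => absurd he (by simp))
  have h₈ := length_tests_le inv feat items s.2.2
  rw [h₂] at h₅ h₆ h₈
  have h₉ : J + 5 * (tests inv feat items s.2.2).length * (inds items).length ≤
      J + 5 * (items.length * (2 * (inds items).length + 1)) * (inds items).length := by gcongr
  refine ⟨h₅.mono h₉, by simpa [round, h₂] using h₇, fun e he => ?_⟩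
  obtain ⟨h₁₀, e', he', h₁₁, h₁₂⟩ := h₆ e he
  exact ⟨h₁₀.trans h₉, h₁₁ ▸ (h₃ e' he').2.1, h₁₂.trans (h₃ e' he').2.2⟩

theorem init_within (items : List Item) (W : ℕ) :
    RoundWithin items W 1
      (nodeString .top, 1, (inds items).map fun a => (a, 0, inds items)) := by
  refine ⟨⟨le_rfl, by omega, ?_⟩, by simp, fun e he => ?_⟩
  · simp [nodeString, encodeNode]
    omega
  · obtain ⟨a, ha, rfl⟩ := List.mem_map.1 he
    exact ⟨by simp, ha, .refl _⟩

theorem foldl_round_within {inv feat : Bool} {items : List Item} (l : List Word) :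
    ∀ {J : ℕ} {s : List Symbol × ℕ × List Entry},
      RoundWithin items (size items + (inds items).length + 1) J s →
      RoundWithin items (size items + (inds items).length + 1)
        (J + 5 * (items.length * (2 * (inds items).length + 1)) * (inds items).length * l.length)
        (l.foldl (fun s _ => round inv feat items s) s) := by
  induction l with
  | nil => exact fun h => h
  | cons a l ih =>
    intro J s h
    convert ih (round_within (inv := inv) (feat := feat) h) using 1
    · simp only [List.length_cons]
      ring
    · rfl

/-- A bound for the sizes of the parts of a state. A string of length `m` has size `3 * m + 2`, and
so has the number `m`. -/
def stateBound (W J : ℕ) : ℕ := 30 * J * (W + J + 10) + 6 * J + 6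

theorem stateBound_mono {W W' J J' : ℕ} (hW : W ≤ W') (hJ : J ≤ J') :
    stateBound W J ≤ stateBound W' J' := by
  unfold stateBound
  gcongr

theorem Within.size_le {W J : ℕ} {o : List Symbol} {n i : ℕ} (h : Within W J o n i) :
    size o + size n + size i ≤ stateBound W J := by
  obtain ⟨h₁, h₂, h₃⟩ := h
  rw [size_symbols, size_nat, size_nat, stateBound]
  have : 30 * J * (W + J + 10) = 3 * (J * (10 * (W + J + 10))) := by ring
  omega

/-- A bound from the sizes of the parts of a state. -/
theorem Within.of_size {K : ℕ} {o : List Symbol} {n i : ℕ} (ho : size o ≤ K) (hn : size n ≤ K)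
    (hi : size i ≤ K) : Within K K o n i := by
  rw [size_nat] at hn hi
  refine ⟨by omega, by omega, ?_⟩
  calc o.length ≤ K * 1 := by rw [size_symbols] at ho; omega
    _ ≤ K * (10 * (K + K + 10)) := by gcongr; omega

theorem TestWithin.of_size {K : ℕ} {τ : Test} (h : size τ ≤ K) : TestWithin K K τ := by
  obtain ⟨x, w, v, i, l⟩ := τ
  have h₁ := length_le_size w
  have h₂ := length_le_size v
  have h₃ := length_le_size l
  simp at h
  constructor <;> simp <;> omega

theorem polyTime_foldl_step :
    PolyTime fun p : (List Item × Word) × List Test × State =>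
      p.2.1.foldl (step p.1.1 p.1.2) p.2.2 := by
  refine PolyTime.foldl (by fun_prop) (by fun_prop) ?_
    (30 * (6 * .X) * (.X + 6 * .X + 10) + 6 * (6 * .X) + 6 + .X + 3) ?_
  · exact polyTime_step.comp (f := fun p : ((List Item × Word) × List Test × State) ×
      State × Test => (p.1.1, p.2)) (by fun_prop)
  · rintro ⟨⟨items, a⟩, ts, o, n, i, c⟩ l hl
    obtain ⟨X, hX⟩ : ∃ X, X = size ((items, a), ts, (o, n, i, c)) := ⟨_, rfl⟩
    rw [← hX]
    simp only [size_prod] at hX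
    have h₁ := foldl_step_within (W := X) (J := X) (items := items) (a := a) l (s := (o, n, i, c))
      (fun τ hτ => .of_size ((size_le_of_mem (hl.subset hτ)).trans (by dsimp only; omega)))
      (.of_size (by dsimp only; omega) (by dsimp only; omega) (by dsimp only; omega))
    have h₂ := foldl_step_sublist (items := items) (a := a) l (o, n, i, c)
    have h₃ := size_le_of_sublist h₂
    have h₄ : l.length ≤ X := (hl.length_le.trans (length_le_size _)).trans (by dsimp only; omega)
    have h₅ := h₁.size_le.trans (stateBound_mono (le_refl X)
      (show X + 5 * l.length ≤ 6 * X by omega))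
    obtain ⟨r, hr⟩ : ∃ r, r = l.foldl (step items a) (o, n, i, c) := ⟨_, rfl⟩
    simp only [← hr] at h₃ h₅ ⊢
    obtain ⟨o', n', i', c'⟩ := r
    simp [stateBound] at h₃ h₅ ⊢
    omega

theorem TableWithin.size_le {J X m : ℕ} {tbl new : List Entry} (h : TableWithin J tbl new)
    (htbl : ∀ e ∈ tbl, size e ≤ X) (hm : new.length ≤ m) :
    size new ≤ m * (X + 3 * J + 2) + 2 := by
  refine (size_le_length_mul (n := X + 3 * J + 1) fun e he => ?_).trans (by gcongr)
  obtain ⟨h₁, e', he', h₂, h₃⟩ := h e he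
  have h₄ := size_le_of_sublist h₃
  have h₅ := htbl e' he'
  obtain ⟨a, i, l⟩ := e
  obtain ⟨a', i', l'⟩ := e'
  simp at h₁ h₂ h₄ h₅ ⊢
  subst h₂
  omega

theorem polyTime_refineEntry (inv feat : Bool) :
    PolyTime fun p : (List Item × List Symbol × ℕ × List Entry) ×
      (List Symbol × ℕ × List Entry) × Entry =>
      refineEntry p.1.1 (tests inv feat p.1.1 p.1.2.2.2) p.2.1 p.2.2 := by
  have h := polyTime_foldl_step.comp (f := fun p : (List Item × List Symbol × ℕ × List Entry) ×
    (List Symbol × ℕ × List Entry) × Entry => ((p.1.1, p.2.2.1),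
      tests inv feat p.1.1 p.1.2.2.2, (p.2.1.1, p.2.1.2.1, p.2.2.2))) (by fun_prop)
  unfold refineEntry
  exact h.fst.pair (h.snd.fst.pair (PolyTime.append (by fun_prop)
    (PolyTime.cons (PolyTime.pair (by fun_prop) h.snd.snd) (by fun_prop))))

theorem polyTime_round (inv feat : Bool) :
    PolyTime fun p : List Item × List Symbol × ℕ × List Entry => round inv feat p.1 p.2 := by
  have hT : PolyTime fun p : List Item × List Symbol × ℕ × List Entry =>
      tests inv feat p.1 p.2.2.2 := by fun_prop
  obtain ⟨T, hT⟩ := hT.size_le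
  obtain ⟨J, hJ⟩ : ∃ J : Polynomial ℕ, J = .X + T + 5 * T * .X := ⟨_, rfl⟩
  unfold round
  refine PolyTime.foldl (l := fun p : List Item × List Symbol × ℕ × List Entry => p.2.2.2)
    (s := fun p => (p.2.1, p.2.2.1, []))
    (f := fun p => refineEntry p.1 (tests inv feat p.1 p.2.2.2)) (by fun_prop) (by fun_prop) ?_
    (30 * J * (.X + T + J + 10) + 6 * J + 6 + (.X * (.X + 3 * J + 2) + 2) + 2) ?_
  · exact (polyTime_refineEntry inv feat)
  · rintro ⟨items, o, n, tbl⟩ l hl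
    have hT := hT (items, o, n, tbl)
    obtain ⟨X, hX⟩ : ∃ X, X = size (items, o, n, tbl) := ⟨_, rfl⟩
    rw [← hX] at hT ⊢
    simp only [size_prod] at hX hT
    have htbl : ∀ e ∈ tbl, size e ≤ X := fun e he => (size_le_of_mem he).trans (by omega)
    obtain ⟨h₁, h₂, h₃⟩ := foldl_refineEntry_within (W := X + T.eval X) (J := X + T.eval X)
      (items := items) (ts := tests inv feat items tbl) (tbl := tbl) l (s := (o, n, []))
      (fun τ hτ => .of_size ((size_le_of_mem hτ).trans (by omega)))
      (fun e he => by
        have := htbl e (hl.subset he)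
        obtain ⟨a, i, c⟩ := e
        simp at this ⊢
        omega) hl.subset
      (.of_size (by dsimp only; omega) (by dsimp only; omega) (by simp; omega))
      (fun e he => absurd he (by simp))
    have h₄ : l.length ≤ X := (hl.length_le.trans (length_le_size _)).trans (by dsimp only; omega)
    have h₅ : X + T.eval X + 5 * (tests inv feat items tbl).length * l.length ≤ J.eval X := by
      have := (length_le_size _).trans hT
      simp only [hJ, Polynomial.eval_add, Polynomial.eval_mul, Polynomial.eval_X,
        Polynomial.eval_ofNat]
      gcongr
    have h₆ := h₁.size_le.trans (stateBound_mono le_rfl h₅)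
    have h₇ := h₂.size_le htbl (m := X) (by rw [h₃]; simpa using h₄)
    have h₈ : X * (X + 3 * (X + T.eval X + 5 * (tests inv feat items tbl).length * l.length) + 2) ≤
      X * (X + 3 * J.eval X + 2) := by gcongr
    obtain ⟨r, hr⟩ : ∃ r, r = l.foldl (refineEntry items (tests inv feat items tbl)) (o, n, []) :=
      ⟨_, rfl⟩
    simp only [← hr] at h₆ h₇ ⊢
    obtain ⟨o', n', tbl'⟩ := r
    simp only [stateBound, size_prod, size_nat, Polynomial.eval_add, Polynomial.eval_mul,
      Polynomial.eval_X, Polynomial.eval_ofNat] at h₆ h₇ ⊢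
    omega

theorem polyTime_rounds (inv feat : Bool) : PolyTime (rounds inv feat) := by
  have hI : PolyTime inds := by fun_prop
  have hR : PolyTime fun items : List Item => (inds items).flatMap fun _ => inds items := by
    fun_prop
  obtain ⟨I, hI⟩ := hI.size_le
  obtain ⟨R, hR⟩ := hR.size_le
  obtain ⟨J, hJ⟩ : ∃ J : Polynomial ℕ, J = 1 + 5 * (.X * (2 * I + 1)) * I * R := ⟨_, rfl⟩
  refine PolyTime.foldl (f := fun items s _ => round inv feat items s) (by fun_prop) (by fun_prop)
    ?_ (30 * J * (.X + I + 1 + J + 10) + 6 * J + 6 + (I * (2 * I + 3 * J + 5) + 2) + 2) ?_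
  · exact (polyTime_round inv feat).comp (f := fun p : List Item ×
      (List Symbol × ℕ × List Entry) × Word => (p.1, p.2.1)) (by fun_prop)
  · intro items l hl
    have hI := hI items
    have hR := hR items
    have h₁ := foldl_round_within (inv := inv) (feat := feat) l
      (init_within items (size items + (inds items).length + 1))
    obtain ⟨X, hX⟩ : ∃ X, X = size items := ⟨_, rfl⟩
    rw [← hX] at hI hR h₁ ⊢
    have h₂ : l.length ≤ R.eval X := (hl.length_le.trans (length_le_size _)).trans hR
    have h₃ : (inds items).length ≤ I.eval X := (length_le_size _).trans hI
    have h₄ : items.length ≤ X := (length_le_size _).trans hX.ge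
    have h₅ : 1 + 5 * (items.length * (2 * (inds items).length + 1)) * (inds items).length *
        l.length ≤ J.eval X := by
      simp only [hJ, Polynomial.eval_add, Polynomial.eval_mul, Polynomial.eval_X,
        Polynomial.eval_ofNat, Polynomial.eval_one]
      gcongr
    obtain ⟨r, hr⟩ : ∃ r, r = l.foldl (fun s _ => round inv feat items s)
      (nodeString .top, 1, (inds items).map fun a => (a, 0, inds items)) := ⟨_, rfl⟩
    rw [← hr] at h₁ ⊢
    obtain ⟨o', n', tbl'⟩ := r
    have h₆ := h₁.within.size_le.trans (stateBound_mono (W' := X + I.eval X + 1) (by omega) h₅)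
    have h₇ : size tbl' ≤ tbl'.length * (2 * I.eval X + 3 * J.eval X + 5) + 2 := by
      refine size_le_length_mul (n := 2 * I.eval X + 3 * J.eval X + 4) fun e he => ?_
      obtain ⟨h₈, h₉, h₁₀⟩ := h₁.entry e he
      have h₁₁ := size_le_of_mem h₉
      have h₁₂ := size_le_of_sublist h₁₀
      obtain ⟨a, i, c⟩ := e
      simp at h₈ h₁₁ h₁₂ ⊢
      omega
    have h₈ : tbl'.length * (2 * I.eval X + 3 * J.eval X + 5) ≤
        I.eval X * (2 * I.eval X + 3 * J.eval X + 5) := by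
      have := h₁.length.trans_le h₃
      gcongr
    simp only [stateBound, size_prod, size_nat, Polynomial.eval_add, Polynomial.eval_mul,
      Polynomial.eval_X, Polynomial.eval_ofNat, Polynomial.eval_one] at h₆ h₇ ⊢
    omega

theorem foldl_collect_within {W : ℕ} {items : List Item} (l : List Entry) :
    ∀ {J : ℕ} {s : List Symbol × ℕ × ℕ}, (∀ e ∈ l, e.2.1 ≤ J) → Within W J s.1 s.2.1 s.2.2 →
      Within W (J + 5 * l.length) (l.foldl (collect items) s).1 (l.foldl (collect items) s).2.1
        (l.foldl (collect items) s).2.2 := by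
  induction l with
  | nil => exact fun _ h => h
  | cons e l ih =>
    intro J s hl hs
    have he := hl e (by simp)
    have h : Within W (J + 5) (collect items s e).1 (collect items s e).2.1
        (collect items s e).2.2 := by
      unfold collect
      cases isGood items e.2.2
      · exact hs.mono (by omega)
      · refine hs.append ?_ (by simp) (by simp)
        obtain ⟨h₁, h₂, -⟩ := hs
        simp [nodeString, encodeNode, length_encodeUnary]
        omega
    refine (ih (fun e' he' => (hl e' (by simp [he'])).trans (by omega)) h).mono ?_
    simp only [List.length_cons]
    omega

theorem polyTime_output (inv feat : Bool) : PolyTime (output inv feat) := by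
  have hr := polyTime_rounds inv feat
  obtain ⟨R, hR⟩ := hr.size_le
  have h : PolyTime fun items => (rounds inv feat items).2.2.foldl (collect items)
      ((rounds inv feat items).1, (rounds inv feat items).2.1, 0) := by
    refine PolyTime.foldl (by fun_prop) (by fun_prop) polyTime_collect
      (30 * (6 * R) * (R + 6 * R + 10) + 6 * (6 * R) + 6 + 2) fun items l hl => ?_
    have hR := hR items
    obtain ⟨r, hr⟩ : ∃ r, r = rounds inv feat items := ⟨_, rfl⟩
    rw [← hr] at hR hl ⊢
    obtain ⟨o, n, tbl⟩ := r
    obtain ⟨X, hX⟩ : ∃ X, X = R.eval (size items) := ⟨_, rfl⟩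
    rw [← hX] at hR
    simp only [size_prod] at hR hl
    have h₁ := foldl_collect_within (W := X) (items := items) l (J := X) (s := (o, n, 0))
      (fun e he => by
        have := size_le_of_mem (hl.subset he)
        obtain ⟨a, i, c⟩ := e
        simp at this ⊢
        omega) (.of_size (by dsimp only; omega) (by dsimp only; omega) (by simp; omega))
    have h₂ : l.length ≤ X := (hl.length_le.trans (length_le_size _)).trans (by omega)
    have h₃ := h₁.size_le.trans (stateBound_mono (le_refl X)
      (show X + 5 * l.length ≤ 6 * X by omega))
    obtain ⟨r, hr⟩ : ∃ r, r = l.foldl (collect items) (o, n, 0) := ⟨_, rfl⟩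
    simp only [← hr] at h₃ ⊢
    obtain ⟨o', n', i'⟩ := r
    simp [stateBound, ← hX] at h₃ ⊢
    omega
  unfold output
  exact PolyTime.append (by fun_prop) (by fun_prop)

/-! ### Partition refinement on databases -/

/-- The roles that may be used in `L` concepts. -/
def AllowedRole (L : DL) : Role → Prop
  | .name _ => True
  | .inverse _ => L.AllowsInverse

section Database

variable {D : FeatureName → Type}

/-- The class of the individual `c` for the relation `r`. -/
def classOf (I : Database D) (r : IndividualName → IndividualName → Prop) (c : IndividualName) :
    Set IndividualName :=
  {d | d ∈ I.adom ∧ r c d}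

/-- The individuals `a` and `b` have the same atoms, and the same numbers of successors in each
class of the relation `r`. -/
structure Alike (L : DL) (I : Database D) (r : IndividualName → IndividualName → Prop)
    (a b : IndividualName) : Prop where
  atom : ∀ A, Fact.concept A a ∈ I.facts ↔ Fact.concept A b ∈ I.facts
  feature : L.AllowsFeatures → ∀ (f : FeatureName) (v : D f),
    Fact.feature f a v ∈ I.facts ↔ Fact.feature f b v ∈ I.facts
  role : ∀ R, AllowedRole L R → ∀ c ∈ I.adom,
    (I.succ R a ∩ classOf I r c).ncard = (I.succ R b ∩ classOf I r c).ncard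

/-- The relation that is reached after `j` rounds of refinement. -/
def refinement (L : DL) (I : Database D) : ℕ → IndividualName → IndividualName → Prop
  | 0 => fun _ _ => True
  | j + 1 => fun a b => refinement L I j a b ∧ Alike L I (refinement L I j) a b

variable {L : DL} {I : Database D}

theorem refinement_equivalence (j : ℕ) : Equivalence (refinement L I j) := by
  induction j with
  | zero => exact ⟨fun _ => trivial, fun _ => trivial, fun _ _ => trivial⟩
  | succ j ih =>
    refine ⟨fun a => ⟨ih.refl a, ?_⟩, fun h => ⟨ih.symm h.1, ?_⟩,
      fun h h' => ⟨ih.trans h.1 h'.1, ?_⟩⟩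
    · exact ⟨fun _ => .rfl, fun _ _ _ => .rfl, fun _ _ _ _ => rfl⟩
    · exact ⟨fun A => (h.2.atom A).symm, fun hL f v => (h.2.feature hL f v).symm,
        fun R hR c hc => (h.2.role R hR c hc).symm⟩
    · exact ⟨fun A => (h.2.atom A).trans (h'.2.atom A),
        fun hL f v => (h.2.feature hL f v).trans (h'.2.feature hL f v),
        fun R hR c hc => (h.2.role R hR c hc).trans (h'.2.role R hR c hc)⟩

/-- After as many rounds as there are pairs of individuals, the relation is stable: each round
before stabilization loses a pair. -/
theorem refinement_stable {j : ℕ} (hj : j = I.adom.ncard * I.adom.ncard) {a b : IndividualName}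
    (ha : a ∈ I.adom) (hb : b ∈ I.adom) (hab : refinement L I j a b) :
    Alike L I (refinement L I j) a b := by
  classical
  let S : ℕ → Set (IndividualName × IndividualName) := fun j =>
    {p | p ∈ I.adom ×ˢ I.adom ∧ refinement L I j p.1 p.2}
  have hfin (j : ℕ) : (S j).Finite :=
    (I.finite_adom.prod I.finite_adom).subset fun p hp => hp.1
  have hanti (j : ℕ) : S (j + 1) ⊆ S j := fun p hp => ⟨hp.1, hp.2.1⟩
  have hstep (j : ℕ) (h : S (j + 1) = S j) : S (j + 2) = S (j + 1) := by
    refine (hanti _).antisymm fun p hp => ⟨hp.1, hp.2, ?_⟩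
    have hcls : ∀ c ∈ I.adom,
        classOf I (refinement L I (j + 1)) c = classOf I (refinement L I j) c := by
      intro c hc
      ext d
      have := Set.ext_iff.1 h (c, d)
      simp only [S, Set.mem_ofPred_eq, Set.mem_prod] at this
      simp only [classOf, Set.mem_ofPred_eq]
      tauto
    obtain ⟨h₁, h₂, h₃⟩ := hp.2.2
    exact ⟨h₁, h₂, fun R hR c hc => by rw [hcls c hc]; exact h₃ R hR c hc⟩
  have key : ∀ j, S (j + 1) = S j ∨ (S j).ncard + j ≤ I.adom.ncard * I.adom.ncard := by
    intro j
    induction j with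
    | zero =>
      right
      rw [← Set.ncard_prod]
      exact Set.ncard_le_ncard (fun p hp => hp.1) (I.finite_adom.prod I.finite_adom)
    | succ j ih =>
      by_cases h : S (j + 1) = S j
      · exact .inl (hstep j h)
      · have h₁ := ih.resolve_left h
        have h₂ := Set.ncard_lt_ncard ((hanti j).ssubset_of_ne h) (hfin j)
        right
        omega
  have hS : S (j + 1) = S j := by
    rcases key j with h | h
    · exact h
    · have : S j = ∅ := (Set.ncard_eq_zero (hfin j)).1 (by omega)
      rw [this]
      exact Set.subset_eq_empty (this ▸ hanti j) rfl
  have : (a, b) ∈ S (j + 1) := hS ▸ ⟨⟨ha, hb⟩, hab⟩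
  exact this.2.2

variable {r : IndividualName → IndividualName → Prop}

/-- The number of elements of a set of individuals is the sum over the classes. -/
theorem exists_ncard_eq_sum (I : Database D) (hr : Equivalence r) :
    ∃ K : Finset (Set IndividualName), (∀ k ∈ K, ∃ c ∈ I.adom, k = classOf I r c) ∧
      ∀ U ⊆ I.adom, U.ncard = ∑ k ∈ K, (U ∩ k).ncard := by
  classical
  refine ⟨I.finite_adom.toFinset.image (classOf I r), ?_, fun U hU => ?_⟩
  · intro k hk
    obtain ⟨c, hc, rfl⟩ := Finset.mem_image.1 hk
    exact ⟨c, by simpa using hc, rfl⟩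
  · have hfin : U.Finite := I.finite_adom.subset hU
    rw [Set.ncard_eq_toFinset_card U hfin,
      Finset.card_eq_sum_card_fiberwise (f := classOf I r)
        (t := I.finite_adom.toFinset.image (classOf I r))]
    · refine Finset.sum_congr rfl fun k hk => ?_
      obtain ⟨c, hc, rfl⟩ := Finset.mem_image.1 hk
      rw [← Set.ncard_coe_finset]
      congr 1
      ext d
      simp only [Finset.coe_filter, Set.Finite.mem_toFinset, Set.mem_ofPred_eq, Set.mem_inter_iff]
      refine and_congr_right fun hd => ?_
      constructor
      · intro h
        rw [← h]
        exact ⟨hU hd, hr.refl d⟩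
      · rintro ⟨-, h⟩
        ext x
        exact and_congr_right fun _ => ⟨fun h' => hr.trans h h', fun h' => hr.trans (hr.symm h) h'⟩
    · intro d hd
      simp only [Set.Finite.coe_toFinset] at hd
      simp only [Finset.coe_image, Set.Finite.coe_toFinset]
      exact ⟨d, hU hd, rfl⟩

/-- A class meets a set that is compatible with the relation either fully or not at all. -/
theorem inter_classOf_of_mem {U V : Set IndividualName} {c : IndividualName} (hc : c ∈ U)
    (hU : ∀ a ∈ I.adom, ∀ b ∈ I.adom, r a b → (a ∈ U ↔ b ∈ U)) (hcI : c ∈ I.adom) :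
    V ∩ U ∩ classOf I r c = V ∩ classOf I r c := by
  ext d
  constructor
  · exact fun h => ⟨h.1.1, h.2⟩
  · exact fun h => ⟨⟨h.1, (hU c hcI d h.2.1 h.2.2).1 hc⟩, h.2⟩

theorem inter_classOf_of_notMem {U V : Set IndividualName} {c : IndividualName} (hc : c ∉ U)
    (hU : ∀ a ∈ I.adom, ∀ b ∈ I.adom, r a b → (a ∈ U ↔ b ∈ U)) (hcI : c ∈ I.adom) :
    V ∩ U ∩ classOf I r c = ∅ := by
  refine Set.eq_empty_of_forall_notMem fun d hd => hc ?_
  exact (hU c hcI d hd.2.1 hd.2.2).2 hd.1.2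

variable [∀ f, LinearOrder (D f)]

theorem ext_subset_adom (C : Concept D) : I.ext C ⊆ I.adom := by
  cases C with
  | top => exact fun a h => h
  | atom A => exact fun a h => ⟨_, h, by simp [Fact.individuals]⟩
  | neg C => exact fun a h => h.1
  | inter C E => exact fun a h => ext_subset_adom C h.1
  | restrict c n R C => exact fun a h => h.1
  | feature c f v => exact fun a h => h.1

/-- Individuals that are related by a stable equivalence relation are indistinguishable by
concepts. -/
theorem mem_ext_iff_of_stable (hr : Equivalence r)
    (hst : ∀ a ∈ I.adom, ∀ b ∈ I.adom, r a b → Alike L I r a b) (C : Concept D) (hC : C.IsIn L) :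
    ∀ a ∈ I.adom, ∀ b ∈ I.adom, r a b → (a ∈ I.ext C ↔ b ∈ I.ext C) := by
  induction C with
  | top => exact fun a ha b hb _ => ⟨fun _ => hb, fun _ => ha⟩
  | atom A => exact fun a ha b hb h => (hst a ha b hb h).atom A
  | neg C ih =>
    exact fun a ha b hb h => and_congr ⟨fun _ => hb, fun _ => ha⟩ (ih hC a ha b hb h).not
  | inter C E ihC ihE =>
    exact fun a ha b hb h => and_congr (ihC hC.1 a ha b hb h) (ihE hC.2 a ha b hb h)
  | feature c f v =>
    intro a ha b hb h
    refine and_congr ⟨fun _ => hb, fun _ => ha⟩ (exists_congr fun w => and_congr_left fun _ => ?_)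
    exact (hst a ha b hb h).feature hC f w
  | restrict c n R C ih =>
    intro a ha b hb h
    have hR : AllowedRole L R := by
      cases R with
      | name r => trivial
      | inverse r => exact hC.1
    have hC' : C.IsIn L := by
      cases R with
      | name r => exact hC
      | inverse r => exact hC.2
    suffices hcard : (I.succ R a ∩ I.ext C).ncard = (I.succ R b ∩ I.ext C).ncard by
      refine and_congr ⟨fun _ => hb, fun _ => ha⟩ ?_
      rw [hcard]
    obtain ⟨K, hK, hsum⟩ := exists_ncard_eq_sum I hr
    rw [hsum _ fun d hd => ext_subset_adom C hd.2, hsum _ fun d hd => ext_subset_adom C hd.2]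
    refine Finset.sum_congr rfl fun k hk => ?_
    obtain ⟨c, hc, rfl⟩ := hK k hk
    by_cases hcC : c ∈ I.ext C
    · rw [inter_classOf_of_mem hcC (ih hC') hc, inter_classOf_of_mem hcC (ih hC') hc]
      exact (hst a ha b hb h).role R hR c hc
    · rw [inter_classOf_of_notMem hcC (ih hC') hc, inter_classOf_of_notMem hcC (ih hC') hc]

/-- The union of the classes that contain at least as many positive as negative examples fits as
many examples as possible: an `L` concept has to include or exclude each class as a whole. -/
theorem numFitted_le_of_stable (hr : Equivalence r)
    (hst : ∀ a ∈ I.adom, ∀ b ∈ I.adom, r a b → Alike L I r a b) {P N : Set IndividualName}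
    (hP : P ⊆ I.adom) (hN : N ⊆ I.adom) {C : Concept D}
    (hC : I.ext C = {b | b ∈ I.adom ∧ (N ∩ classOf I r b).ncard ≤ (P ∩ classOf I r b).ncard})
    {E : Concept D} (hE : E.IsIn L) : numFitted I P N E ≤ numFitted I P N C := by
  have hE' := mem_ext_iff_of_stable hr hst E hE
  have hC' : ∀ a ∈ I.adom, ∀ b ∈ I.adom, r a b → (a ∈ I.ext C ↔ b ∈ I.ext C) := by
    intro a ha b hb hab
    have : classOf I r a = classOf I r b := by
      ext x
      exact and_congr_right fun _ => ⟨hr.trans (hr.symm hab), hr.trans hab⟩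
    rw [hC]
    simp only [Set.mem_ofPred_eq, this, ha, hb]
  have hcompl {U : Set IndividualName}
      (hU : ∀ a ∈ I.adom, ∀ b ∈ I.adom, r a b → (a ∈ U ↔ b ∈ U)) :
      ∀ a ∈ I.adom, ∀ b ∈ I.adom, r a b → (a ∈ Uᶜ ↔ b ∈ Uᶜ) :=
    fun a ha b hb hab => (hU a ha b hb hab).not
  obtain ⟨K, hK, hsum⟩ := exists_ncard_eq_sum I hr
  unfold numFitted
  rw [Set.sdiff_eq, Set.sdiff_eq, hsum (P ∩ I.ext E) fun d hd => hP hd.1,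
    hsum (N ∩ (I.ext E)ᶜ) fun d hd => hN hd.1, hsum (P ∩ I.ext C) fun d hd => hP hd.1,
    hsum (N ∩ (I.ext C)ᶜ) fun d hd => hN hd.1, ← Finset.sum_add_distrib,
    ← Finset.sum_add_distrib]
  refine Finset.sum_le_sum fun k hk => ?_
  obtain ⟨c, hc, rfl⟩ := hK k hk
  have h₁ : (P ∩ I.ext E ∩ classOf I r c).ncard + (N ∩ (I.ext E)ᶜ ∩ classOf I r c).ncard ≤
      max (P ∩ classOf I r c).ncard (N ∩ classOf I r c).ncard := by
    by_cases hcE : c ∈ I.ext E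
    · rw [inter_classOf_of_mem hcE hE' hc,
        inter_classOf_of_notMem (U := (I.ext E)ᶜ) (by simpa using hcE) (hcompl hE') hc]
      simp
    · rw [inter_classOf_of_notMem hcE hE' hc,
        inter_classOf_of_mem (U := (I.ext E)ᶜ) (by simpa using hcE) (hcompl hE') hc]
      simp
  refine h₁.trans ?_
  by_cases hcC : c ∈ I.ext C
  · rw [inter_classOf_of_mem hcC hC' hc,
      inter_classOf_of_notMem (U := (I.ext C)ᶜ) (by simpa using hcC) (hcompl hC') hc]
    rw [hC] at hcC
    simpa using hcC.2
  · rw [inter_classOf_of_notMem hcC hC' hc,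
      inter_classOf_of_mem (U := (I.ext C)ᶜ) (by simpa using hcC) (hcompl hC') hc]
    rw [hC] at hcC
    have : ¬(N ∩ classOf I r c).ncard ≤ (P ∩ classOf I r c).ncard := fun h => hcC ⟨hc, h⟩
    simp
    omega

/-- A concept fits the examples if and only if it fits the largest possible number of them. -/
theorem fits_iff {P N : Set IndividualName} (hP : P ⊆ I.adom) (hN : N ⊆ I.adom) (C : Concept D) :
    Fits I P N C ↔ P.ncard + N.ncard ≤ numFitted I P N C := by
  have hPf := I.finite_adom.subset hP
  have hNf := I.finite_adom.subset hN
  have h₁ : (P ∩ I.ext C).ncard ≤ P.ncard := Set.ncard_le_ncard Set.inter_subset_left hPf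
  have h₂ : (N \ I.ext C).ncard ≤ N.ncard := Set.ncard_le_ncard Set.sdiff_subset hNf
  unfold Fits numFitted
  constructor
  · rintro ⟨h₃, h₄⟩
    rw [Set.inter_eq_left.2 h₃, sdiff_eq_left.2 (Set.disjoint_left.2 h₄)]
  · intro h
    exact ⟨Set.inter_eq_left.1 (Set.eq_of_subset_of_ncard_le Set.inter_subset_left (by omega) hPf),
      Set.disjoint_left.1 (sdiff_eq_left.1
        (Set.eq_of_subset_of_ncard_le Set.sdiff_subset (by omega) hNf))⟩

end Database

/-! ### Reading the input -/

section Reading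

variable {D : FeatureName → Type} (code : ∀ f, D f → List Bool)

/-- The item that is read for a fact. -/
def itemOfFact : Fact D → Item
  | .concept A a => (.conceptFact, [A, a])
  | .role r a b => (.roleFact, [r, a, b])
  | .feature f a v => (.featureFact, [f, a, code f v])

/-- The items that are read for an input. -/
def itemsOf (X : Input D) : List Item :=
  X.facts.map (itemOfFact code) ++ X.pos.map (fun a => (.posExample, [a])) ++
    X.neg.map (fun a => (.negExample, [a]))

variable {code}

theorem itemOfFact_injective (hcode : ∀ f, Function.Injective (code f)) :
    Function.Injective (itemOfFact code) := by
  rintro (⟨A, a⟩ | ⟨r, a, b⟩ | ⟨f, a, v⟩) (⟨A', a'⟩ | ⟨r', a', b'⟩ | ⟨f', a', v'⟩) h <;>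
    simp only [itemOfFact, Prod.mk.injEq, List.cons.injEq, and_true, true_and, reduceCtorEq,
      false_and] at h
  · rw [h.1, h.2]
  · rw [h.1, h.2.1, h.2.2]
  · obtain ⟨rfl, rfl, h⟩ := h
    rw [hcode _ h]

theorem mem_itemsOf (hcode : ∀ f, Function.Injective (code f)) {X : Input D} {φ : Fact D} :
    itemOfFact code φ ∈ itemsOf code X ↔ φ ∈ X.db.facts := by
  have h₁ : itemOfFact code φ ∉ X.pos.map (fun a => (Symbol.posExample, [a])) := by
    cases φ <;> simp [itemOfFact]
  have h₂ : itemOfFact code φ ∉ X.neg.map (fun a => (Symbol.negExample, [a])) := by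
    cases φ <;> simp [itemOfFact]
  simp only [itemsOf, List.mem_append, h₁, h₂, or_false,
    List.mem_map_of_injective (itemOfFact_injective hcode)]
  rfl

theorem foldr_encodeBits (w : List Bool) (s : List Word × List Item) :
    (encodeBits w).foldr (fun x s => parseStep s x) s = (w :: s.1, s.2) := by
  have h₀ : parseStep s .endMark = ([] :: s.1, s.2) := by
    simp [parseStep, show eqB Symbol.endMark .endMark = true from eqB_iff.2 rfl]
  rw [encodeBits, List.foldr_append, List.foldr_cons, List.foldr_nil, h₀]
  induction w with
  | nil => rfl
  | cons b w ih =>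
    rw [List.map_cons, List.foldr_cons, ih]
    cases b <;> simp [parseStep, eqB]

theorem parse_encodeInput (X : Input D) : parse (encodeInput code X) = itemsOf code X := by
  have hfact (l : List (Fact D)) (is : List Item) :
      (l.flatMap (encodeFact code)).foldr (fun x s => parseStep s x) ([], is) =
        ([], l.map (itemOfFact code) ++ is) := by
    induction l with
    | nil => rfl
    | cons φ l ih =>
      rw [List.flatMap_cons, List.foldr_append, ih]
      cases φ <;> simp only [encodeFact, List.foldr_cons, List.foldr_append, foldr_encodeBits] <;>
        simp [parseStep, eqB, itemOfFact]
  have hexample (x : Symbol) (hx : x = .posExample ∨ x = .negExample) (l : List Word)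
      (is : List Item) :
      (l.flatMap fun a => x :: encodeBits a).foldr (fun x s => parseStep s x) ([], is) =
        ([], l.map (fun a => (x, [a])) ++ is) := by
    induction l with
    | nil => rfl
    | cons a l ih =>
      rw [List.flatMap_cons, List.foldr_append, ih]
      rcases hx with rfl | rfl <;> simp only [List.foldr_cons, foldr_encodeBits] <;>
        simp [parseStep, eqB]
  rw [parse, List.foldl_reverse, encodeInput, List.foldr_append, List.foldr_append,
    hexample _ (.inr rfl), hexample _ (.inl rfl), hfact]
  simp [itemsOf]

theorem mem_inds {X : Input D} {a : Word} : a ∈ inds (itemsOf code X) ↔ a ∈ X.db.adom := by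
  have h : a ∈ X.db.adom ↔ ∃ φ ∈ X.facts, a ∈ φ.individuals := Iff.rfl
  rw [h, inds, (dedupB_spec _).2]
  have hP (φ : Fact D) : a ∈ φ.individuals ↔
      a ∈ (bif eqB (itemOfFact code φ).1 .conceptFact || eqB (itemOfFact code φ).1 .featureFact
        then [Item.word₁ (itemOfFact code φ)]
        else bif eqB (itemOfFact code φ).1 .roleFact
        then [Item.word₁ (itemOfFact code φ), Item.word₂ (itemOfFact code φ)] else []) := by
    cases φ <;> simp [itemOfFact, eqB, Fact.individuals, Item.word₁, Item.word₂]
  simp only [itemsOf, List.flatMap_append, List.mem_append, List.flatMap_map, List.mem_flatMap,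
    ← hP]
  simp [eqB]

theorem nodup_inds (items : List Item) : (inds items).Nodup :=
  (dedupB_spec _).1

theorem examples_pos (X : Input D) : examples .posExample (itemsOf code X) = X.pos := by
  have h (φ : Fact D) : (itemOfFact code φ).1 ≠ .posExample := by
    cases φ <;> simp [itemOfFact]
  simp [examples, itemsOf, List.filter_append, List.filter_map, Function.comp_def, h, eqB,
    Item.word₀]

theorem examples_neg (X : Input D) : examples .negExample (itemsOf code X) = X.neg := by
  have h (φ : Fact D) : (itemOfFact code φ).1 ≠ .negExample := by
    cases φ <;> simp [itemOfFact]
  simp [examples, itemsOf, List.filter_append, List.filter_map, Function.comp_def, h, eqB,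
    Item.word₀]

theorem ncard_setOf_mem {α : Type} {l : List α} (hl : l.Nodup) : {a | a ∈ l}.ncard = l.length := by
  classical
  rw [← List.toFinset_card_of_nodup hl, ← Set.ncard_coe_finset]
  simp

theorem length_inds (X : Input D) : (inds (itemsOf code X)).length = X.db.adom.ncard := by
  rw [← ncard_setOf_mem (nodup_inds _)]
  congr 1
  ext a
  exact mem_inds

theorem isGood_iff {X : Input D} {l : List Word} : isGood (itemsOf code X) l = true ↔
    (X.N ∩ {a | a ∈ l}).ncard ≤ (X.P ∩ {a | a ∈ l}).ncard := by
  rw [isGood, decide_eq_true_iff, examples_pos, examples_neg,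
    ← ncard_setOf_mem (X.nodup_pos.filter _), ← ncard_setOf_mem (X.nodup_neg.filter _)]
  simp only [List.mem_filter, memB_iff]
  rfl

/-! ### The results of the tests -/

/-- The test that counts the `R`-successors in the extension `l` of the node `i`. -/
def roleTest (R : Role) (i : ℕ) (l : List Word) : Test :=
  match R with
  | .name r => (.roleName, r, [], i, l)
  | .inverse r => (.inverseRole, r, [], i, l)

theorem val_role (hcode : ∀ f, Function.Injective (code f)) (X : Input D) (R : Role) (i : ℕ)
    {l : List Word} (hl : l.Nodup) (b : Word) :
    val (itemsOf code X) (roleTest R i l) b = (X.db.succ R b ∩ {c | c ∈ l}).ncard := by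
  have h (c : Word) : query (roleTest R i l) b c ∈ itemsOf code X ↔ c ∈ X.db.succ R b := by
    cases R with
    | name r =>
      have e : query (roleTest (.name r) i l) b c = itemOfFact code (.role r b c) := by
        simp [query, roleTest, eqB, itemOfFact]
      rw [e, mem_itemsOf hcode]
      rfl
    | inverse r =>
      have e : query (roleTest (.inverse r) i l) b c = itemOfFact code (.role r c b) := by
        simp [query, roleTest, eqB, itemOfFact]
      rw [e, mem_itemsOf hcode]
      rfl
  have hl' : (roleTest R i l).2.2.2.2 = l := by cases R <;> rfl
  rw [val, hl', ← ncard_setOf_mem (hl.filter _)]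
  congr 1
  ext c
  simp [h, and_comm]

open Classical in
theorem val_atom (hcode : ∀ f, Function.Injective (code f)) (X : Input D) (A : Word) (b : Word) :
    val (itemsOf code X) (.atom, A, [], 0, [[]]) b =
      if Fact.concept A b ∈ X.db.facts then 1 else 0 := by
  have h := mem_itemsOf hcode (X := X) (φ := .concept A b)
  simp only [itemOfFact] at h
  by_cases hb : Fact.concept A b ∈ X.db.facts <;>
    simp [val, query, eqB, h, hb]

open Classical in
theorem val_feature (hcode : ∀ f, Function.Injective (code f)) (X : Input D) (f : Word) (v : D f)
    (b : Word) : val (itemsOf code X) (.feature, f, code f v, 0, [[]]) b =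
      if Fact.feature f b v ∈ X.db.facts then 1 else 0 := by
  have h := mem_itemsOf hcode (X := X) (φ := .feature f b v)
  simp only [itemOfFact] at h
  by_cases hb : Fact.feature f b v ∈ X.db.facts <;>
    simp [val, query, eqB, h, hb]

variable {inv feat : Bool}

theorem mem_tests {X : Input D} {tbl : List Entry} {τ : Test} :
    τ ∈ tests inv feat (itemsOf code X) tbl ↔
      (∃ A a, Fact.concept A a ∈ X.db.facts ∧ τ = (.atom, A, [], 0, [[]])) ∨
      (feat = true ∧ ∃ f a v, Fact.feature f a v ∈ X.db.facts ∧
        τ = (.feature, f, code f v, 0, [[]])) ∨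
      ∃ r a b, Fact.role r a b ∈ X.db.facts ∧ ∃ e ∈ tbl, τ = roleTest (.name r) e.2.1 e.2.2 ∨
        inv = true ∧ τ = roleTest (.inverse r) e.2.1 e.2.2 := by
  have hdb (φ : Fact D) : φ ∈ X.db.facts ↔ φ ∈ X.facts := Iff.rfl
  simp only [hdb, tests, itemsOf, List.flatMap_append, List.mem_append, List.flatMap_map,
    List.mem_flatMap]
  constructor
  · rintro ((⟨φ, hφ, h⟩ | ⟨a, ha, h⟩) | ⟨a, ha, h⟩)
    · cases φ with
      | concept A a =>
        exact .inl ⟨A, a, hφ, by simpa [itemOfFact, eqB, Item.word₀] using h⟩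
      | feature f a v =>
        cases feat with
        | false => simp [itemOfFact, eqB] at h
        | true =>
          exact .inr (.inl ⟨rfl, f, a, v, hφ, by
            simpa [itemOfFact, eqB, Item.word₀, Item.word₂] using h⟩)
      | role r a b =>
        refine .inr (.inr ⟨r, a, b, hφ, ?_⟩)
        cases inv <;> simpa [itemOfFact, eqB, Item.word₀, roleTest] using h
    · simp [eqB] at h
    · simp [eqB] at h
  · rintro (⟨A, a, hφ, rfl⟩ | ⟨rfl, f, a, v, hφ, rfl⟩ | ⟨r, a, b, hφ, h⟩)
    · exact .inl (.inl ⟨_, hφ, by simp [itemOfFact, eqB, Item.word₀]⟩)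
    · exact .inl (.inl ⟨_, hφ, by simp [itemOfFact, eqB, Item.word₀, Item.word₂]⟩)
    · refine .inl (.inl ⟨_, hφ, ?_⟩)
      cases inv <;> simpa [itemOfFact, eqB, Item.word₀, roleTest] using h

end Reading

/-! ### The DAG of the refinement -/

section Correctness

variable {D : FeatureName → Type} (code : ∀ f, D f → List Bool) (L : DL)

/-- The string `o` represents a DAG with `n` nodes, which represent the `L` concepts `cs`. -/
def Built (o : List Symbol) (n : ℕ) (cs : List (Concept D)) : Prop :=
  ∃ g : DAG D, encodeDAG code g = o ∧ g.unfold = some cs ∧ cs.length = n ∧ ∀ C ∈ cs, C.IsIn L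

variable {code L} {o : List Symbol} {n : ℕ} {cs cs' : List (Concept D)}

theorem Built.append (h : Built code L o n cs) {ν : Node D} {C : Concept D}
    (hν : ν.toConcept cs = some C) (hC : C.IsIn L) :
    Built code L (o ++ encodeNode code ν) (n + 1) (cs ++ [C]) := by
  obtain ⟨g, rfl, hg, rfl, hcs⟩ := h
  refine ⟨g ++ [ν], by simp [encodeDAG], ?_, by simp, ?_⟩
  · rw [DAG.unfold] at hg ⊢
    simp [List.foldlM_append, hg, hν]
  · simpa [or_imp, forall_and] using ⟨hcs, hC⟩

theorem Built.isIn (h : Built code L o n cs) {i : ℕ} {C : Concept D} (hC : cs[i]? = some C) :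
    C.IsIn L := by
  obtain ⟨g, -, -, -, hcs⟩ := h
  exact hcs C (List.mem_of_getElem? hC)

theorem Built.getElem?_append (h : Built code L o n cs) (i : ℕ) (ds : List (Concept D)) :
    (cs ++ ds)[n + i]? = ds[i]? := by
  obtain ⟨g, -, -, rfl, -⟩ := h
  rw [List.getElem?_append_right (by omega), Nat.add_sub_cancel_left]

theorem getElem?_of_prefix (h : cs <+: cs') {i : ℕ} {C : Concept D} (hC : cs[i]? = some C) :
    cs'[i]? = some C := by
  obtain ⟨ds, rfl⟩ := h
  rw [List.getElem?_append_left (List.getElem?_eq_some_iff.1 hC).1, hC]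

theorem Built.neg (h : Built code L o n cs) {i : ℕ} {C : Concept D} (hC : cs[i]? = some C) :
    Built code L (o ++ nodeString (.neg i)) (n + 1) (cs ++ [.neg C]) :=
  h.append (ν := .neg i) (by simp [Node.toConcept, hC]) (h.isIn (C := C) hC)

theorem Built.inter (h : Built code L o n cs) {i j : ℕ} {C E : Concept D} (hC : cs[i]? = some C)
    (hE : cs[j]? = some E) :
    Built code L (o ++ nodeString (.inter i j)) (n + 1) (cs ++ [.inter C E]) :=
  h.append (ν := .inter i j) (by simp [Node.toConcept, hC, hE]) ⟨h.isIn hC, h.isIn hE⟩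

variable [∀ f, LinearOrder (D f)]

/-- The extension of the concept number `i` is the set `S`. -/
def HasExt (I : Database D) (cs : List (Concept D)) (i : ℕ) (S : Set IndividualName) : Prop :=
  ∃ C, cs[i]? = some C ∧ I.ext C = S

theorem HasExt.mono {I : Database D} {i : ℕ} {S : Set IndividualName} (h : HasExt I cs i S)
    (hcs : cs <+: cs') : HasExt I cs' i S := by
  obtain ⟨C, hC, hS⟩ := h
  exact ⟨C, getElem?_of_prefix hcs hC, hS⟩

/-- The tests that may be used when the concepts `cs` are available. -/
inductive Admissible (code : ∀ f, D f → List Bool) (L : DL) (I : Database D)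
    (cs : List (Concept D)) : Test → Prop
  | atom (A : ConceptName) : Admissible code L I cs (.atom, A, [], 0, [[]])
  | feature (f : FeatureName) (v : D f) (hL : L.AllowsFeatures) :
      Admissible code L I cs (.feature, f, code f v, 0, [[]])
  | role (R : Role) (i : ℕ) (l : List Word) (hR : AllowedRole L R) (hl : l.Nodup)
      (h : HasExt I cs i {a | a ∈ l}) : Admissible code L I cs (roleTest R i l)

theorem Admissible.mono {I : Database D} {τ : Test} (h : Admissible code L I cs τ)
    (hcs : cs <+: cs') : Admissible code L I cs' τ := by
  cases h with
  | atom A => exact .atom A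
  | feature f v hL => exact .feature f v hL
  | role R i l hR hl h => exact .role R i l hR hl (h.mono hcs)

/-- The nodes that are added for a test single out the individuals with a given result. -/
theorem Admissible.exists_node (hcode : ∀ f, Function.Injective (code f)) {X : Input D} {τ : Test}
    (h : Admissible code L X.db cs τ) (hcs : ∀ C ∈ cs, C.IsIn L) (a : Word) :
    ∃ (ν : Cmp → Node D) (K : Cmp → Concept D),
      (∀ c, testString τ c (val (itemsOf code X) τ a) = encodeNode code (ν c)) ∧
      (∀ c cs', cs <+: cs' → (ν c).toConcept cs' = some (K c)) ∧ (∀ c, (K c).IsIn L) ∧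
      ∀ b ∈ X.db.adom, (b ∈ X.db.ext (K .ge) ∩ X.db.ext (K .le) ↔
        if negated τ (val (itemsOf code X) τ a) then
          val (itemsOf code X) τ b ≠ val (itemsOf code X) τ a
        else val (itemsOf code X) τ b = val (itemsOf code X) τ a) := by
  classical
  cases h with
  | atom A =>
    refine ⟨fun _ => .atom A, fun _ => .atom A, fun c => by simp [testString, eqB, nodeString,
      encodeNode], fun _ _ _ => rfl, fun _ => trivial, fun b hb => ?_⟩
    rw [Set.inter_self, val_atom hcode, val_atom hcode, negated]
    by_cases ha : Fact.concept A a ∈ X.db.facts <;>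
      by_cases hb : Fact.concept A b ∈ X.db.facts <;> simp [ha, hb, eqB, Database.ext]
  | feature f v hL =>
    refine ⟨fun c => .feature c f v, fun c => .feature c f v, fun c => by simp [testString, eqB,
      nodeString, encodeNode], fun _ _ _ => rfl, fun _ => hL, fun b hb => ?_⟩
    have hext : b ∈ X.db.ext (.feature .ge f v) ∩ X.db.ext (.feature .le f v) ↔
        Fact.feature f b v ∈ X.db.facts := by
      constructor
      · rintro ⟨⟨-, w, hw, hwv⟩, -, w', hw', hwv'⟩
        obtain rfl := X.db.functional f b w w' hw hw'
        obtain rfl : w = v := le_antisymm hwv' hwv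
        exact hw
      · exact fun h => ⟨⟨hb, v, h, le_refl v⟩, hb, v, h, le_refl v⟩
    rw [hext, val_feature hcode, val_feature hcode, negated]
    by_cases ha : Fact.feature f a v ∈ X.db.facts <;>
      by_cases hb : Fact.feature f b v ∈ X.db.facts <;> simp [ha, hb, eqB]
  | role R i l hR hl h =>
    obtain ⟨C, hC, hS⟩ := h
    have hneg : negated (roleTest R i l) (val (itemsOf code X) (roleTest R i l) a) = false := by
      cases R <;> simp [negated, roleTest, eqB]
    refine ⟨fun c => .restrict c (val (itemsOf code X) (roleTest R i l) a) R i,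
      fun c => .restrict c (val (itemsOf code X) (roleTest R i l) a) R C, fun c => ?_,
      fun c cs' hcs' => ?_, fun c => ?_, fun b hb => ?_⟩
    · cases R <;> simp [testString, roleTest, eqB, nodeString, encodeNode]
    · simp [Node.toConcept, getElem?_of_prefix hcs' hC]
    · have hCL : C.IsIn L := hcs C (List.mem_of_getElem? hC)
      cases R with
      | name r => exact hCL
      | inverse r => exact ⟨hR, hCL⟩
    · rw [hneg, val_role hcode X R i hl, val_role hcode X R i hl, ← hS]
      simp only [Database.ext, Cmp.Holds, Set.mem_inter_iff, Set.mem_ofPred_eq, hb, true_and]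
      simp
      omega

variable {X : Input D}

/-- If the class of a state is represented by a node, then so is the class after a test. -/
theorem exists_step (hcode : ∀ f, Function.Injective (code f)) (a : Word) {s : State} {τ : Test}
    (hs : Built code L s.1 s.2.1 cs) (hi : HasExt X.db cs s.2.2.1 {b | b ∈ s.2.2.2})
    (hτ : Admissible code L X.db cs τ) :
    ∃ cs', cs <+: cs' ∧
      Built code L (step (itemsOf code X) a s τ).1 (step (itemsOf code X) a s τ).2.1 cs' ∧
      HasExt X.db cs' (step (itemsOf code X) a s τ).2.2.1
        {b | b ∈ (step (itemsOf code X) a s τ).2.2.2} := by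
  obtain ⟨ν, K, hstr, hν, hK, hext⟩ := hτ.exists_node hcode (fun C hC => by
    obtain ⟨g, -, -, -, h⟩ := hs
    exact h C hC) a
  obtain ⟨o, n, i, l⟩ := s
  obtain ⟨C, hC, hl⟩ := hi
  simp only at hs hC hl
  have h₁ := hs.append (hν .ge cs (List.prefix_refl _)) (hK _)
  have h₂ := h₁.append (hν .le _ (List.prefix_append _ _)) (hK _)
  have get (ds : List (Concept D)) (j : ℕ) {E : Concept D} (h : ds[j]? = some E) :
      (cs ++ ds)[n + j]? = some E := (hs.getElem?_append j ds).trans h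
  have h₃ := h₂.inter (i := n) (j := n + 1) (C := K .ge) (E := K .le)
    (by simpa using get [K .ge, K .le] 0 rfl) (by simpa using get [K .ge, K .le] 1 rfl)
  simp only [List.append_assoc] at h₁ h₂ h₃
  have hmem {b : Word} : b ∈ X.db.ext C ↔ b ∈ l := by rw [hl]; rfl
  cases hneg : negated τ (val (itemsOf code X) τ a) with
  | true =>
    have h₄ := h₃.neg (i := n + 2) (C := .inter (K .ge) (K .le)) (by exact get _ 2 rfl)
    have h₅ := h₄.inter (i := i) (j := n + 3) (C := C) (E := .neg (.inter (K .ge) (K .le)))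
      (by rw [List.append_assoc]; exact getElem?_of_prefix (List.prefix_append _ _) hC)
      (by rw [List.append_assoc]; exact get _ 3 rfl)
    refine ⟨cs ++ [K .ge, K .le, .inter (K .ge) (K .le), .neg (.inter (K .ge) (K .le)),
      .inter C (.neg (.inter (K .ge) (K .le)))], List.prefix_append _ _, ?_,
      .inter C (.neg (.inter (K .ge) (K .le))), ?_, ?_⟩
    · simpa [step, hneg, hstr] using h₅
    · simp only [step, hneg, cond_true]
      exact get _ 4 rfl
    · ext b
      simp only [step, List.mem_filter, eqB_iff, Set.mem_ofPred_eq, Database.ext, Set.mem_inter_iff,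
        Set.mem_sdiff, hmem]
      refine and_congr_right fun hb => ?_
      have hbI := ext_subset_adom C (hmem.2 hb)
      have := hext b hbI
      simp only [hneg, Set.mem_inter_iff, if_true] at this
      rw [this]
      simp [hbI]
  | false =>
    have h₅ := h₃.inter (i := i) (j := n + 2) (C := C) (E := .inter (K .ge) (K .le))
      (getElem?_of_prefix (List.prefix_append _ _) hC)
      (by exact get _ 2 rfl)
    refine ⟨cs ++ [K .ge, K .le, .inter (K .ge) (K .le), .inter C (.inter (K .ge) (K .le))],
      List.prefix_append _ _, ?_, .inter C (.inter (K .ge) (K .le)), ?_, ?_⟩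
    · simpa [step, hneg, hstr] using h₅
    · simp only [step, hneg, cond_false]
      exact get _ 3 rfl
    · ext b
      simp only [step, List.mem_filter, eqB_iff, Set.mem_ofPred_eq, Database.ext, Set.mem_inter_iff,
        hmem]
      refine and_congr_right fun hb => ?_
      have := hext b (ext_subset_adom C (hmem.2 hb))
      simpa [hneg, Set.mem_inter_iff] using this

theorem exists_foldl_step (hcode : ∀ f, Function.Injective (code f)) (a : Word) (ts : List Test) :
    ∀ {s : State} {cs : List (Concept D)}, Built code L s.1 s.2.1 cs →
      HasExt X.db cs s.2.2.1 {b | b ∈ s.2.2.2} → (∀ τ ∈ ts, Admissible code L X.db cs τ) →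
      ∃ cs', cs <+: cs' ∧
        Built code L (ts.foldl (step (itemsOf code X) a) s).1
          (ts.foldl (step (itemsOf code X) a) s).2.1 cs' ∧
        HasExt X.db cs' (ts.foldl (step (itemsOf code X) a) s).2.2.1
          {b | b ∈ (ts.foldl (step (itemsOf code X) a) s).2.2.2} := by
  induction ts with
  | nil => exact fun {s cs} hs hi _ => ⟨cs, List.prefix_refl _, hs, hi⟩
  | cons τ ts ih =>
    intro s cs hs hi hts
    obtain ⟨cs₁, hcs₁, hs₁, hi₁⟩ := exists_step hcode a hs hi (hts τ (by simp))
    obtain ⟨cs₂, hcs₂, h⟩ := ih hs₁ hi₁ fun σ hσ => (hts σ (by simp [hσ])).mono hcs₁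
    exact ⟨cs₂, hcs₁.trans hcs₂, h⟩

theorem foldl_step_class (items : List Item) (a : Word) (ts : List Test) (s : State) :
    (ts.foldl (step items a) s).2.2.2 =
      s.2.2.2.filter fun b => ts.all fun τ => eqB (val items τ b) (val items τ a) := by
  induction ts generalizing s with
  | nil => simp
  | cons τ ts ih => simp [ih, step, List.filter_filter, Bool.and_comm]

/-- The table entry `e` is correct for the relation `r`: its list is the class of its individual,
and its node represents this class. -/
structure Correct (I : Database D) (r : IndividualName → IndividualName → Prop)
    (cs : List (Concept D)) (e : Entry) : Prop where
  nodup : e.2.2.Nodup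
  eq_classOf : {b | b ∈ e.2.2} = classOf I r e.1
  hasExt : HasExt I cs e.2.1 {b | b ∈ e.2.2}

theorem Correct.mono {I : Database D} {r : IndividualName → IndividualName → Prop} {e : Entry}
    (h : Correct I r cs e) (hcs : cs <+: cs') : Correct I r cs' e :=
  ⟨h.nodup, h.eq_classOf, h.hasExt.mono hcs⟩

/-- The refinement of the entries of a table for `r` yields correct entries for `r'`, if `r'` is the
part of `r` on which the results of the tests agree. -/
theorem exists_foldl_refineEntry (hcode : ∀ f, Function.Injective (code f))
    {r r' : IndividualName → IndividualName → Prop} {ts : List Test}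
    (hr : ∀ a ∈ X.db.adom, ∀ b ∈ X.db.adom, r' a b ↔ r a b ∧
      ∀ τ ∈ ts, val (itemsOf code X) τ b = val (itemsOf code X) τ a) (es : List Entry) :
    ∀ {s : List Symbol × ℕ × List Entry} {cs : List (Concept D)}, Built code L s.1 s.2.1 cs →
      (∀ τ ∈ ts, Admissible code L X.db cs τ) →
      (∀ e ∈ es, e.1 ∈ X.db.adom ∧ Correct X.db r cs e) → (∀ e ∈ s.2.2, Correct X.db r' cs e) →
      ∃ cs', cs <+: cs' ∧
        Built code L (es.foldl (refineEntry (itemsOf code X) ts) s).1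
          (es.foldl (refineEntry (itemsOf code X) ts) s).2.1 cs' ∧
        (∀ e ∈ (es.foldl (refineEntry (itemsOf code X) ts) s).2.2, Correct X.db r' cs' e) ∧
        (es.foldl (refineEntry (itemsOf code X) ts) s).2.2.map Prod.fst =
          s.2.2.map Prod.fst ++ es.map Prod.fst := by
  induction es with
  | nil => exact fun {s cs} hs _ _ hs' => ⟨cs, List.prefix_refl _, hs, hs', by simp⟩
  | cons e es ih =>
    intro s cs hs hts hes hs'
    obtain ⟨he, hec⟩ := hes e (by simp)
    obtain ⟨cs₁, hcs₁, hb₁, hi₁⟩ :=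
      exists_foldl_step hcode e.1 ts (s := (s.1, s.2.1, e.2)) hs hec.hasExt hts
    have hclass := foldl_step_class (itemsOf code X) e.1 ts (s.1, s.2.1, e.2)
    have hnew : Correct X.db r' cs₁
        (e.1, (ts.foldl (step (itemsOf code X) e.1) (s.1, s.2.1, e.2)).2.2) := by
      refine ⟨?_, ?_, hi₁⟩
      · simp only [hclass]
        exact hec.nodup.filter _
      · ext b
        have hb : b ∈ e.2.2 ↔ b ∈ X.db.adom ∧ r e.1 b := Set.ext_iff.1 hec.eq_classOf b
        simp only [hclass, Set.mem_ofPred_eq, List.mem_filter, hb, classOf, List.all_eq_true,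
          eqB_iff, and_assoc]
        exact and_congr_right fun hb => (hr e.1 he b hb).symm
    obtain ⟨cs₂, hcs₂, hb₂, hc₂, hm₂⟩ := ih (s := refineEntry (itemsOf code X) ts s e) hb₁
      (fun τ hτ => (hts τ hτ).mono hcs₁)
      (fun e' he' => ⟨(hes e' (by simp [he'])).1, (hes e' (by simp [he'])).2.mono hcs₁⟩)
      (fun e' he' => by
        rcases List.mem_append.1 he' with h | h
        · exact (hs' e' h).mono hcs₁
        · rw [List.mem_singleton.1 h]
          exact hnew)
    refine ⟨cs₂, hcs₁.trans hcs₂, hb₂, hc₂, ?_⟩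
    rw [List.foldl_cons, hm₂]
    simp [refineEntry]

end Correctness

/-! ### Correctness of the algorithm -/

section Optimality

variable {D : FeatureName → Type} {code : ∀ f, D f → List Bool} {L : DL} {inv feat : Bool}
  {X : Input D}

/-- The individuals for which all tests have the same results are those that are alike. -/
theorem forall_tests_iff (hcode : ∀ f, Function.Injective (code f))
    (hinv : inv = true ↔ L.AllowsInverse) (hfeat : feat = true ↔ L.AllowsFeatures)
    {r : IndividualName → IndividualName → Prop} {tbl : List Entry}
    (htbl : tbl.map Prod.fst = inds (itemsOf code X))
    (hcls : ∀ e ∈ tbl, e.2.2.Nodup ∧ {b | b ∈ e.2.2} = classOf X.db r e.1) (a b : Word) :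
    (∀ τ ∈ tests inv feat (itemsOf code X) tbl,
      val (itemsOf code X) τ b = val (itemsOf code X) τ a) ↔ Alike L X.db r a b := by
  classical
  constructor
  · intro h
    refine ⟨fun A => ?_, fun hL f v => ?_, fun R hR c hc => ?_⟩
    · have key {x : Word} (hx : Fact.concept A x ∈ X.db.facts) :
          Fact.concept A a ∈ X.db.facts ↔ Fact.concept A b ∈ X.db.facts := by
        have := h _ (mem_tests.2 (.inl ⟨A, x, hx, rfl⟩))
        rw [val_atom hcode, val_atom hcode] at this
        by_cases ha : Fact.concept A a ∈ X.db.facts <;>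
          by_cases hb : Fact.concept A b ∈ X.db.facts <;> simp_all
      exact ⟨fun ha => (key ha).1 ha, fun hb => (key hb).2 hb⟩
    · have key {x : Word} (hx : Fact.feature f x v ∈ X.db.facts) :
          Fact.feature f a v ∈ X.db.facts ↔ Fact.feature f b v ∈ X.db.facts := by
        have := h _ (mem_tests.2 (.inr (.inl ⟨hfeat.2 hL, f, x, v, hx, rfl⟩)))
        rw [val_feature hcode, val_feature hcode] at this
        by_cases ha : Fact.feature f a v ∈ X.db.facts <;>
          by_cases hb : Fact.feature f b v ∈ X.db.facts <;> simp_all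
      exact ⟨fun ha => (key ha).1 ha, fun hb => (key hb).2 hb⟩
    · obtain ⟨e, he, rfl⟩ : ∃ e ∈ tbl, e.1 = c := by
        rw [← mem_inds (code := code), ← htbl] at hc
        simpa using hc
      obtain ⟨hnd, hcl⟩ := hcls e he
      -- a role name that occurs in no fact has no successors and yields no test
      have key {x y : Word} (hxy : y ∈ X.db.succ R x) :
          (X.db.succ R a ∩ classOf X.db r e.1).ncard =
            (X.db.succ R b ∩ classOf X.db r e.1).ncard := by
        have hmem : roleTest R e.2.1 e.2.2 ∈ tests inv feat (itemsOf code X) tbl := by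
          cases R with
          | name s => exact mem_tests.2 (.inr (.inr ⟨s, x, y, hxy, e, he, .inl rfl⟩))
          | inverse s =>
            exact mem_tests.2 (.inr (.inr ⟨s, y, x, hxy, e, he, .inr ⟨hinv.2 hR, rfl⟩⟩))
        have := h _ hmem
        rw [val_role hcode X R _ hnd, val_role hcode X R _ hnd, hcl] at this
        exact this.symm
      by_cases hsucc : ∃ x y, y ∈ X.db.succ R x
      · obtain ⟨x, y, hxy⟩ := hsucc
        exact key hxy
      · have hempty (x : Word) : X.db.succ R x = ∅ :=
          Set.eq_empty_of_forall_notMem fun y hy => hsucc ⟨x, y, hy⟩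
        rw [hempty, hempty]
  · intro h τ hτ
    have hrole (R : Role) (hR : AllowedRole L R) (e : Entry) (he : e ∈ tbl) :
        val (itemsOf code X) (roleTest R e.2.1 e.2.2) b =
          val (itemsOf code X) (roleTest R e.2.1 e.2.2) a := by
      rw [val_role hcode X R _ (hcls e he).1, val_role hcode X R _ (hcls e he).1, (hcls e he).2]
      refine (h.role R hR e.1 ?_).symm
      rw [← mem_inds (code := code), ← htbl]
      exact List.mem_map_of_mem he
    rcases mem_tests.1 hτ with ⟨A, x, -, rfl⟩ | ⟨hf, f, x, v, -, rfl⟩ | ⟨s, x, y, -, e, he, h'⟩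
    · rw [val_atom hcode, val_atom hcode]
      simp only [h.atom A]
    · rw [val_feature hcode, val_feature hcode]
      simp only [h.feature (hfeat.1 hf) f v]
    · rcases h' with rfl | ⟨hi, rfl⟩
      · exact hrole (.name s) trivial e he
      · exact hrole (.inverse s) (hinv.1 hi) e he

variable [∀ f, LinearOrder (D f)]

/-- The state of the algorithm after the refinement has reached the relation `r`. The node `0` is
`⊤`, the starting point for the intersection of the complements of the good classes. -/
structure Reached (code : ∀ f, D f → List Bool) (L : DL) (X : Input D)
    (r : IndividualName → IndividualName → Prop) (cs : List (Concept D))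
    (s : List Symbol × ℕ × List Entry) : Prop where
  built : Built code L s.1 s.2.1 cs
  top : HasExt X.db cs 0 X.db.adom
  inds : s.2.2.map Prod.fst = inds (itemsOf code X)
  correct : ∀ e ∈ s.2.2, Correct X.db r cs e

theorem Reached.mem_adom {r : IndividualName → IndividualName → Prop} {cs : List (Concept D)}
    {s : List Symbol × ℕ × List Entry} (h : Reached code L X r cs s) {e : Entry} (he : e ∈ s.2.2) :
    e.1 ∈ X.db.adom := by
  rw [← mem_inds (code := code), ← h.inds]
  exact List.mem_map_of_mem he

/-- The tests of a round compare individuals by the current classes. -/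
theorem Reached.round (hcode : ∀ f, Function.Injective (code f))
    (hinv : inv = true ↔ L.AllowsInverse) (hfeat : feat = true ↔ L.AllowsFeatures)
    {r : IndividualName → IndividualName → Prop} {cs : List (Concept D)}
    {s : List Symbol × ℕ × List Entry} (h : Reached code L X r cs s) :
    ∃ cs', Reached code L X (fun a b => r a b ∧ Alike L X.db r a b) cs'
      (round inv feat (itemsOf code X) s) := by
  have htests := forall_tests_iff hcode hinv hfeat h.inds
    (r := r) fun e he => ⟨(h.correct e he).nodup, (h.correct e he).eq_classOf⟩
  obtain ⟨cs', hcs', hb, hc, hm⟩ := exists_foldl_refineEntry (X := X) hcode (L := L)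
    (ts := tests inv feat (itemsOf code X) s.2.2)
    (r := r) (r' := fun a b => r a b ∧ Alike L X.db r a b)
    (fun a _ b _ => and_congr_right fun _ => (htests a b).symm) s.2.2 (s := (s.1, s.2.1, []))
    h.built (fun τ hτ => by
      have hrole (R : Role) (hR : AllowedRole L R) (e : Entry) (he : e ∈ s.2.2) :
          Admissible code L X.db cs (roleTest R e.2.1 e.2.2) :=
        .role R _ _ hR (h.correct e he).nodup (h.correct e he).hasExt
      rcases mem_tests.1 hτ with ⟨A, x, -, rfl⟩ | ⟨hf, f, x, v, -, rfl⟩ | ⟨t, x, y, -, e, he, h'⟩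
      · exact .atom A
      · exact .feature f v (hfeat.1 hf)
      · rcases h' with rfl | ⟨hi, rfl⟩
        · exact hrole (.name t) trivial e he
        · exact hrole (.inverse t) (hinv.1 hi) e he)
    (fun e he => ⟨h.mem_adom he, h.correct e he⟩) (by simp)
  exact ⟨cs', hb, h.top.mono hcs', hm.trans h.inds, hc⟩

theorem exists_reached (hcode : ∀ f, Function.Injective (code f))
    (hinv : inv = true ↔ L.AllowsInverse) (hfeat : feat = true ↔ L.AllowsFeatures) :
    ∃ cs, Reached code L X (refinement L X.db (X.db.adom.ncard * X.db.adom.ncard)) cs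
      (rounds inv feat (itemsOf code X)) := by
  have hfold (l : List Word) : ∀ {j : ℕ} {cs : List (Concept D)}
      {s : List Symbol × ℕ × List Entry}, Reached code L X (refinement L X.db j) cs s →
      ∃ cs', Reached code L X (refinement L X.db (j + l.length)) cs'
        (l.foldl (fun s _ => round inv feat (itemsOf code X) s) s) := by
    induction l with
    | nil => exact fun {j cs s} h => ⟨cs, h⟩
    | cons a l ih =>
      intro j cs s h
      obtain ⟨cs₁, h₁⟩ := h.round (inv := inv) (feat := feat) hcode hinv hfeat
      obtain ⟨cs₂, h₂⟩ := ih (j := j + 1) h₁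
      refine ⟨cs₂, ?_⟩
      rwa [Nat.add_assoc, Nat.add_comm 1] at h₂
  have hlen : ((inds (itemsOf code X)).flatMap fun _ => inds (itemsOf code X)).length =
      X.db.adom.ncard * X.db.adom.ncard := by
    simp [List.length_flatMap, length_inds]
  have htop : HasExt X.db [.top] 0 X.db.adom := ⟨.top, rfl, rfl⟩
  have hall : {b | b ∈ inds (itemsOf code X)} = X.db.adom := Set.ext fun b => mem_inds
  have h₀ : Reached code L X (refinement L X.db 0) [.top] (nodeString .top, 1,
      (inds (itemsOf code X)).map fun a => (a, 0, inds (itemsOf code X))) := by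
    refine ⟨⟨[.top], rfl, rfl, rfl, ?_⟩, htop, by simp [Function.comp_def], fun e he => ?_⟩
    · intro C hC
      rw [List.mem_singleton.1 hC]
      trivial
    · obtain ⟨a, -, rfl⟩ := List.mem_map.1 he
      exact ⟨nodup_inds _, by simp [hall, classOf, refinement], hall ▸ htop⟩
  have := hfold ((inds (itemsOf code X)).flatMap fun _ => inds (itemsOf code X)) h₀
  rwa [hlen, Nat.zero_add] at this

/-- The individuals that are left by `collect` are those that belong to no good class. -/
theorem exists_foldl_collect {r : IndividualName → IndividualName → Prop} (es : List Entry) :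
    ∀ {s : List Symbol × ℕ × ℕ} {cs : List (Concept D)} {S : Set IndividualName},
      Built code L s.1 s.2.1 cs → HasExt X.db cs s.2.2 S → (∀ e ∈ es, Correct X.db r cs e) →
      ∃ cs', Built code L (es.foldl (collect (itemsOf code X)) s).1
          (es.foldl (collect (itemsOf code X)) s).2.1 cs' ∧
        HasExt X.db cs' (es.foldl (collect (itemsOf code X)) s).2.2
          {b | b ∈ S ∧ ∀ e ∈ es, isGood (itemsOf code X) e.2.2 = true → b ∉ e.2.2} := by
  induction es with
  | nil => exact fun {s cs S} hs hS _ => ⟨cs, hs, by simpa using hS⟩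
  | cons e es ih =>
    intro s cs S hs hS hes
    by_cases hgood : isGood (itemsOf code X) e.2.2 = true
    · obtain ⟨C, hC, hCS⟩ := hS
      obtain ⟨E, hE, hEe⟩ := (hes e (by simp)).hasExt
      have h₁ := hs.neg hE
      have h₂ := h₁.inter (i := s.2.2) (j := s.2.1) (C := C) (E := .neg E)
        (getElem?_of_prefix (List.prefix_append _ _) hC) (hs.getElem?_append 0 [.neg E])
      obtain ⟨cs', hb, hx⟩ := ih (s := collect (itemsOf code X) s e)
        (cs := cs ++ [.neg E] ++ [.inter C (.neg E)]) (S := S ∩ (X.db.adom \ {b | b ∈ e.2.2}))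
        (by simpa [collect, hgood] using h₂)
        ⟨.inter C (.neg E), by
          simpa [collect, hgood] using hs.getElem?_append 1 [.neg E, .inter C (.neg E)],
          by simp [Database.ext, hCS, hEe]⟩
        (fun e' he' => (hes e' (by simp [he'])).mono (by simp))
      have hset : {b | b ∈ S ∧ ∀ e' ∈ e :: es, isGood (itemsOf code X) e'.2.2 = true → b ∉ e'.2.2} =
          {b | b ∈ S ∩ (X.db.adom \ {b | b ∈ e.2.2}) ∧
            ∀ e' ∈ es, isGood (itemsOf code X) e'.2.2 = true → b ∉ e'.2.2} := by
        ext b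
        have hSI : b ∈ S → b ∈ X.db.adom := fun hb => ext_subset_adom C (hCS ▸ hb)
        simp only [List.forall_mem_cons, Set.mem_ofPred_eq, Set.mem_inter_iff, Set.mem_sdiff, hgood]
        tauto
      rw [hset]
      exact ⟨cs', hb, hx⟩
    · obtain ⟨cs', hb, hx⟩ := ih (s := s) hs hS fun e' he' => hes e' (by simp [he'])
      have e₁ : collect (itemsOf code X) s e = s := by simp [collect, hgood]
      refine ⟨cs', by rwa [List.foldl_cons, e₁], ?_⟩
      rw [List.foldl_cons, e₁]
      simpa [hgood] using hx

/-- The output represents a concept whose extension is the union of the good classes, and this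
concept is optimal. -/
theorem exists_output (hcode : ∀ f, Function.Injective (code f))
    (hinv : inv = true ↔ L.AllowsInverse) (hfeat : feat = true ↔ L.AllowsFeatures)
    (X : Input D) :
    ∃ g : DAG D, encodeDAG code g = output inv feat (itemsOf code X) ∧
      ∃ C : Concept D, g.toConcept = some C ∧ C.IsIn L ∧
        ∀ E : Concept D, E.IsIn L → numFitted X.db X.P X.N E ≤ numFitted X.db X.P X.N C := by
  obtain ⟨cs, h⟩ := exists_reached (X := X) (inv := inv) (feat := feat) hcode hinv hfeat
  have hr := refinement_equivalence (L := L) (I := X.db) (X.db.adom.ncard * X.db.adom.ncard)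
  have hst := fun a ha b hb => refinement_stable (L := L) (I := X.db) rfl (a := a) (b := b) ha hb
  generalize refinement L X.db (X.db.adom.ncard * X.db.adom.ncard) = r at h hr hst
  obtain ⟨cs', hb, C, hC, hS⟩ := exists_foldl_collect (X := X) _ (s := ((rounds inv feat
    (itemsOf code X)).1, (rounds inv feat (itemsOf code X)).2.1, 0)) h.built h.top h.correct
  obtain ⟨g, hg, hun, -, hL⟩ := hb.neg hC
  refine ⟨g, hg, .neg C, by simp [DAG.toConcept, hun], hL (.neg C) (by simp), fun E hE => ?_⟩
  refine numFitted_le_of_stable hr hst (fun a ha => X.pos_occurs a ha)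
    (fun a ha => X.neg_occurs a ha) ?_ hE
  ext b
  simp only [Database.ext, hS, Set.mem_sdiff, Set.mem_ofPred_eq, not_and, not_forall, not_not]
  refine and_congr_right fun hbI => ?_
  have hcls {a : IndividualName} (hab : r a b) : classOf X.db r a = classOf X.db r b := by
    ext x
    exact and_congr_right fun _ => ⟨hr.trans (hr.symm hab), hr.trans hab⟩
  constructor
  · intro h'
    obtain ⟨e, he, hgood, hbe⟩ := h' hbI
    have hcl := (h.correct e he).eq_classOf
    rw [isGood_iff, hcl] at hgood
    have : b ∈ classOf X.db r e.1 := hcl ▸ hbe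
    rwa [hcls this.2] at hgood
  · intro hgood _
    obtain ⟨e, he, rfl⟩ : ∃ e ∈ (rounds inv feat (itemsOf code X)).2.2, e.1 = b := by
      rw [← mem_inds (code := code), ← h.inds] at hbI
      simpa using hbI
    have hcl := (h.correct e he).eq_classOf
    refine ⟨e, he, by rwa [isGood_iff, hcl], ?_⟩
    have : e.1 ∈ classOf X.db r e.1 := ⟨hbI, hr.refl _⟩
    rw [← hcl] at this
    exact this

end Optimality
end Fitting
end DLFitting

theorem theorem2
    (D : DLFitting.FeatureName → Type) [∀ f, LinearOrder (D f)]
    (code : ∀ f, D f → List Bool) (hcode : ∀ f, Function.Injective (code f))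
    (L : DLFitting.DL) :
    ∃ 𝒜 : DLFitting.Input D → DLFitting.DAG D,
      DLFitting.IsPolyTime code 𝒜 ∧
      DLFitting.IsFittingAlgorithm L 𝒜 ∧
      DLFitting.IsOptimal L 𝒜 := by
  classical
  choose 𝒜 henc hopt using DLFitting.Fitting.exists_output (L := L) hcode
    (decide_eq_true_iff (p := L.AllowsInverse)) (decide_eq_true_iff (p := L.AllowsFeatures))
  refine ⟨𝒜, ?_, fun X => ?_, hopt⟩
  · refine DLFitting.Machine.PolyTime.computable
      ((DLFitting.Fitting.polyTime_output (decide L.AllowsInverse) (decide L.AllowsFeatures)).comp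
        DLFitting.Fitting.polyTime_parse) fun X => ?_
    rw [henc, DLFitting.Fitting.parse_encodeInput]
  · obtain ⟨C, hC, hCL, h⟩ := hopt X
    refine ⟨C, hC, hCL, fun ⟨E, hE, hfit⟩ => ?_⟩
    have hP : X.P ⊆ X.db.adom := fun a ha => X.pos_occurs a ha
    have hN : X.N ⊆ X.db.adom := fun a ha => X.neg_occurs a ha
    rw [DLFitting.Fitting.fits_iff hP hN] at hfit ⊢
    exact hfit.trans (h E hE)
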